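/- Call a finite set of unit vectors in $\mathbb R^d$ a spherical $\{\alpha,\beta\}$-code if the inner product of any two distinct vectors of the set lies in $\{\alpha,\beta\}$, and let $N_{\alpha,\beta}(d)$ be the maximum size of a spherical $\{\alpha,\beta\}$-code in $\mathbb R^d$. For a real number $\lambda>0$ let $k(\lambda)$ be the smallest number of vertices of a graph whose adjacency matrix has largest eigenvalue exactly $\lambda$, with $k(\lambda)=\infty$ if no such graph exists. A signed graph $G^\pm$ is a finite simple graph whose edges are each labelled $+$ or $-$; its signed adjacency matrix has entries $1$ at positive edges, $-1$ at negative edges and $0$ elsewhere. Write $|G^\pm|$ for the number of vertices, $\lambda_1(G^\pm)$ for the largest eigenvalue of the signed adjacency matrix, and $\operatorname{mult}(\lambda,G^\pm)$ for the multiplicity of $\lambda$ as an eigenvalue of it. A valid $t$-coloring of $G^\pm$ colors the vertices with $t$ colors so that the endpoints of every negative edge get distinct colors and the endpoints of every positive edge get identical colors; $\chi(G^\pm)$ is the smallest $t$ for which a valid $t$-coloring exists ($\infty$ if there is none). For $\lambda>0$ and a positive integer $p$ let $$k_p(\lambda)=\inf\left\{\frac{|G^\pm|}{\operatorname{mult}(\lambda,G^\pm)}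 : \chi(G^\pm)\le p,\ \lambda_1(G^\pm)=\lambda\right\},$$ with $\inf\emptyset=\infty$; $k_p(\lambda)$ is called achievable if it is finite and the infimum is attained. **Theorem.** Fix $-1\le\beta<0\le\alpha<1$, and set $\lambda=(1-\alpha)/(\alpha-\beta)$ and $p=\lfloor-\alpha/\beta\rfloor+1$. Below, $O_{\alpha,\beta}(1)$ denotes a quantity bounded in absolute value, for all $d$, by a constant depending only on $\alpha$ and $\beta$, and $o(d)$ refers to $d\to\infty$ with $\alpha,\beta$ fixed. (a) If $p\le 2$, then $N_{\alpha,\beta}(d)=\dfrac{k(\lambda)\,d}{k(\lambda)-1}+O_{\alpha,\beta}(1)$ if $k(\lambda)<\infty$, and $N_{\alpha,\beta}(d)=d+o(d)$ if $k(\lambda)=\infty$. (b) If $\lambda=1$ and $p\ge 2$, then $k_p(1)=p/(p-1)$ and $N_{\alpha,\beta}(d)=pd+O_{\alpha,\beta}(1)$. (c) If $\lambda=\sqrt3$ and $p=3$, then $k_3(\sqrt3)=7/3$ and $N_{\alpha,\beta}(d)=7d/4+O_{\alpha,\beta}(1)$. (d) If $\lambda\in\{\sqrt2,\sqrt3\}$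 and $p\ge\lambda^2+1$, then $k_p(\lambda)=2$ and $N_{\alpha,\beta}(d)=2d+O_{\alpha,\beta}(1)$. Moreover, $k_p(\lambda)$ is achievable for every $\lambda\in\{1,\sqrt2,\sqrt3\}$ and every positive integer $p$. -/

import Mathlib

noncomputable section

/-- A spherical `{α, β}`-code in `ℝ^d`: a finite set of unit vectors whose pairwise inner products
(over distinct vectors) lie in `{α, β}`. -/
def IsSphericalCode (α β : ℝ) (d : ℕ) (C : Finset (EuclideanSpace ℝ (Fin d))) : Prop :=
  (∀ v ∈ C, ‖v‖ = 1) ∧ ∀ v ∈ C, ∀ w ∈ C, v ≠ w → inner ℝ v w = α ∨ inner ℝ v w = β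

/-- The set of all sizes of spherical `{α, β}`-codes in `ℝ^d`. -/
def codeSizes (α β : ℝ) (d : ℕ) : Set ℕ :=
  {n | ∃ C : Finset (EuclideanSpace ℝ (Fin d)), IsSphericalCode α β d C ∧ C.card = n}

/-- `N_{α,β}(d)`: the maximum size of a spherical `{α, β}`-code in `ℝ^d`. (That the maximum exists
is part of the theorem.) -/
def maxCodeSize (α β : ℝ) (d : ℕ) : ℕ := sSup (codeSizes α β d)

/-- `lam` is the largest eigenvalue `λ₁` of the Hermitian matrix `A`. (If the index type is empty,
no real number is.) -/
def IsTopEigenvalue {V : Type*} [Fintype V] [DecidableEq V] {A : Matrix V V ℝ}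
    (hA : A.IsHermitian) (lam : ℝ) : Prop :=
  IsGreatest (Set.range hA.eigenvalues) lam

open Classical in
/-- The graph `G` has spectral radius `λ₁(G)` equal to `lam`. -/
def SimpleGraph.HasSpectralRadius {V : Type*} [Fintype V] (G : SimpleGraph V) (lam : ℝ) : Prop :=
  IsTopEigenvalue (A := G.adjMatrix ℝ) (G.isHermitian_adjMatrix ℝ) lam

/-- The spectral radius order `k(lam)`: the smallest number of vertices of a graph with spectral
radius exactly `lam`, and `⊤` if there is no such graph. -/
def spectralRadiusOrder (lam : ℝ) : ℕ∞ :=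
  sInf {k | ∃ (n : ℕ) (G : SimpleGraph (Fin n)), G.HasSpectralRadius lam ∧ k = (n : ℕ∞)}

/-- A signed graph: a simple graph whose edges are each labelled positive or negative. -/
structure SignedGraph (V : Type*) where
  /-- the graph of positive edges -/
  pos : SimpleGraph V
  /-- the graph of negative edges -/
  neg : SimpleGraph V
  disjoint : Disjoint pos neg

namespace SignedGraph

variable {V : Type*}

open Classical in
/-- The signed adjacency matrix: `1` at positive edges, `-1` at negative edges, `0` elsewhere. -/
def adjMatrix (G : SignedGraph V) : Matrix V V ℝ :=
  Matrix.of fun i j => if G.pos.Adj i j then 1 else if G.neg.Adj i j then -1 else 0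

theorem isHermitian_adjMatrix (G : SignedGraph V) : G.adjMatrix.IsHermitian := by
  ext i j
  have hpos : G.pos.Adj j i ↔ G.pos.Adj i j := G.pos.adj_comm j i
  have hneg : G.neg.Adj j i ↔ G.neg.Adj i j := G.neg.adj_comm j i
  simp only [adjMatrix, Matrix.conjTranspose_apply, Matrix.of_apply, star_trivial]
  by_cases h1 : G.pos.Adj i j <;> by_cases h2 : G.neg.Adj i j <;>
    simp [h1, h2, hpos.2, hneg.2, mt hpos.1, mt hneg.1]

/-- `G` has a valid `t`-coloring: endpoints of negative edges get distinct colors, and endpoints of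
positive edges get identical colors. -/
def ValidColorable (G : SignedGraph V) (t : ℕ) : Prop :=
  ∃ c : V → Fin t, (∀ u v, G.neg.Adj u v → c u ≠ c v) ∧ (∀ u v, G.pos.Adj u v → c u = c v)

/-- The chromatic number: the least `t` such that there is a valid `t`-coloring, `⊤` if none. -/
def chromaticNumber (G : SignedGraph V) : ℕ∞ :=
  sInf {k | ∃ t : ℕ, G.ValidColorable t ∧ k = (t : ℕ∞)}

variable [Fintype V] [DecidableEq V]

/-- `mult(lam, G)`: the number of indices `i` such that the `i`-th eigenvalue of the signed adjacency
matrix is `lam`. -/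
def mult (G : SignedGraph V) (lam : ℝ) : ℕ :=
  Nat.card {i : V // G.isHermitian_adjMatrix.eigenvalues i = lam}

end SignedGraph

/-- The set of all ratios `|G| / mult(lam, G)` over signed graphs `G` with chromatic number at most
`p` and largest eigenvalue `lam`. -/
def signedRatios (p : ℕ) (lam : ℝ) : Set EReal :=
  {x | ∃ (n : ℕ) (G : SignedGraph (Fin n)), G.chromaticNumber ≤ p ∧
    IsTopEigenvalue G.isHermitian_adjMatrix lam ∧ x = (((n : ℝ) / (G.mult lam : ℝ) : ℝ) : EReal)}

/-- The parameter `k_p(lam)`, an infimum of an empty set being `⊤`. -/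
def kParam (p : ℕ) (lam : ℝ) : EReal := sInf (signedRatios p lam)

/-- `k_p(lam)` is achievable: it is finite and the infimum is attained. -/
def IsAchievable (p : ℕ) (lam : ℝ) : Prop :=
  kParam p lam ≠ ⊤ ∧ kParam p lam ∈ signedRatios p lam

/-- `f(d) = g(d) + O(1)` over all `d`. -/
def EqUpToConst (f : ℕ → ℕ) (g : ℕ → ℝ) : Prop :=
  ∃ C : ℝ, ∀ d : ℕ, |(f d : ℝ) - g d| ≤ C

end

/-! Color the vectors of a code with `p` colors, and let `A` be the signed adjacency matrix of the
pairs whose inner product is not the one expected from the colors (`α` inside a class, `β` across).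
The Gram matrix equals `(α - β)(lam - A)` plus a pattern depending only on the colors
(`IsCodeFamily.inner_eq_shiftMatrix`). Vectors with zero sum on each class do not see the pattern.
Hence a code of size `n` in dimension `d` satisfies `n ≤ d + p + mult(lam, A)`, and `lam - A` has at
most `p` negative directions. Conversely, if `λ₁(A) ≤ lam`, disjoint copies of the graph sharing one
color pattern give codes with about `n` vectors for every `n - mult(lam, A)` dimensions
(`mul_card_mem_codeSizes`); the choice of `p` is what makes the pattern positive semidefinite. So
`(1 - κ) N(d) = d + O(1)`, where `κ` is the largest ratio of multiplicity to size.

Upper bounds need a good coloring. After deleting boundedly many vectors there is one for which the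
exceptional pairs form a graph of bounded degree (`exists_structure`). This is a Ramsey argument:
averages over large independent sets have nearly prescribed inner products, and a wrong pattern
would give an explicit combination of negative squared norm.

It remains to bound multiplicities, first when `λ₁ ≤ lam` and then when boundedly many eigenvalues
exceed `lam`. For `lam < 2` a path of bounded length already has larger radius than `lam`, so
deleting a bounded set of vertices restores `λ₁ ≤ lam` (`exists_nullity_bound`). For at most two
colors, switching removes the signs. A connected graph then has a simple top eigenvalue, and a
connected graph of bounded degree with bounded negative index has sublinear multiplicity, by
comparing closed walks before and after the deletion of a net (`exists_sublinear_bound`).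

The extremal ratios are found as follows. For `lam = 1`, an edge forces its ends to be twins, so
degrees are below `p`, and Cauchy-Schwarz on the spectrum bounds the multiplicity
(`nullity_one_le`). For irrational `√k`, conjugation pairs the eigenvalues `√k` and `-√k`, so the
ratio is at most `1/2` for any graph (`two_mul_nullity_le`); the negative square and the signed cube
attain it. For `√3` with three colors, one shows `n ≤ 7R`, where `R` counts the eigenvalues other
than `±√3` (`nullity_sqrt_three_le`). A component containing a claw has at most 8 vertices, one with
a vertex of degree four at most 13, and a trace inequality settles claw-free graphs of degree at
most three. Here `R = 0` would mean `A² = 3`, which three colors do not allow. -/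

section

open Matrix

set_option linter.unusedSectionVars false

/-! ### Kernels, negative index and spectra of symmetric real matrices -/

section LinearAlgebra

open scoped Classical

/-- The dimension of the kernel of a square real matrix. -/
noncomputable def nullity {V : Type*} [Fintype V] (M : Matrix V V ℝ) : ℕ :=
  Module.finrank ℝ (LinearMap.ker M.mulVecLin)

/-- The principal submatrix on the indices satisfying `P`. -/
def restr {V : Type*} (M : Matrix V V ℝ) (P : V → Prop) : Matrix {v // P v} {v // P v} ℝ :=
  M.submatrix Subtype.val Subtype.val

/-- Extension by zero of a function on a subtype. -/
noncomputable def extendZero {V : Type*} {P : V → Prop} (x : {v // P v} → ℝ) : V → ℝ :=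
  fun v => if h : P v then x ⟨v, h⟩ else 0

variable {V : Type*} [Fintype V]

theorem extendZero_val {P : V → Prop} (x : {v // P v} → ℝ) (v : {v // P v}) :
    extendZero x v.1 = x v := by simp [extendZero, v.2]

theorem extendZero_of_not {P : V → Prop} (x : {v // P v} → ℝ) {v : V} (h : ¬ P v) :
    extendZero x v = 0 := by simp [extendZero, h]

theorem sum_subtype_of_eq_zero {P : V → Prop} [Fintype {v // P v}] (f : V → ℝ) (hf : ∀ v, ¬ P v → f v = 0) :
    ∑ v, f v = ∑ v : {v // P v}, f v := by
  rw [← Finset.sum_subtype (Finset.univ.filter P) (by simp) f, Finset.sum_filter]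
  exact Finset.sum_congr rfl fun v _ => by by_cases h : P v <;> simp [h, hf]

theorem mulVec_restr_of_support {P : V → Prop} [Fintype {v // P v}] (M : Matrix V V ℝ) (x : V → ℝ)
    (hx : ∀ v, ¬ P v → x v = 0) (u : {v // P v}) :
    (restr M P *ᵥ fun v => x v) u = (M *ᵥ x) u := by
  simp only [mulVec, dotProduct, restr, submatrix_apply]
  rw [sum_subtype_of_eq_zero (P := P) (fun v => M u v * x v) fun v hv => by simp [hx v hv]]

theorem extendZero_dotProduct_mulVec {P : V → Prop} [Fintype {v // P v}]
    (M : Matrix V V ℝ) (x y : {v // P v} → ℝ) :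
    extendZero x ⬝ᵥ M *ᵥ extendZero y = x ⬝ᵥ restr M P *ᵥ y := by
  have h1 : (restr M P *ᵥ y) = fun u : {v // P v} => (M *ᵥ extendZero y) u := by
    ext u
    rw [← mulVec_restr_of_support M _ fun v hv => extendZero_of_not y hv]
    simp only [extendZero_val]
  rw [h1]
  simp only [dotProduct]
  rw [sum_subtype_of_eq_zero (P := P) _ fun v hv => by simp [extendZero_of_not x hv]]
  simp only [extendZero_val]

/-- Kernel vectors vanishing off `P` are kernel vectors of the principal submatrix, and vanishing
costs one linear condition for each deleted index. -/
theorem nullity_le_restr_add (M : Matrix V V ℝ) (P : V → Prop)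
    [Fintype {v // P v}] [Fintype {v // ¬ P v}] :
    nullity M ≤ nullity (restr M P) + Fintype.card {v // ¬ P v} := by
  let f : LinearMap.ker M.mulVecLin →ₗ[ℝ] ({v // ¬ P v} → ℝ) :=
    (LinearMap.funLeft ℝ ℝ Subtype.val).comp (Submodule.subtype _)
  have h1 := LinearMap.finrank_range_add_finrank_ker f
  have h2 : Module.finrank ℝ (LinearMap.range f) ≤ Fintype.card {v // ¬ P v} := by
    simpa using Submodule.finrank_le (LinearMap.range f)
  have h3 : Module.finrank ℝ (LinearMap.ker f) ≤ nullity (restr M P) := by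
    have hz : ∀ x : LinearMap.ker f, ∀ v, ¬ P v → x.1.1 v = 0 := fun x v hv =>
      congrFun (LinearMap.mem_ker.1 x.2) ⟨v, hv⟩
    let g : LinearMap.ker f →ₗ[ℝ] LinearMap.ker (restr M P).mulVecLin :=
      LinearMap.codRestrict _ ((LinearMap.funLeft ℝ ℝ (Subtype.val : {v // P v} → V)).comp
        ((Submodule.subtype _).comp (Submodule.subtype _))) (by
        intro x
        rw [LinearMap.mem_ker]
        ext u
        have h := mulVec_restr_of_support M x.1.1 (hz x) u
        have h' : M *ᵥ x.1.1 = 0 := x.1.2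
        rw [h'] at h
        exact h)
    refine LinearMap.finrank_le_finrank_of_injective (f := g) fun x y hxy => ?_
    apply Subtype.ext
    apply Subtype.ext
    funext v
    by_cases hv : P v
    · exact congrFun (congrArg Subtype.val hxy) ⟨v, hv⟩
    · rw [hz x v hv, hz y v hv]
  unfold nullity at *
  omega

theorem mulVec_restr_of_split {P : V → Prop} [Fintype {v // P v}] (M : Matrix V V ℝ)
    (hM : ∀ u v, P u → ¬ P v → M u v = 0) (x : V → ℝ) (u : {v // P v}) :
    (restr M P *ᵥ fun v => x v) u = (M *ᵥ x) u := by
  simp only [mulVec, dotProduct, restr, submatrix_apply]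
  rw [sum_subtype_of_eq_zero (P := P) (fun v => M u v * x v) fun v hv => by simp [hM u v u.2 hv]]

theorem nullity_le_add_of_split (M : Matrix V V ℝ) (P : V → Prop)
    [Fintype {v // P v}] [Fintype {v // ¬ P v}]
    (hM : ∀ u v, P u → ¬ P v → M u v = 0) (hM' : ∀ u v, ¬ P u → P v → M u v = 0) :
    nullity M ≤ nullity (restr M P) + nullity (restr M fun v => ¬ P v) := by
  have key : ∀ (Q : V → Prop) [Fintype {v // Q v}], (∀ u v, Q u → ¬ Q v → M u v = 0) →
      ∀ x : LinearMap.ker M.mulVecLin,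
        (fun v : {v // Q v} => x.1 v) ∈ LinearMap.ker (restr M Q).mulVecLin := by
    intro Q _ hQ x
    rw [LinearMap.mem_ker]
    ext u
    have h := mulVec_restr_of_split M hQ x.1 u
    have h' : M *ᵥ x.1 = 0 := x.2
    rw [h'] at h
    exact h
  let g : LinearMap.ker M.mulVecLin →ₗ[ℝ]
      LinearMap.ker (restr M P).mulVecLin × LinearMap.ker (restr M fun v => ¬ P v).mulVecLin :=
    LinearMap.prod
      (LinearMap.codRestrict _ ((LinearMap.funLeft ℝ ℝ (Subtype.val : {v // P v} → V)).comp
        (Submodule.subtype _)) (key P hM))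
      (LinearMap.codRestrict _ ((LinearMap.funLeft ℝ ℝ (Subtype.val : {v // ¬ P v} → V)).comp
        (Submodule.subtype _)) (key _ fun u v hu hv => hM' u v hu (not_not.1 hv)))
  have := LinearMap.finrank_le_finrank_of_injective (f := g) fun x y hxy => by
    apply Subtype.ext
    funext v
    by_cases hv : P v
    · exact congrFun (congrArg Subtype.val (congrArg Prod.fst hxy)) ⟨v, hv⟩
    · exact congrFun (congrArg Subtype.val (congrArg Prod.snd hxy)) ⟨v, hv⟩
  rwa [Module.finrank_prod] at this

theorem nullity_add_rank (M : Matrix V V ℝ) : nullity M + M.rank = Fintype.card V := by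
  have := LinearMap.finrank_range_add_finrank_ker M.mulVecLin
  rw [Module.finrank_pi] at this
  unfold nullity Matrix.rank
  omega

theorem nullity_le_card (M : Matrix V V ℝ) : nullity M ≤ Fintype.card V := by
  have := nullity_add_rank M
  omega

/-- Among `s + 1` pairwise `M`-orthogonal vectors, one has nonnegative `M`-energy. -/
def NegRankLE (M : Matrix V V ℝ) (s : ℕ) : Prop :=
  ∀ x : Fin (s + 1) → V → ℝ, (∀ i j, i ≠ j → x i ⬝ᵥ M *ᵥ x j = 0) → ∃ i, 0 ≤ x i ⬝ᵥ M *ᵥ x i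

theorem NegRankLE.restr {M : Matrix V V ℝ} {s : ℕ} (h : NegRankLE M s) (P : V → Prop)
    [Fintype {v // P v}] : NegRankLE (restr M P) s := by
  intro x hx
  obtain ⟨i, hi⟩ := h (fun i => extendZero (x i)) fun i j hij => by
    rw [extendZero_dotProduct_mulVec, hx i j hij]
  exact ⟨i, by rwa [extendZero_dotProduct_mulVec] at hi⟩

theorem dotProduct_mulVec_symm {M : Matrix V V ℝ} (hM : M.IsHermitian) (x y : V → ℝ) :
    x ⬝ᵥ M *ᵥ y = y ⬝ᵥ M *ᵥ x := by
  have hT : Mᵀ = M := by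
    rw [← conjTranspose_eq_transpose_of_trivial]; exact hM
  rw [dotProduct_mulVec, ← mulVec_transpose, hT, dotProduct_comm]

theorem posSemidef_iff {M : Matrix V V ℝ} (hM : M.IsHermitian) :
    M.PosSemidef ↔ ∀ x : V → ℝ, 0 ≤ x ⬝ᵥ M *ᵥ x := by
  rw [posSemidef_iff_dotProduct_mulVec]
  simp only [star_trivial]
  exact ⟨fun h => h.2, fun h => ⟨hM, h⟩⟩

theorem NegRankLE.posSemidef {M : Matrix V V ℝ} (hM : M.IsHermitian) (h : NegRankLE M 0) :
    M.PosSemidef := by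
  rw [posSemidef_iff hM]
  intro x
  obtain ⟨i, hi⟩ := h (fun _ => x) fun i j hij => absurd (by omega) hij
  exact hi

theorem isHermitian_restr {M : Matrix V V ℝ} (h : M.IsHermitian) (P : V → Prop) :
    (restr M P).IsHermitian := h.submatrix _

theorem mulVec_eq_zero_of_posSemidef {M : Matrix V V ℝ} (h : M.PosSemidef) {x : V → ℝ}
    (hx : x ⬝ᵥ M *ᵥ x = 0) : M *ᵥ x = 0 := by
  have := (h.dotProduct_mulVec_zero_iff x).1
  simp only [star_trivial] at this
  exact this hx

/-- If the form is negative somewhere on one side of a splitting, the other side has smaller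
negative index. -/
theorem NegRankLE.of_split {M : Matrix V V ℝ} {s : ℕ} (h : NegRankLE M s) (P : V → Prop)
    [Fintype {v // P v}] [Fintype {v // ¬ P v}]
    (hM : ∀ u v, P u → ¬ P v → M u v = 0) (hM' : ∀ u v, ¬ P u → P v → M u v = 0)
    (x : {v // P v} → ℝ) (hx : x ⬝ᵥ _root_.restr M P *ᵥ x < 0) :
    0 < s ∧ NegRankLE (_root_.restr M fun v => ¬ P v) (s - 1) := by
  have hs : 0 < s := by
    rcases Nat.eq_zero_or_pos s with rfl | hs
    · obtain ⟨i, hi⟩ := h (fun _ => extendZero x) fun i j hij => absurd (by omega) hij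
      rw [extendZero_dotProduct_mulVec] at hi
      linarith
    · exact hs
  refine ⟨hs, fun y hy => ?_⟩
  obtain ⟨s, rfl⟩ : ∃ t, s = t + 1 := ⟨s - 1, by omega⟩
  have hcross : ∀ (a : {v // P v} → ℝ) (b : {v // ¬ P v} → ℝ),
      extendZero a ⬝ᵥ M *ᵥ extendZero b = 0 ∧ extendZero b ⬝ᵥ M *ᵥ extendZero a = 0 := by
    intro a b
    simp only [dotProduct, mulVec, Finset.mul_sum]
    constructor <;> refine Finset.sum_eq_zero fun u _ => Finset.sum_eq_zero fun v _ => ?_ <;>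
      by_cases hu : P u <;> by_cases hv : P v <;>
      simp [extendZero, hu, hv, hM, hM']
  -- The negative vector on `P`, put in front of a family living off `P`, takes up one place; the
  -- index with nonnegative energy must belong to the rest.
  obtain ⟨i, hi⟩ := h (Fin.cons (extendZero x) fun i => extendZero (y i)) (by
    intro i j
    refine Fin.cases ?_ (fun i => ?_) i <;> refine Fin.cases ?_ (fun j => ?_) j
    · simp
    · intro _
      simpa using (hcross x (y j)).1
    · intro _
      simpa using (hcross x (y i)).2
    · intro hij
      simp only [Fin.cons_succ, extendZero_dotProduct_mulVec]
      exact hy i j fun h => hij (by rw [h]))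
  revert hi
  refine Fin.cases ?_ (fun i => ?_) i
  · simp only [Fin.cons_zero, extendZero_dotProduct_mulVec]
    intro h
    linarith
  · simp only [Fin.cons_succ, extendZero_dotProduct_mulVec]
    exact fun h => ⟨i, h⟩

variable [DecidableEq V]

theorem exists_spectral {A : Matrix V V ℝ} (hA : A.IsHermitian) :
    ∃ U : Matrix V V ℝ, U * Uᵀ = 1 ∧ Uᵀ * U = 1 ∧ A = U * diagonal hA.eigenvalues * Uᵀ := by
  refine ⟨hA.eigenvectorUnitary, ?_, ?_, ?_⟩
  · have := Unitary.coe_mul_star_self hA.eigenvectorUnitary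
    simpa [star_eq_conjTranspose, conjTranspose_eq_transpose_of_trivial] using this
  · have := Unitary.coe_star_mul_self hA.eigenvectorUnitary
    simpa [star_eq_conjTranspose, conjTranspose_eq_transpose_of_trivial] using this
  · have := hA.spectral_theorem
    rw [Unitary.conjStarAlgAut_apply] at this
    simpa [star_eq_conjTranspose, conjTranspose_eq_transpose_of_trivial, Function.comp_def] using this

theorem spectral_sub {A : Matrix V V ℝ} (hA : A.IsHermitian) {U : Matrix V V ℝ}
    (h1 : U * Uᵀ = 1) (h3 : A = U * diagonal hA.eigenvalues * Uᵀ) (lam : ℝ) :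
    lam • (1 : Matrix V V ℝ) - A = U * diagonal (fun i => lam - hA.eigenvalues i) * Uᵀ := by
  have : diagonal (fun i => lam - hA.eigenvalues i) = lam • (1 : Matrix V V ℝ) -
      diagonal hA.eigenvalues := by
    ext i j
    by_cases h : i = j
    · subst h; simp
    · simp [h]
  rw [this, Matrix.mul_sub, Matrix.sub_mul, ← h3]
  simp [h1]

theorem trace_pow_eq_sum {A : Matrix V V ℝ} (hA : A.IsHermitian) (k : ℕ) :
    (A ^ k).trace = ∑ i, hA.eigenvalues i ^ k := by
  obtain ⟨U, h1, h2, h3⟩ := exists_spectral hA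
  have : A ^ k = U * diagonal (fun i => hA.eigenvalues i ^ k) * Uᵀ := by
    induction k with
    | zero => simp [h1]
    | succ k ih =>
      rw [pow_succ, ih]
      nth_rewrite 2 [h3]
      calc _ = U * diagonal (fun i => hA.eigenvalues i ^ k) * (Uᵀ * U) *
            diagonal hA.eigenvalues * Uᵀ := by simp only [Matrix.mul_assoc]
        _ = _ := by
          rw [h2, Matrix.mul_one, Matrix.mul_assoc U, diagonal_mul_diagonal]
          simp [pow_succ]
  rw [this, trace_mul_comm, ← Matrix.mul_assoc, h2, Matrix.one_mul, trace_diagonal]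

theorem card_eigenvalues_eq_nullity {A : Matrix V V ℝ} (hA : A.IsHermitian) (lam : ℝ) :
    Nat.card {i // hA.eigenvalues i = lam} = nullity (lam • (1 : Matrix V V ℝ) - A) := by
  obtain ⟨U, h1, h2, h3⟩ := exists_spectral hA
  have hr : (lam • (1 : Matrix V V ℝ) - A).rank =
      Fintype.card {i // lam - hA.eigenvalues i ≠ 0} := by
    rw [spectral_sub hA h1 h3 lam]
    have hU : IsUnit U.det := by
      have := congrArg det h1
      rw [det_mul, det_one] at this
      exact IsUnit.of_mul_eq_one _ this
    have hU' : IsUnit Uᵀ.det := by simpa using hU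
    rw [rank_mul_eq_left_of_isUnit_det _ _ hU', rank_mul_eq_right_of_isUnit_det _ _ hU,
      rank_diagonal]
  have h4 := nullity_add_rank (lam • (1 : Matrix V V ℝ) - A)
  rw [hr] at h4
  have h5 := Fintype.card_subtype_compl (fun i => lam - hA.eigenvalues i ≠ 0)
  have h6 : Fintype.card {i // ¬ (lam - hA.eigenvalues i ≠ 0)} =
      Nat.card {i // hA.eigenvalues i = lam} := by
    rw [Nat.card_eq_fintype_card]
    exact Fintype.card_congr (Equiv.subtypeEquivRight fun i => by
      rw [not_not, sub_eq_zero, eq_comm])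
  have h7 := Fintype.card_subtype_le (fun i => lam - hA.eigenvalues i ≠ 0)
  omega

theorem isHermitian_smul_one_sub {A : Matrix V V ℝ} (hA : A.IsHermitian) (lam : ℝ) :
    (lam • (1 : Matrix V V ℝ) - A).IsHermitian := by
  refine IsHermitian.sub ?_ hA
  simp [Matrix.IsHermitian]

theorem posSemidef_iff_eigenvalues_le {A : Matrix V V ℝ} (hA : A.IsHermitian) (lam : ℝ) :
    (lam • (1 : Matrix V V ℝ) - A).PosSemidef ↔ ∀ i, hA.eigenvalues i ≤ lam := by
  obtain ⟨U, h1, h2, h3⟩ := exists_spectral hA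
  constructor
  · intro h i
    have h4 := h.dotProduct_mulVec_nonneg (U *ᵥ Pi.single i 1)
    rw [spectral_sub hA h1 h3 lam, star_trivial, mulVec_mulVec, Matrix.mul_assoc, h2,
      Matrix.mul_one, dotProduct_mulVec, ← vecMul_vecMul, ← mulVec_transpose U, mulVec_mulVec, h2,
      one_mulVec, ← dotProduct_mulVec] at h4
    simpa using h4
  · intro h
    rw [spectral_sub hA h1 h3 lam]
    have := (PosSemidef.diagonal (d := fun i => lam - hA.eigenvalues i)
      fun i => sub_nonneg.2 (h i)).mul_mul_conjTranspose_same U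
    simpa [conjTranspose_eq_transpose_of_trivial] using this

/-- Replaces the enumeration of eigenvalues by a form and a kernel, both of which behave well when
vertices are deleted. -/
theorem isTopEigenvalue_iff {A : Matrix V V ℝ} (hA : A.IsHermitian) (lam : ℝ) :
    IsTopEigenvalue hA lam ↔ (lam • (1 : Matrix V V ℝ) - A).PosSemidef ∧
      0 < nullity (lam • (1 : Matrix V V ℝ) - A) := by
  rw [posSemidef_iff_eigenvalues_le hA, ← card_eigenvalues_eq_nullity hA]
  unfold IsTopEigenvalue IsGreatest upperBounds
  rw [Nat.card_eq_fintype_card, Fintype.card_pos_iff]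
  simp only [Set.mem_range, Set.mem_ofPred_eq, forall_exists_index, forall_apply_eq_imp_iff,
    nonempty_subtype]
  tauto

end LinearAlgebra

/-! ### Signed adjacency matrices of colored graphs -/

section ColoredMatrix

open scoped Classical

/-- The signed adjacency matrix of a graph whose edges are positive inside a color class and
negative between color classes. -/
noncomputable def colMatrix {V κ : Type*} (H : SimpleGraph V) (c : V → κ) : Matrix V V ℝ :=
  of fun u v => if H.Adj u v then if c u = c v then 1 else -1 else 0

variable {V κ : Type*} {H : SimpleGraph V} {c : V → κ}

theorem colMatrix_apply (u v : V) :
    colMatrix H c u v = if H.Adj u v then if c u = c v then 1 else -1 else 0 := rfl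

theorem colMatrix_symm (u v : V) : colMatrix H c u v = colMatrix H c v u := by
  simp only [colMatrix_apply, H.adj_comm u v, eq_comm (a := c u)]

theorem isHermitian_colMatrix : (colMatrix H c).IsHermitian := by
  ext u v
  simp [conjTranspose_apply, colMatrix_symm v u]

theorem colMatrix_self (u : V) : colMatrix H c u u = 0 := by simp [colMatrix_apply]

theorem colMatrix_of_not_adj {u v : V} (h : ¬ H.Adj u v) : colMatrix H c u v = 0 := by
  simp [colMatrix_apply, h]

theorem colMatrix_sq {u v : V} (h : H.Adj u v) : colMatrix H c u v * colMatrix H c u v = 1 := by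
  by_cases h' : c u = c v <;> simp [colMatrix_apply, h, h']

theorem colMatrix_eq_or {u v : V} (h : H.Adj u v) :
    colMatrix H c u v = 1 ∨ colMatrix H c u v = -1 := by
  by_cases h' : c u = c v <;> simp [colMatrix_apply, h, h']

theorem colMatrix_ne_zero_iff {u v : V} : colMatrix H c u v ≠ 0 ↔ H.Adj u v := by
  by_cases h : H.Adj u v <;> by_cases h' : c u = c v <;> simp [colMatrix_apply, h, h']

variable [Fintype V] [DecidableEq V]

/-- `lam` minus the signed adjacency matrix. -/
noncomputable def shiftMatrix (lam : ℝ) (H : SimpleGraph V) (c : V → κ) : Matrix V V ℝ :=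
  lam • (1 : Matrix V V ℝ) - colMatrix H c

theorem isHermitian_shiftMatrix (lam : ℝ) : (shiftMatrix lam H c).IsHermitian :=
  isHermitian_smul_one_sub isHermitian_colMatrix lam

theorem shiftMatrix_self (lam : ℝ) (u : V) : shiftMatrix lam H c u u = lam := by
  simp [shiftMatrix, colMatrix_self]

theorem shiftMatrix_of_ne (lam : ℝ) {u v : V} (h : u ≠ v) :
    shiftMatrix lam H c u v = - colMatrix H c u v := by
  simp [shiftMatrix, h]

theorem shiftMatrix_eq_zero (lam : ℝ) {u v : V} (h : u ≠ v) (h' : ¬ H.Adj u v) :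
    shiftMatrix lam H c u v = 0 := by
  simp [shiftMatrix_of_ne lam h, colMatrix_of_not_adj h']

theorem restr_shiftMatrix (lam : ℝ) (P : V → Prop) [DecidableEq {v // P v}] :
    restr (shiftMatrix lam H c) P =
      shiftMatrix lam (H.comap (Subtype.val : {v // P v} → V)) (c ∘ Subtype.val) := by
  ext u v
  by_cases h : u = v
  · subst h
    simp [restr, shiftMatrix_self]
  · rw [shiftMatrix_of_ne lam h, restr, submatrix_apply,
      shiftMatrix_of_ne lam fun h' => h (Subtype.ext h')]
    rfl

theorem mulVec_shiftMatrix (lam : ℝ) (x : V → ℝ) (u : V) :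
    (shiftMatrix lam H c *ᵥ x) u = lam * x u - ∑ v, colMatrix H c u v * x v := by
  rw [shiftMatrix, sub_mulVec, smul_mulVec, one_mulVec]
  simp [mulVec, dotProduct]

/-- The quadratic form of `lam - A`. -/
theorem shiftMatrix_form (lam : ℝ) (x : V → ℝ) :
    x ⬝ᵥ shiftMatrix lam H c *ᵥ x =
      lam * ∑ v, x v ^ 2 - ∑ u, ∑ v, colMatrix H c u v * (x u * x v) := by
  simp only [dotProduct, mulVec_shiftMatrix, mul_sub, Finset.sum_sub_distrib, Finset.mul_sum]
  congr 1
  · exact Finset.sum_congr rfl fun v _ => by ring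
  · exact Finset.sum_congr rfl fun u _ => Finset.sum_congr rfl fun v _ => by ring

theorem trace_colMatrix : (colMatrix H c).trace = 0 := by
  simp [trace, colMatrix_self]

theorem trace_colMatrix_sq : (colMatrix H c ^ 2).trace = ∑ v, (H.degree v : ℝ) := by
  rw [pow_two, trace]
  refine Finset.sum_congr rfl fun v _ => ?_
  rw [diag_apply, mul_apply, ← SimpleGraph.card_neighborFinset_eq_degree,
    SimpleGraph.neighborFinset_eq_filter, Finset.card_filter]
  push_cast
  refine Finset.sum_congr rfl fun u _ => ?_
  rw [colMatrix_symm u v]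
  by_cases h : H.Adj v u
  · simp [colMatrix_sq h, h]
  · simp [colMatrix_of_not_adj h, h]

end ColoredMatrix

/-! ### Signed graphs of bounded chromatic number as colored graphs -/

section SignedGraphs

open scoped Classical

variable {V : Type*}

/-- A valid coloring determines all signs, so it is enough to study arbitrary graphs with arbitrary
vertex colorings. -/
theorem SignedGraph.ValidColorable.exists_colMatrix {G : SignedGraph V} {t : ℕ}
    (h : G.ValidColorable t) : ∃ c : V → Fin t, G.adjMatrix = colMatrix (G.pos ⊔ G.neg) c := by
  obtain ⟨c, hn, hp⟩ := h
  refine ⟨c, ?_⟩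
  ext u v
  simp only [SignedGraph.adjMatrix, of_apply, colMatrix_apply, SimpleGraph.sup_adj]
  by_cases h1 : G.pos.Adj u v
  · simp [h1, hp u v h1]
  · by_cases h2 : G.neg.Adj u v
    · simp [h1, h2, hn u v h2]
    · simp [h1, h2]

theorem SignedGraph.chromaticNumber_le_iff {G : SignedGraph V} {p : ℕ} :
    G.chromaticNumber ≤ p ↔ G.ValidColorable p := by
  constructor
  · intro h
    have hne : {k : ℕ∞ | ∃ t : ℕ, G.ValidColorable t ∧ k = (t : ℕ∞)}.Nonempty := by
      by_contra hne
      rw [Set.not_nonempty_iff_eq_empty] at hne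
      rw [SignedGraph.chromaticNumber, hne, sInf_empty] at h
      simp at h
    obtain ⟨t, ⟨c, hn, hp⟩, ht⟩ := csInf_mem hne
    have htp : t ≤ p := by
      rw [SignedGraph.chromaticNumber, ht] at h
      exact_mod_cast h
    exact ⟨fun v => Fin.castLE htp (c v), fun u v huv h' => hn u v huv (Fin.castLE_injective htp h'),
      fun u v huv => by simp [hp u v huv]⟩
  · exact fun h => sInf_le ⟨p, h, rfl⟩

/-- The signed graph of a colored graph. -/
def SignedGraph.ofColoring {κ : Type*} (H : SimpleGraph V) (c : V → κ) : SignedGraph V where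
  pos := { Adj := fun u v => H.Adj u v ∧ c u = c v
           symm := ⟨fun _ _ h => ⟨h.1.symm, h.2.symm⟩⟩
           loopless := ⟨fun _ h => H.loopless.irrefl _ h.1⟩ }
  neg := { Adj := fun u v => H.Adj u v ∧ c u ≠ c v
           symm := ⟨fun _ _ h => ⟨h.1.symm, h.2.symm⟩⟩
           loopless := ⟨fun _ h => H.loopless.irrefl _ h.1⟩ }
  disjoint := by
    rw [disjoint_iff]
    ext u v
    simp only [SimpleGraph.inf_adj, SimpleGraph.bot_adj, iff_false]
    exact fun h => h.2.2 h.1.2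

theorem SignedGraph.adjMatrix_ofColoring {κ : Type*} (H : SimpleGraph V) (c : V → κ) :
    (SignedGraph.ofColoring H c).adjMatrix = colMatrix H c := by
  ext u v
  simp only [SignedGraph.adjMatrix, of_apply, colMatrix_apply, SignedGraph.ofColoring]
  by_cases h1 : H.Adj u v <;> by_cases h2 : c u = c v <;> simp [h1, h2]

theorem SignedGraph.validColorable_ofColoring {t : ℕ} (H : SimpleGraph V) (c : V → Fin t) :
    (SignedGraph.ofColoring H c).ValidColorable t :=
  ⟨c, fun _ _ h => h.2, fun _ _ h => h.2⟩

theorem SignedGraph.mult_eq_nullity [Fintype V] [DecidableEq V] (G : SignedGraph V) (lam : ℝ) :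
    G.mult lam = nullity (lam • (1 : Matrix V V ℝ) - G.adjMatrix) :=
  card_eigenvalues_eq_nullity _ lam

/-- `k_p(lam) = r` is attained as soon as `r` bounds all ratios from below and is one of them. -/
theorem kParam_eq_and_isAchievable {p : ℕ} {lam r : ℝ}
    (hle : ∀ (n : ℕ) (H : SimpleGraph (Fin n)) (c : Fin n → Fin p),
      (shiftMatrix lam H c).PosSemidef → r * nullity (shiftMatrix lam H c) ≤ n)
    {n₀ : ℕ} (H₀ : SimpleGraph (Fin n₀)) (c₀ : Fin n₀ → Fin p)
    (hpsd : (shiftMatrix lam H₀ c₀).PosSemidef) (hpos : 0 < nullity (shiftMatrix lam H₀ c₀))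
    (hn₀ : r * nullity (shiftMatrix lam H₀ c₀) = n₀) :
    kParam p lam = (r : EReal) ∧ IsAchievable p lam := by
  have hmem : (r : EReal) ∈ signedRatios p lam := by
    refine ⟨n₀, SignedGraph.ofColoring H₀ c₀,
      SignedGraph.chromaticNumber_le_iff.2 (SignedGraph.validColorable_ofColoring H₀ c₀), ?_, ?_⟩
    · rw [isTopEigenvalue_iff, SignedGraph.adjMatrix_ofColoring]
      exact ⟨hpsd, hpos⟩
    · rw [SignedGraph.mult_eq_nullity, SignedGraph.adjMatrix_ofColoring]
      have : (nullity (shiftMatrix lam H₀ c₀) : ℝ) ≠ 0 := by positivity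
      congr 1
      rw [← hn₀]
      change r = _ / (nullity (shiftMatrix lam H₀ c₀) : ℝ)
      field_simp
  have hlb : ∀ x ∈ signedRatios p lam, (r : EReal) ≤ x := by
    rintro x ⟨n, G, hG, htop, rfl⟩
    obtain ⟨c, hc⟩ := (SignedGraph.chromaticNumber_le_iff.1 hG).exists_colMatrix
    rw [isTopEigenvalue_iff, hc] at htop
    rw [SignedGraph.mult_eq_nullity, hc]
    have h1 := hle n _ c htop.1
    have h2 : (0 : ℝ) < nullity (shiftMatrix lam (G.pos ⊔ G.neg) c) := by exact_mod_cast htop.2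
    exact_mod_cast (le_div_iff₀ h2).2 h1
  have hk : kParam p lam = (r : EReal) := le_antisymm (sInf_le hmem) (le_sInf hlb)
  exact ⟨hk, by rw [hk]; exact EReal.coe_ne_top r, by rw [hk]; exact hmem⟩

end SignedGraphs

/-! ### Existence of the maximum and codes built from graphs -/

section Constructions

open scoped Classical

variable {α β : ℝ}

/-- Distinct code vectors are at distance at least `2 * ε`, so each ball of a finite `ε`-cover of
the compact sphere contains at most one of them. -/
theorem bddAbove_codeSizes (hβ : β < 1) (hα : α < 1) (d : ℕ) : BddAbove (codeSizes α β d) := by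
  set m := max α β with hm
  have hm1 : m < 1 := max_lt hα hβ
  set ε := Real.sqrt (2 - 2 * m) / 2 with hε
  have hε0 : 0 < ε := by
    have : 0 < Real.sqrt (2 - 2 * m) := Real.sqrt_pos.2 (by linarith)
    positivity
  obtain ⟨t, ht, htc⟩ := Metric.totallyBounded_iff.1
    (isCompact_sphere (0 : EuclideanSpace ℝ (Fin d)) 1).totallyBounded ε hε0
  refine ⟨ht.toFinset.card, ?_⟩
  rintro n ⟨C, ⟨hC1, hC2⟩, rfl⟩
  have hex : ∀ v ∈ C, ∃ y ∈ t, dist v y < ε := by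
    intro v hv
    have := htc (show v ∈ Metric.sphere (0 : EuclideanSpace ℝ (Fin d)) 1 by simpa using hC1 v hv)
    simpa using this
  choose! f hf hfd using hex
  refine Finset.card_le_card_of_injOn f (fun v hv => by simpa using hf v hv) ?_
  intro v hv w hw hvw
  by_contra hne
  have h1 : dist v w < 2 * ε := by
    have a := hfd v hv
    have b := hfd w hw
    rw [hvw] at a
    have := dist_triangle_right v w (f w)
    linarith
  have h2 : inner ℝ v w ≤ m := by
    rcases hC2 v hv w hw hne with h | h <;> rw [h]
    · exact le_max_left _ _
    · exact le_max_right _ _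
  have h3 : dist v w ^ 2 = 2 - 2 * inner ℝ v w := by
    rw [dist_eq_norm, norm_sub_sq_real, hC1 v hv, hC1 w hw]
    ring
  have h4 : (2 * ε) ^ 2 = 2 - 2 * m := by
    rw [hε, mul_div_cancel₀ _ (by norm_num : (2 : ℝ) ≠ 0), Real.sq_sqrt (by linarith)]
  have h5 : dist v w ^ 2 < (2 * ε) ^ 2 := by gcongr
  linarith

theorem isGreatest_maxCodeSize (hβ : β < 1) (hα : α < 1) (d : ℕ) :
    IsGreatest (codeSizes α β d) (maxCodeSize α β d) := by
  have hne : (codeSizes α β d).Nonempty := ⟨0, ∅, ⟨by simp, by simp⟩, rfl⟩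
  exact ⟨Nat.sSup_mem hne (bddAbove_codeSizes hβ hα d),
    fun n hn => le_csSup (bddAbove_codeSizes hβ hα d) hn⟩

/-- A family of coordinate vectors with the right Gram matrix gives a spherical code. -/
theorem card_mem_codeSizes {V ι : Type*} [Fintype V] [Fintype ι] {d : ℕ}
    (hβ : β < 1) (hα : α < 1) (w : V → ι → ℝ) (hd : Fintype.card ι ≤ d)
    (h1 : ∀ u, ∑ k, w u k * w u k = 1)
    (h2 : ∀ u v, u ≠ v → ∑ k, w u k * w v k = α ∨ ∑ k, w u k * w v k = β) :
    Fintype.card V ∈ codeSizes α β d := by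
  obtain ⟨e⟩ : Nonempty (ι ↪ Fin d) :=
    Function.Embedding.nonempty_of_card_le (by simpa using hd)
  let W : V → EuclideanSpace ℝ (Fin d) := fun u => WithLp.toLp 2 (Function.extend e (w u) 0)
  have hip : ∀ u v, inner ℝ (W u) (W v) = ∑ k, w u k * w v k := by
    intro u v
    rw [PiLp.inner_apply]
    refine (Fintype.sum_of_injective e e.injective _ _ ?_ ?_).symm
    · intro j hj
      have hj' : ¬ ∃ a, e a = j := fun ⟨a, ha⟩ => hj ⟨a, ha⟩
      simp [W, Function.extend_apply' _ _ _ hj']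
    · intro k
      simp [W, e.injective.extend_apply, mul_comm]
  have hinj : Function.Injective W := by
    intro u v huv
    by_contra hne
    have h3 := hip u v
    rw [← huv, hip u u, h1] at h3
    rcases h2 u v hne with h | h <;> rw [h] at h3 <;> linarith
  refine ⟨Finset.univ.map ⟨W, hinj⟩, ⟨?_, ?_⟩, by simp⟩
  · intro x hx
    obtain ⟨u, -, rfl⟩ := Finset.mem_map.1 hx
    have h3 := hip u u
    rw [h1, real_inner_self_eq_norm_sq] at h3
    exact (pow_eq_one_iff_of_nonneg (norm_nonneg (W u)) two_ne_zero).1 h3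
  · intro x hx y hy hxy
    obtain ⟨u, -, rfl⟩ := Finset.mem_map.1 hx
    obtain ⟨v, -, rfl⟩ := Finset.mem_map.1 hy
    have hne : u ≠ v := fun h => hxy (by rw [h])
    simpa only [Function.Embedding.coeFn_mk, hip] using h2 u v hne

/-- Vectors realizing inner products `α` (equal colors) and `β` (distinct colors). -/
theorem exists_color_vectors {p : ℕ} (hp : 0 ≤ α + (p - 1) * β) (hβ0 : β < 0) :
    ∃ F : Matrix (Fin p) (Fin p) ℝ, ∀ x y, ∑ a, F a x * F a y = if x = y then α else β := by
  let f : Matrix (Fin p) (Fin p) ℝ := of fun x y => if x = y then α else β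
  have hf : f.IsHermitian := by
    ext x y
    simp [f, conjTranspose_apply, eq_comm]
  have hpsd : f.PosSemidef := by
    rw [posSemidef_iff hf]
    intro x
    have h1 : x ⬝ᵥ f *ᵥ x = (α - β) * ∑ a, x a ^ 2 + β * (∑ a, x a) ^ 2 := by
      have hfm : ∀ a, (f *ᵥ x) a = (α - β) * x a + β * ∑ b, x b := by
        intro a
        have : ∀ b, f a b * x b = (if a = b then (α - β) * x b else 0) + β * x b := by
          intro b
          by_cases h : a = b <;> simp [f, h]
          ring
        simp only [mulVec, dotProduct, this, Finset.sum_add_distrib, ← Finset.mul_sum]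
        simp
      simp only [dotProduct, hfm, mul_add, Finset.sum_add_distrib]
      rw [← Finset.sum_mul, pow_two (∑ a, x a)]
      congr 1
      · rw [Finset.mul_sum]
        exact Finset.sum_congr rfl fun a _ => by ring
      · ring
    -- Since `β < 0`, Cauchy-Schwarz bounds the form below by `(α + (p - 1) * β) * ∑ x²`.
    have h2 : (∑ a, x a) ^ 2 ≤ p * ∑ a, x a ^ 2 := by
      simpa using sq_sum_le_card_mul_sum_sq (s := Finset.univ) (f := x)
    have h3 : 0 ≤ ∑ a, x a ^ 2 := Finset.sum_nonneg fun a _ => sq_nonneg _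
    rw [h1]
    nlinarith [mul_le_mul_of_nonpos_left h2 hβ0.le, mul_nonneg hp h3]
  obtain ⟨U, -, -, h3⟩ := exists_spectral hf
  refine ⟨of fun a x => √(hf.eigenvalues a) * U x a, fun x y => ?_⟩
  have h4 := congrFun (congrFun h3 x) y
  rw [Matrix.mul_apply] at h4
  change _ = f x y
  rw [h4]
  refine Finset.sum_congr rfl fun a _ => ?_
  have : √(hf.eigenvalues a) * √(hf.eigenvalues a) = hf.eigenvalues a :=
    Real.mul_self_sqrt (hpsd.eigenvalues_nonneg a)
  simp only [of_apply, mul_diagonal, transpose_apply]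
  linear_combination (U x a * U y a) * this

/-- Disjoint copies of a colored graph with largest eigenvalue at most `lam` give codes. -/
theorem mul_card_mem_codeSizes {V : Type*} [Fintype V] [DecidableEq V] {p : ℕ} {lam : ℝ}
    (hβ0 : β < 0) (hα0 : 0 ≤ α) (hα : α < 1) (hlam : lam = (1 - α) / (α - β))
    (hp : 0 ≤ α + (p - 1) * β) (H : SimpleGraph V) (c : V → Fin p)
    (hpsd : (shiftMatrix lam H c).PosSemidef) (l d : ℕ)
    (hd : l * (Fintype.card V - nullity (shiftMatrix lam H c)) + p ≤ d) :
    l * Fintype.card V ∈ codeSizes α β d := by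
  have hαβ : 0 < α - β := by linarith
  have hlam' : (α - β) * lam = 1 - α := by rw [hlam]; field_simp
  obtain ⟨F, hF⟩ := exists_color_vectors hp hβ0
  have hA : (colMatrix H c).IsHermitian := isHermitian_colMatrix
  obtain ⟨U, h1, -, h3⟩ := exists_spectral hA
  have hle := (posSemidef_iff_eigenvalues_le hA lam).1 hpsd
  -- Coordinates belonging to the eigenvalue `lam` vanish and are dropped, which is where the
  -- multiplicity is gained.
  have hent : ∀ u v, ∑ k : {k // hA.eigenvalues k ≠ lam},
      (√((α - β) * (lam - hA.eigenvalues k)) * U u k) *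
      (√((α - β) * (lam - hA.eigenvalues k)) * U v k) = (α - β) * shiftMatrix lam H c u v := by
    intro u v
    have e1 := congrFun (congrFun (spectral_sub hA h1 h3 lam) u) v
    rw [shiftMatrix, e1, Matrix.mul_apply, Finset.mul_sum,
      sum_subtype_of_eq_zero (P := fun k => hA.eigenvalues k ≠ lam)]
    · refine Finset.sum_congr rfl fun k _ => ?_
      have : √((α - β) * (lam - hA.eigenvalues k)) * √((α - β) * (lam - hA.eigenvalues k)) =
          (α - β) * (lam - hA.eigenvalues k) :=
        Real.mul_self_sqrt (mul_nonneg hαβ.le (sub_nonneg.2 (hle k)))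
      rw [mul_diagonal, transpose_apply]
      linear_combination (U u k * U v k) * this
    · intro k hk
      rw [not_not] at hk
      simp [mul_diagonal, hk]
  -- Each copy has its own spectral coordinates, while the `p` color coordinates are shared by all
  -- copies.
  let w : Fin l × V → (Fin l × {k // hA.eigenvalues k ≠ lam}) ⊕ Fin p → ℝ := fun x =>
    Sum.elim (fun y => if x.1 = y.1 then
      √((α - β) * (lam - hA.eigenvalues y.2)) * U x.2 y.2 else 0) (fun a => F a (c x.2))
  have hw : ∀ x y, ∑ k, w x k * w y k =
      (if x.1 = y.1 then (α - β) * shiftMatrix lam H c x.2 y.2 else 0) +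
        if c x.2 = c y.2 then α else β := by
    intro x y
    rw [Fintype.sum_sum_type, Fintype.sum_prod_type]
    simp only [w, Sum.elim_inl, Sum.elim_inr, hF]
    congr 1
    by_cases hxy : x.1 = y.1
    · rw [if_pos hxy, Finset.sum_eq_single y.1]
      · rw [← hent]
        exact Finset.sum_congr rfl fun k _ => by simp [hxy]
      · intro j _ hj
        exact Finset.sum_eq_zero fun k _ => by simp [Ne.symm hj]
      · simp
    · rw [if_neg hxy]
      refine Finset.sum_eq_zero fun j _ => Finset.sum_eq_zero fun k _ => ?_
      by_cases hj : x.1 = j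
      · have : y.1 ≠ j := fun h => hxy (hj.trans h.symm)
        simp [this]
      · simp [hj]
  have hcard : Fintype.card {k // hA.eigenvalues k ≠ lam} =
      Fintype.card V - nullity (shiftMatrix lam H c) := by
    have := card_eigenvalues_eq_nullity hA lam
    rw [Nat.card_eq_fintype_card] at this
    have h5 := Fintype.card_subtype_compl (fun k => hA.eigenvalues k = lam)
    rw [this] at h5
    exact h5
  have hβ1 : β < 1 := by linarith
  rw [show l * Fintype.card V = Fintype.card (Fin l × V) by simp]
  refine card_mem_codeSizes (d := d) hβ1 hα w ?_ ?_ ?_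
  · simpa [hcard] using hd
  · intro x
    rw [hw]
    simp only [if_true, shiftMatrix_self]
    linarith
  · intro x y hxy
    rw [hw]
    by_cases h1 : x.1 = y.1
    · have h2 : x.2 ≠ y.2 := fun h => hxy (Prod.ext h1 h)
      rw [if_pos h1, shiftMatrix_of_ne lam h2, colMatrix_apply]
      by_cases h3 : H.Adj x.2 y.2 <;> by_cases h4 : c x.2 = c y.2 <;> simp [h3, h4]
    · rw [if_neg h1, zero_add]
      by_cases h4 : c x.2 = c y.2 <;> simp [h4]

/-- The asymptotic lower bound coming from a colored graph. -/
theorem exists_lower_bound {V : Type*} [Fintype V] [DecidableEq V] {p : ℕ} {lam : ℝ}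
    (hβ0 : β < 0) (hα0 : 0 ≤ α) (hα : α < 1) (hlam : lam = (1 - α) / (α - β))
    (hp : 0 ≤ α + (p - 1) * β) (H : SimpleGraph V) (c : V → Fin p)
    (hpsd : (shiftMatrix lam H c).PosSemidef) {κ : ℝ} (hκ : κ < 1)
    (hκn : (nullity (shiftMatrix lam H c) : ℝ) = κ * Fintype.card V) [Nonempty V] :
    ∃ C : ℝ, ∀ d : ℕ, (d : ℝ) - C ≤ (1 - κ) * maxCodeSize α β d := by
  set n := Fintype.card V with hn
  set m := nullity (shiftMatrix lam H c) with hm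
  have hn0 : 0 < n := Fintype.card_pos
  have hn0' : (0 : ℝ) < n := by exact_mod_cast hn0
  have hmn : m < n := by
    have : (m : ℝ) < n := by rw [hκn]; nlinarith
    exact_mod_cast this
  have hcast : ((n - m : ℕ) : ℝ) = (1 - κ) * n := by
    rw [Nat.cast_sub hmn.le, hκn]
    ring
  refine ⟨p + (1 - κ) * n, fun d => ?_⟩
  by_cases hdp : p ≤ d
  · set l := (d - p) / (n - m) with hl
    have h1 : l * (n - m) + p ≤ d := by
      have : l * (n - m) ≤ d - p := Nat.div_mul_le_self (d - p) (n - m)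
      omega
    have h2 := (isGreatest_maxCodeSize (by linarith) hα d).2
      (mul_card_mem_codeSizes hβ0 hα0 hα hlam hp H c hpsd l d h1)
    have h3 : d - p < (l + 1) * (n - m) := by
      have := Nat.lt_mul_div_succ (d - p) (show 0 < n - m by omega)
      rwa [mul_comm] at this
    have h4 : ((d - p : ℕ) : ℝ) < (l + 1) * ((n - m : ℕ) : ℝ) := by exact_mod_cast h3
    rw [Nat.cast_sub hdp, hcast] at h4
    have h5 : (l : ℝ) * n ≤ maxCodeSize α β d := by exact_mod_cast h2
    nlinarith
  · have h1 : (d : ℝ) ≤ p := by exact_mod_cast (not_le.1 hdp).le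
    have h2 : 0 ≤ (1 - κ) * (maxCodeSize α β d : ℝ) := by
      have : 0 < 1 - κ := by linarith
      positivity
    have h3 : 0 ≤ (1 - κ) * n := by
      have : 0 < 1 - κ := by linarith
      positivity
    linarith

end Constructions

/-! ### Ramsey's theorem for cliques and independent sets -/

section Ramsey

open scoped Classical

/-- An upper bound for the graph Ramsey number. -/
def ramseyBound : ℕ → ℕ → ℕ
  | 0, _ => 0
  | _ + 1, 0 => 0
  | s + 1, t + 1 => ramseyBound s (t + 1) + ramseyBound (s + 1) t + 1

theorem exists_clique_or_indepSet {V : Type*} (G : SimpleGraph V) : ∀ (s t : ℕ) (U : Finset V),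
    ramseyBound s t ≤ U.card →
    (∃ K ⊆ U, K.card = s ∧ G.IsClique K) ∨ ∃ I ⊆ U, I.card = t ∧ G.IsIndepSet I
  | 0, _, _, _ => Or.inl ⟨∅, by simp, by simp, by simp⟩
  | _ + 1, 0, _, _ => Or.inr ⟨∅, by simp, by simp, by simp⟩
  | s + 1, t + 1, U, hU => by
    rw [ramseyBound] at hU
    obtain ⟨x, hx⟩ : U.Nonempty := Finset.card_pos.1 (by omega)
    set N := (U.erase x).filter (G.Adj x)
    set N' := (U.erase x).filter fun y => ¬ G.Adj x y
    have hcard : N.card + N'.card = U.card - 1 := by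
      rw [← Finset.card_erase_of_mem hx, Finset.card_filter_add_card_filter_not]
    have hN : N ⊆ U := fun y hy => Finset.mem_of_mem_erase (Finset.mem_filter.1 hy).1
    have hN' : N' ⊆ U := fun y hy => Finset.mem_of_mem_erase (Finset.mem_filter.1 hy).1
    have hxN : x ∉ N := by simp [N]
    have hxN' : x ∉ N' := by simp [N']
    by_cases hc : ramseyBound s (t + 1) ≤ N.card
    · rcases exists_clique_or_indepSet G s (t + 1) N hc with ⟨K, hK, hKs, hKc⟩ | ⟨I, hI, hIt, hIi⟩
      · left
        refine ⟨insert x K, Finset.insert_subset hx (hK.trans hN), ?_, ?_⟩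
        · rw [Finset.card_insert_of_notMem fun h => hxN (hK h), hKs]
        · rw [Finset.coe_insert, SimpleGraph.isClique_insert]
          exact ⟨hKc, fun y hy _ => (Finset.mem_filter.1 (hK hy)).2⟩
      · exact Or.inr ⟨I, hI.trans hN, hIt, hIi⟩
    · rcases exists_clique_or_indepSet G (s + 1) t N' (by omega) with
        ⟨K, hK, hKs, hKc⟩ | ⟨I, hI, hIt, hIi⟩
      · exact Or.inl ⟨K, hK.trans hN', hKs, hKc⟩
      · right
        refine ⟨insert x I, Finset.insert_subset hx (hI.trans hN'), ?_, ?_⟩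
        · rw [Finset.card_insert_of_notMem fun h => hxN' (hI h), hIt]
        · rw [Finset.coe_insert, SimpleGraph.isIndepSet_iff, Set.pairwise_insert]
          refine ⟨hIi, fun y hy _ => ?_⟩
          have := (Finset.mem_filter.1 (hI hy)).2
          exact ⟨this, fun h => this h.symm⟩

end Ramsey

/-! ### Averages of code vectors and incompatible inner products -/

section CodeFamilies

open scoped Classical

/-- A family of unit vectors with pairwise inner products in `{α, β}`. -/
structure IsCodeFamily {V E : Type*} [NormedAddCommGroup E] [InnerProductSpace ℝ E]
    (α β : ℝ) (v : V → E) : Prop where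
  norm_eq : ∀ i, ‖v i‖ = 1
  inner_eq : ∀ i j, i ≠ j → inner ℝ (v i) (v j) = α ∨ inner ℝ (v i) (v j) = β

variable {V E : Type*} [NormedAddCommGroup E] [InnerProductSpace ℝ E]

/-- The graph of pairs of vectors with inner product `β`. -/
def innerGraph (β : ℝ) (v : V → E) : SimpleGraph V where
  Adj i j := i ≠ j ∧ inner ℝ (v i) (v j) = β
  symm := ⟨fun i j h => ⟨h.1.symm, by rw [real_inner_comm]; exact h.2⟩⟩
  loopless := ⟨fun _ h => h.1 rfl⟩

/-- The average of a finite set of vectors of the family. -/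
noncomputable def avg (v : V → E) (S : Finset V) : E := (S.card : ℝ)⁻¹ • ∑ i ∈ S, v i

theorem inner_avg_right (v : V → E) (S : Finset V) (x : E) :
    inner ℝ x (avg v S) = (S.card : ℝ)⁻¹ * ∑ i ∈ S, inner ℝ x (v i) := by
  rw [avg, inner_smul_right, inner_sum]

theorem le_inner_avg {v : V → E} {S : Finset V} (hS : 0 < S.card) {x : E} {m : ℝ}
    (h : ∀ i ∈ S, m ≤ inner ℝ (v i) x) : m ≤ inner ℝ (avg v S) x := by
  have hS' : (0 : ℝ) < S.card := by exact_mod_cast hS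
  rw [real_inner_comm, inner_avg_right, inv_mul_eq_div, le_div_iff₀ hS', mul_comm, ← nsmul_eq_mul]
  exact Finset.card_nsmul_le_sum _ _ _ fun i hi => by rw [real_inner_comm]; exact h i hi

theorem inner_avg_le {v : V → E} {S : Finset V} (hS : 0 < S.card) {x : E} {m : ℝ}
    (h : ∀ i ∈ S, inner ℝ (v i) x ≤ m) : inner ℝ (avg v S) x ≤ m := by
  have hS' : (0 : ℝ) < S.card := by exact_mod_cast hS
  rw [real_inner_comm, inner_avg_right, inv_mul_eq_div, div_le_iff₀ hS', mul_comm, ← nsmul_eq_mul]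
  exact Finset.sum_le_card_nsmul _ _ _ fun i hi => by rw [real_inner_comm]; exact h i hi

variable {α β : ℝ} {v : V → E}

theorem IsCodeFamily.inner_self (hv : IsCodeFamily α β v) (i : V) : inner ℝ (v i) (v i) = 1 := by
  rw [real_inner_self_eq_norm_sq, hv.norm_eq, one_pow]

theorem IsCodeFamily.inner_of_not_adj (hv : IsCodeFamily α β v) {i j : V} (hij : i ≠ j)
    (h : ¬ (innerGraph β v).Adj i j) : inner ℝ (v i) (v j) = α :=
  (hv.inner_eq i j hij).resolve_right fun h' => h ⟨hij, h'⟩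

/-- A vector with few `β`-neighbors in `S` has inner product close to `α` with its average. -/
theorem IsCodeFamily.le_inner_avg_of_sparse (hv : IsCodeFamily α β v) (hα : α ≤ 1) (hβ : β ≤ α)
    (x : V) (S : Finset V) {D : ℕ} (hS : 0 < S.card)
    (hD : (S.filter ((innerGraph β v).Adj x)).card ≤ D) :
    α - (α - β) * D / S.card ≤ inner ℝ (v x) (avg v S) := by
  have hS' : (0 : ℝ) < S.card := by exact_mod_cast hS
  have h1 : ∀ i ∈ S, α - (if (innerGraph β v).Adj x i then α - β else 0) ≤ inner ℝ (v x) (v i) := by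
    intro i _
    by_cases h : (innerGraph β v).Adj x i
    · rw [if_pos h, h.2]; linarith
    · rw [if_neg h]
      by_cases hxi : x = i
      · rw [← hxi, hv.inner_self]; linarith
      · rw [hv.inner_of_not_adj hxi h]; linarith
  have h2 := Finset.sum_le_sum h1
  rw [Finset.sum_sub_distrib, Finset.sum_const, ← Finset.sum_filter, Finset.sum_const,
    nsmul_eq_mul, nsmul_eq_mul] at h2
  rw [inner_avg_right, inv_mul_eq_div, le_div_iff₀ hS', sub_mul, div_mul_cancel₀ _ hS'.ne']
  have h3 : ((S.filter ((innerGraph β v).Adj x)).card : ℝ) ≤ D := by exact_mod_cast hD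
  nlinarith

/-- A vector with few non-neighbors in `S` has inner product close to `β` with its average. -/
theorem IsCodeFamily.inner_avg_le_of_dense (hv : IsCodeFamily α β v) (hα : α ≤ 1) (hβ : β ≤ α)
    (x : V) (S : Finset V) {D : ℕ} (hS : 0 < S.card)
    (hD : (S.filter fun i => ¬ (innerGraph β v).Adj x i).card ≤ D) :
    inner ℝ (v x) (avg v S) ≤ β + (1 - β) * D / S.card := by
  have hS' : (0 : ℝ) < S.card := by exact_mod_cast hS
  have h1 : ∀ i ∈ S, inner ℝ (v x) (v i) ≤
      β + (if ¬ (innerGraph β v).Adj x i then 1 - β else 0) := by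
    intro i _
    by_cases h : (innerGraph β v).Adj x i
    · rw [if_neg (not_not.2 h), h.2]; linarith
    · rw [if_pos h]
      by_cases hxi : x = i
      · rw [← hxi, hv.inner_self]; linarith
      · rw [hv.inner_of_not_adj hxi h]; linarith
  have h2 := Finset.sum_le_sum h1
  rw [Finset.sum_add_distrib, Finset.sum_const, ← Finset.sum_filter, Finset.sum_const,
    nsmul_eq_mul, nsmul_eq_mul] at h2
  rw [inner_avg_right, inv_mul_eq_div, div_le_iff₀ hS', add_mul, div_mul_cancel₀ _ hS'.ne']
  have h3 : ((S.filter fun i => ¬ (innerGraph β v).Adj x i).card : ℝ) ≤ D := by exact_mod_cast hD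
  nlinarith

theorem IsCodeFamily.inner_avg_self_le (hv : IsCodeFamily α β v) (hα : 0 ≤ α)
    (S : Finset V) (hS : 0 < S.card) (hI : (innerGraph β v).IsIndepSet S) :
    inner ℝ (avg v S) (avg v S) ≤ α + 1 / S.card := by
  have hS' : (0 : ℝ) < S.card := by exact_mod_cast hS
  refine inner_avg_le hS fun x hx => ?_
  have h1 : ∀ i ∈ S, inner ℝ (v x) (v i) ≤ α + (if x = i then 1 else 0) := by
    intro i hi
    by_cases h : x = i
    · rw [if_pos h, ← h, hv.inner_self]; linarith
    · rw [if_neg h, hv.inner_of_not_adj h (hI hx hi h)]; linarith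
  have h2 := Finset.sum_le_sum h1
  rw [Finset.sum_add_distrib, Finset.sum_const, Finset.sum_ite_eq, if_pos hx, nsmul_eq_mul] at h2
  rw [inner_avg_right, inv_mul_eq_div, div_le_iff₀ hS', add_mul, div_mul_cancel₀ _ hS'.ne']
  linarith

/-- The sum of `k` vectors with mutual inner products `β` has squared norm `k * (k * β + 1 - β)`. By
Ramsey, large sets therefore contain large independent sets. -/
theorem IsCodeFamily.card_clique_le (hv : IsCodeFamily α β v) (hβ : β < 0)
    (K : Finset V) (hK : (innerGraph β v).IsClique K) : (K.card : ℝ) ≤ 1 + 1 / (-β) := by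
  rcases K.eq_empty_or_nonempty with rfl | hne
  · simp only [Finset.card_empty, Nat.cast_zero]
    have : 0 < 1 / (-β) := by apply one_div_pos.2; linarith
    linarith
  have h0 : (0 : ℝ) < K.card := by exact_mod_cast Finset.card_pos.2 hne
  have h1 : ∀ i ∈ K, ∀ j ∈ K, inner ℝ (v i) (v j) = β + if i = j then 1 - β else 0 := by
    intro i hi j hj
    by_cases h : i = j
    · rw [if_pos h, ← h, hv.inner_self]; ring
    · rw [if_neg h, (hK hi hj h).2, add_zero]
  have h2 : inner ℝ (∑ i ∈ K, v i) (∑ i ∈ K, v i) = K.card * (K.card * β + (1 - β)) := by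
    rw [sum_inner]
    rw [Finset.sum_congr rfl fun i hi => by
      rw [inner_sum, Finset.sum_congr rfl (h1 i hi), Finset.sum_add_distrib, Finset.sum_const,
        Finset.sum_ite_eq, if_pos hi, nsmul_eq_mul]]
    rw [Finset.sum_const, nsmul_eq_mul]
  have h3 : 0 ≤ (K.card : ℝ) * (K.card * β + (1 - β)) := h2 ▸ real_inner_self_nonneg
  have h4 : 0 ≤ (K.card : ℝ) * β + (1 - β) := nonneg_of_mul_nonneg_right h3 h0
  rw [← sub_le_iff_le_add', le_div_iff₀ (by linarith)]
  linarith

/-- Three vectors whose inner products are incompatible. -/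
theorem false_of_triple {lam ε : ℝ} (hlam : (α - β) * lam = 1 - α) (hlam0 : 0 ≤ lam) 
    (hε : ε * (4 * lam ^ 2 + 8 * lam + 3) < 1 - α) {x a b : E} (hx : inner ℝ x x = (1 : ℝ))
    (ha : inner ℝ a a ≤ α + ε) (hb : inner ℝ b b ≤ α + ε) (hxa : inner ℝ x a ≤ β + ε)
    (hxb : α - ε ≤ inner ℝ x b) (hab : α - ε ≤ inner ℝ a b) : False := by
  -- At `ε = 0` the squared norm of this combination is at most `-(1 - α)`; collecting the error
  -- terms gives the factor `4 * lam ^ 2 + 8 * lam + 3`.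
  have h := real_inner_self_nonneg (x := x + lam • a - (lam + 1) • b)
  simp only [inner_sub_left, inner_sub_right, inner_add_left, inner_add_right, inner_smul_left,
    inner_smul_right, hx, real_inner_comm x a, real_inner_comm x b, real_inner_comm a b,
    conj_trivial] at h
  have h1 := mul_le_mul_of_nonneg_left ha (mul_nonneg hlam0 hlam0)
  have h2 := mul_le_mul_of_nonneg_left hb (mul_nonneg (by linarith : 0 ≤ lam + 1)
    (by linarith : 0 ≤ lam + 1))
  have h3 := mul_le_mul_of_nonneg_left hxa hlam0
  have h4 := mul_le_mul_of_nonneg_left hxb (by linarith : 0 ≤ lam + 1)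
  have h5 := mul_le_mul_of_nonneg_left hab (mul_nonneg hlam0 (by linarith : 0 ≤ lam + 1))
  nlinarith

/-- The squared norm of `a + a' - 2b` would be at most `-2 * (α - β) + 16 * ε`. -/
theorem false_of_two_sparse {ε : ℝ} (hε : 8 * ε < α - β) {a a' b : E}
    (ha : inner ℝ a a ≤ α + ε) (ha' : inner ℝ a' a' ≤ α + ε) (hb : inner ℝ b b ≤ α + ε)
    (haa : inner ℝ a a' ≤ β + ε) (hab : α - ε ≤ inner ℝ a b) (hab' : α - ε ≤ inner ℝ a' b) :
    False := by
  have h := real_inner_self_nonneg (x := a + a' - (2 : ℝ) • b)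
  simp only [inner_sub_left, inner_sub_right, inner_add_left, inner_add_right, inner_smul_left,
    inner_smul_right, real_inner_comm a a', real_inner_comm a b, real_inner_comm a' b,
    conj_trivial] at h
  linarith

end CodeFamilies

/-! ### Codes are multipartite patterns up to bounded error -/

section Structure

open scoped Classical

/-- `q` pairwise completely joined independent sets of size `L`. -/
def IsConfig {V : Type*} (G : SimpleGraph V) (q L : ℕ) (S : Fin q → Finset V) : Prop :=
  (∀ i, (S i).card = L ∧ G.IsIndepSet (S i)) ∧
    ∀ i j, i ≠ j → ∀ x ∈ S i, ∀ y ∈ S j, G.Adj x y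

/-- Deviation of a code from the complete multipartite pattern given by a coloring. -/
def devGraph {V E κ : Type*} [NormedAddCommGroup E] [InnerProductSpace ℝ E] (α β : ℝ)
    (v : V → E) (c : V → κ) : SimpleGraph V where
  Adj i j := i ≠ j ∧ (c i = c j ∧ inner ℝ (v i) (v j) = β ∨ c i ≠ c j ∧ inner ℝ (v i) (v j) = α)
  symm := ⟨fun i j h => ⟨h.1.symm, by
    rw [real_inner_comm, eq_comm (a := c j), ne_comm (a := c j)]; exact h.2⟩⟩
  loopless := ⟨fun _ h => h.1 rfl⟩

variable {V E : Type*} [NormedAddCommGroup E] [InnerProductSpace ℝ E] {α β : ℝ} {v : V → E}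

/-- Each vertex of `I` spoils at most `D` vertices of an old part, so after discarding at most `M *
D` vertices every old part still has `M` vertices joined to all of `I`. -/
theorem exists_config_succ {G : SimpleGraph V} {q L D M : ℕ} {S : Fin q → Finset V}
    (hS : IsConfig G q L S) (hL : M + M * D ≤ L) {I : Finset V} (hI : I.card = M)
    (hIi : G.IsIndepSet I)
    (hd : ∀ x ∈ I, ∀ i, ((S i).filter fun y => ¬ G.Adj x y).card ≤ D) :
    ∃ S' : Fin (q + 1) → Finset V, IsConfig G (q + 1) M S' := by
  have hex : ∀ i, ∃ S' ⊆ (S i).filter (fun y => ∀ x ∈ I, G.Adj x y), S'.card = M := by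
    intro i
    refine Finset.exists_subset_card_eq ?_
    have h1 : (S i).filter (fun y => ¬ ∀ x ∈ I, G.Adj x y) ⊆
        I.biUnion fun x => (S i).filter fun y => ¬ G.Adj x y := by
      intro y hy
      simp only [Finset.mem_filter, not_forall] at hy
      obtain ⟨hy, x, hx, hxy⟩ := hy
      exact Finset.mem_biUnion.2 ⟨x, hx, Finset.mem_filter.2 ⟨hy, hxy⟩⟩
    have h2 := (Finset.card_le_card h1).trans
      (Finset.card_biUnion_le_card_mul I _ D fun x hx => hd x hx i)
    have h3 := Finset.card_filter_add_card_filter_not (s := S i) (fun y => ∀ x ∈ I, G.Adj x y)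
    rw [(hS.1 i).1] at h3
    rw [hI] at h2
    omega
  choose S' hS' hS'c using hex
  have hsub : ∀ i, S' i ⊆ S i := fun i => (hS' i).trans (Finset.filter_subset _ _)
  have hadj : ∀ i, ∀ x ∈ I, ∀ y ∈ S' i, G.Adj x y := fun i x hx y hy =>
    (Finset.mem_filter.1 (hS' i hy)).2 x hx
  refine ⟨Fin.cons I S', ?_, ?_⟩
  · intro i
    refine Fin.cases ⟨hI, hIi⟩ (fun i => ⟨hS'c i, ?_⟩) i
    exact (hS.1 i).2.mono (Finset.coe_subset.2 (hsub i))
  · intro i j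
    refine Fin.cases ?_ (fun i => ?_) i <;> refine Fin.cases ?_ (fun j => ?_) j
    · simp
    · intro _ x hx y hy
      exact hadj j x hx y hy
    · intro _ x hx y hy
      exact (hadj i y hy x hx).symm
    · intro hij x hx y hy
      exact hS.2 i j (fun h => hij (by rw [h])) x (hsub i hx) y (hsub j hy)

/-- The sum of the `p + 1` averages would have squared norm at most `(p + 1) * (α + p * β + ε) < 0`.
-/
theorem IsCodeFamily.not_isConfig (hv : IsCodeFamily α β v) (hα : 0 ≤ α) {p L : ℕ} {ε : ℝ}
    (hL : 0 < L) (hLε : 1 / (L : ℝ) ≤ ε) (hε : α + p * β + ε < 0) (S : Fin (p + 1) → Finset V) :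
    ¬ IsConfig (innerGraph β v) (p + 1) L S := by
  intro hS
  have hpos : ∀ i, 0 < (S i).card := fun i => by rw [(hS.1 i).1]; exact hL
  have h1 : ∀ i j, inner ℝ (avg v (S i)) (avg v (S j)) ≤
      β + if i = j then α + ε - β else 0 := by
    intro i j
    by_cases h : i = j
    · subst h
      have := hv.inner_avg_self_le hα (S i) (hpos i) (hS.1 i).2
      rw [(hS.1 i).1] at this
      rw [if_pos rfl]
      linarith
    · rw [if_neg h, add_zero]
      refine inner_avg_le (hpos i) fun x hx => ?_
      rw [real_inner_comm]
      refine inner_avg_le (hpos j) fun y hy => ?_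
      rw [real_inner_comm, (hS.2 i j h x hx y hy).2]
  have h2 := real_inner_self_nonneg (x := ∑ i, avg v (S i))
  rw [sum_inner] at h2
  have h3 : ∑ i, inner ℝ (avg v (S i)) (∑ j, avg v (S j)) ≤
      ∑ i : Fin (p + 1), ((p + 1) * β + (α + ε - β)) := by
    refine Finset.sum_le_sum fun i _ => ?_
    rw [inner_sum]
    refine (Finset.sum_le_sum fun j _ => h1 i j).trans ?_
    rw [Finset.sum_add_distrib, Finset.sum_ite_eq]
    simp
  rw [Finset.sum_const, nsmul_eq_mul] at h3
  simp only [Finset.card_univ, Fintype.card_fin] at h3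
  push_cast at h3
  nlinarith [(Nat.cast_nonneg p : (0 : ℝ) ≤ p)]

/-- Quantitative form: with the constants fixed, a code is a multipartite pattern up to a bounded
set of vertices and bounded degree. -/
theorem IsCodeFamily.exists_pattern [Fintype V] (hv : IsCodeFamily α β v) (hβ : -1 ≤ β)
    (hβ0 : β < 0)
    (hα0 : 0 ≤ α) (hα : α < 1) {lam ε : ℝ} (hlam : (α - β) * lam = 1 - α) (hlam0 : 0 ≤ lam)
    {p D l ω : ℕ} (hp : 0 < p) (hε0 : 0 < ε) (hε1 : ε * (4 * lam ^ 2 + 8 * lam + 3) < 1 - α)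
    (hε2 : 8 * ε < α - β) (hε3 : α + p * β + ε < 0) (hD : 1 / ε ≤ D) (hl : 2 * D / ε ≤ l)
    (hl2 : 2 * D ≤ l) (hω : 1 + 1 / (-β) < ω) :
    let R := ramseyBound ω
    ∃ (T : Finset V) (c : V → Fin p),
      T.card ≤ ∑ k ∈ Finset.range (p + 1), R (l * (D + 1) ^ k) + p * p * R l ∧
      ∀ x, x ∉ T → (Finset.univ.filter fun y => y ∉ T ∧ (devGraph α β v c).Adj x y).card ≤ p * R l := by
  intro R
  set G := innerGraph β v with hG
  have hD0 : 0 < D := by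
    have : (0 : ℝ) < D := lt_of_lt_of_le (by positivity) hD
    exact_mod_cast this
  have hl0 : 0 < l := by omega
  have hram : ∀ t (U : Finset V), R t ≤ U.card → ∃ I ⊆ U, I.card = t ∧ G.IsIndepSet I := by
    intro t U hU
    rcases exists_clique_or_indepSet G ω t U hU with ⟨K, -, hKs, hKc⟩ | h
    · have := hv.card_clique_le hβ0 K hKc
      rw [hKs] at this
      linarith
    · exact h
  have hbig : ∀ {n : ℕ}, D ≤ n → 1 / (n : ℝ) ≤ ε := by
    intro n hn
    have h1 : (D : ℝ) ≤ n := by exact_mod_cast hn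
    have h2 : (0 : ℝ) < n := by exact_mod_cast lt_of_lt_of_le hD0 hn
    rw [div_le_iff₀ h2]
    rw [div_le_iff₀ hε0] at hD
    nlinarith
  have hself : ∀ I : Finset V, D ≤ I.card → G.IsIndepSet I →
      inner ℝ (avg v I) (avg v I) ≤ α + ε := fun I hI hIi =>
    (hv.inner_avg_self_le hα0 I (by omega) hIi).trans (by linarith [hbig hI])
  have hsmall : ∀ {n : ℕ} {r : ℝ}, l ≤ n → 0 ≤ r → r ≤ 2 → r * D / (n : ℝ) ≤ ε := by
    intro n r hn hr hr2
    have h1 : (l : ℝ) ≤ n := by exact_mod_cast hn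
    have h2 : (0 : ℝ) < n := by exact_mod_cast lt_of_lt_of_le hl0 hn
    have h3 : (0 : ℝ) < D := by exact_mod_cast hD0
    rw [div_le_iff₀ h2]
    rw [div_le_iff₀ hε0] at hl
    nlinarith
  -- sparse and dense vertices relative to an independent set
  have hsparse : ∀ x (S : Finset V), l ≤ S.card → (S.filter (G.Adj x)).card ≤ D →
      α - ε ≤ inner ℝ (v x) (avg v S) := fun x S hS hx => by
    have h1 := hv.le_inner_avg_of_sparse hα.le (by linarith) x S (by omega) hx
    have h2 := hsmall hS (r := α - β) (by linarith) (by linarith)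
    linarith
  have hdense : ∀ x (S : Finset V), l ≤ S.card → (S.filter fun y => ¬ G.Adj x y).card ≤ D →
      inner ℝ (v x) (avg v S) ≤ β + ε := fun x S hS hx => by
    have h1 := hv.inner_avg_le_of_dense hα.le (by linarith) x S (by omega) hx
    have h2 := hsmall hS (r := 1 - β) (by linarith) (by linarith)
    linarith
  -- If `x` had more than `D` neighbors and more than `D` non-neighbors in `S`, then `x` and the
  -- averages of these two sets would be an incompatible triple.
  have hdich : ∀ x (S : Finset V), G.IsIndepSet S → ¬ (S.filter (G.Adj x)).card ≤ D →
      (S.filter fun y => ¬ G.Adj x y).card ≤ D := by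
    intro x S hSi h1
    by_contra h2
    have hxS : x ∉ S := by
      intro hx
      obtain ⟨y, hy⟩ := Finset.card_pos.1 (by omega : 0 < (S.filter (G.Adj x)).card)
      rw [Finset.mem_filter] at hy
      exact hSi hx hy.1 hy.2.1 hy.2
    have sub1 : S.filter (G.Adj x) ⊆ S := Finset.filter_subset _ _
    have sub2 : (S.filter fun y => ¬ G.Adj x y) ⊆ S := Finset.filter_subset _ _
    refine false_of_triple (x := v x) (a := avg v (S.filter (G.Adj x)))
      (b := avg v (S.filter fun y => ¬ G.Adj x y)) hlam hlam0 hε1 (hv.inner_self x)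
      (hself _ (by omega) (hSi.mono (Finset.coe_subset.2 sub1)))
      (hself _ (by omega) (hSi.mono (Finset.coe_subset.2 sub2))) ?_ ?_ ?_
    · rw [real_inner_comm]
      refine inner_avg_le (by omega) fun i hi => ?_
      rw [real_inner_comm, (Finset.mem_filter.1 hi).2.2]
      linarith
    · rw [real_inner_comm]
      refine le_inner_avg (by omega) fun i hi => ?_
      rw [Finset.mem_filter] at hi
      rw [real_inner_comm, hv.inner_of_not_adj (fun h : x = i => hxS (h ▸ hi.1)) hi.2]
      linarith
    · refine le_inner_avg (by omega) fun i hi => ?_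
      rw [real_inner_comm]
      refine le_inner_avg (by omega) fun j hj => ?_
      rw [Finset.mem_filter] at hi hj
      have hji : j ≠ i := fun h => hj.2 (h ▸ hi.2)
      rw [hv.inner_of_not_adj hji (hSi hj.1 hi.1 hji)]
      linarith
  -- a configuration with the largest number of parts
  let L : ℕ → ℕ := fun q => l * (D + 1) ^ (p + 1 - q)
  have hLl : ∀ q, l ≤ L q := fun q => Nat.le_mul_of_pos_right l (by positivity)
  -- `L` shrinks by the factor `D + 1` with each new part, exactly the loss in `exists_config_succ`;
  -- the process stops by `q = p` because `p + 1` parts are impossible.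
  obtain ⟨q, hqp, ⟨S, hS⟩, hmax⟩ : ∃ q ≤ p, (∃ S, IsConfig G q (L q) S) ∧
      ¬ ∃ S, IsConfig G (q + 1) (L (q + 1)) S := by
    by_contra hcon
    push Not at hcon
    have : ∀ q ≤ p + 1, ∃ S, IsConfig G q (L q) S := by
      intro q
      induction q with
      | zero => exact fun _ => ⟨fun i => i.elim0, fun i => i.elim0, fun i => i.elim0⟩
      | succ q ih => exact fun hq => hcon q (by omega) (ih (by omega))
    obtain ⟨S, hS⟩ := this (p + 1) le_rfl
    exact hv.not_isConfig hα0 (lt_of_lt_of_le hl0 (hLl _))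
      (hbig ((by omega : D ≤ l).trans (hLl _))) hε3 S hS
  have hLS : ∀ i, l ≤ (S i).card := fun i => by rw [(hS.1 i).1]; exact hLl q
  have hLstep : L (q + 1) + L (q + 1) * D = L q := by
    have : p + 1 - q = (p + 1 - (q + 1)) + 1 := by omega
    simp only [L]
    rw [this, pow_succ]
    ring
  let sp : V → Fin q → Prop := fun x i => ((S i).filter (G.Adj x)).card ≤ D
  have hnsp : ∀ x i, ¬ sp x i → ((S i).filter fun y => ¬ G.Adj x y).card ≤ D := fun x i h =>
    hdich x (S i) (hS.1 i).2 h
  let T₁ : Finset V := Finset.univ.filter fun x => ∀ i, ¬ sp x i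
  let T₂ : Fin q × Fin q → Finset V := fun ij =>
    if ij.1 = ij.2 then ∅ else Finset.univ.filter fun x => sp x ij.1 ∧ sp x ij.2
  -- Many vertices that are dense to every part would contain an independent set, hence a further
  -- part, against maximality.
  have hT₁ : T₁.card ≤ R (L (q + 1)) := by
    by_contra hcon
    obtain ⟨I, hIT, hI, hIi⟩ := hram _ T₁ (not_le.1 hcon).le
    exact hmax (exists_config_succ hS hLstep.le hI hIi fun x hx i =>
      hnsp x i ((Finset.mem_filter.1 (hIT hx)).2 i))
  -- An average of vertices sparse to two parts would be near `α` to both parts, which are at `β` to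
  -- each other.
  have hT₂ : ∀ ij, (T₂ ij).card ≤ R l := by
    rintro ⟨i, j⟩
    by_contra hcon
    obtain ⟨I, hIT, hI, hIi⟩ := hram _ (T₂ (i, j)) (not_le.1 hcon).le
    have hij : i ≠ j := by
      intro h
      apply hcon
      simp [T₂, h]
    simp only [T₂, if_neg hij] at hIT
    have hIs : ∀ x ∈ I, sp x i ∧ sp x j := fun x hx => (Finset.mem_filter.1 (hIT hx)).2
    refine false_of_two_sparse (a := avg v (S i)) (a' := avg v (S j)) (b := avg v I) hε2
      (hself _ ((by omega : D ≤ l).trans (hLS i)) (hS.1 i).2)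
      (hself _ ((by omega : D ≤ l).trans (hLS j)) (hS.1 j).2)
      (hself _ (by omega) hIi) ?_ ?_ ?_
    · refine inner_avg_le (lt_of_lt_of_le hl0 (hLS i)) fun x hx => ?_
      rw [real_inner_comm]
      refine inner_avg_le (lt_of_lt_of_le hl0 (hLS j)) fun y hy => ?_
      rw [real_inner_comm, (hS.2 i j hij x hx y hy).2]
      linarith
    · rw [real_inner_comm]
      exact le_inner_avg (by omega) fun x hx => hsparse x (S i) (hLS i) (hIs x hx).1
    · rw [real_inner_comm]
      exact le_inner_avg (by omega) fun x hx => hsparse x (S j) (hLS j) (hIs x hx).2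
  let T : Finset V := T₁ ∪ Finset.univ.biUnion T₂
  have hTex : ∀ x, x ∉ T → ∃ i, sp x i := by
    intro x hx
    by_contra hcon
    push Not at hcon
    exact hx (Finset.mem_union_left _ (Finset.mem_filter.2 ⟨Finset.mem_univ _, hcon⟩))
  have hTun : ∀ x, x ∉ T → ∀ i j, sp x i → sp x j → i = j := by
    intro x hx i j hi hj
    by_contra hij
    refine hx (Finset.mem_union_right _ (Finset.mem_biUnion.2 ⟨(i, j), Finset.mem_univ _, ?_⟩))
    simp [T₂, hij, hi, hj]
  -- A vertex outside `T` takes the color of the only part to which it is sparse; the default value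
  -- is used on `T` only.
  let c : V → Fin p := fun x => if h : ∃ i, sp x i then Fin.castLE hqp h.choose else ⟨0, hp⟩
  have hc : ∀ x, x ∉ T → ∃ i, c x = Fin.castLE hqp i ∧ sp x i := by
    intro x hx
    have h := hTex x hx
    exact ⟨h.choose, by simp only [c, dif_pos h], h.choose_spec⟩
  refine ⟨T, c, ?_, ?_⟩
  · refine (Finset.card_union_le _ _).trans (add_le_add (hT₁.trans ?_) ?_)
    · exact Finset.single_le_sum (f := fun k => R (l * (D + 1) ^ k)) (fun _ _ => Nat.zero_le _)
        (Finset.mem_range.2 (by omega : p + 1 - (q + 1) < p + 1))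
    · refine (Finset.card_biUnion_le_card_mul _ _ _ fun ij _ => hT₂ ij).trans ?_
      rw [Finset.card_univ, Fintype.card_prod, Fintype.card_fin]
      gcongr
  · intro x hx
    obtain ⟨i, hci, hsi⟩ := hc x hx
    let N : Fin p → Finset V := fun k =>
      Finset.univ.filter fun y => y ∉ T ∧ c y = k ∧ (devGraph α β v c).Adj x y
    have hN : (Finset.univ.filter fun y => y ∉ T ∧ (devGraph α β v c).Adj x y) ⊆
        Finset.univ.biUnion N := by
      intro y hy
      rw [Finset.mem_filter] at hy
      exact Finset.mem_biUnion.2 ⟨c y, Finset.mem_univ _,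
        Finset.mem_filter.2 ⟨Finset.mem_univ _, hy.2.1, rfl, hy.2.2⟩⟩
    refine (Finset.card_le_card hN).trans ((Finset.card_biUnion_le_card_mul _ _ (R l)
      fun k _ => ?_).trans (by simp))
    -- Too many deviating neighbors of color `k` contain an independent set `I`. Its average and
    -- that of the part `S j` of color `k` are nearly at `α`, but `x` is near `α` to one and near
    -- `β` to the other.
    by_contra hcon
    obtain ⟨I, hIN, hI, hIi⟩ := hram _ (N k) (not_le.1 hcon).le
    have hIN' : ∀ y ∈ I, y ∉ T ∧ c y = k ∧ (devGraph α β v c).Adj x y := fun y hy =>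
      (Finset.mem_filter.1 (hIN hy)).2
    obtain ⟨y₀, hy₀⟩ := Finset.card_pos.1 (by omega : 0 < I.card)
    obtain ⟨j, hcj, -⟩ := hc y₀ (hIN' y₀ hy₀).1
    have hk : k = Fin.castLE hqp j := (hIN' y₀ hy₀).2.1.symm.trans hcj
    have hIj : ∀ y ∈ I, sp y j := by
      intro y hy
      obtain ⟨j', hcj', hsj'⟩ := hc y (hIN' y hy).1
      have : j' = j := Fin.castLE_injective hqp (by rw [← hcj', (hIN' y hy).2.1, hk])
      exact this ▸ hsj'
    have hIS : α - ε ≤ inner ℝ (avg v I) (avg v (S j)) :=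
      le_inner_avg (by omega) fun y hy => hsparse y (S j) (hLS j) (hIj y hy)
    have hSS := hself (S j) ((by omega : D ≤ l).trans (hLS j)) (hS.1 j).2
    have hII := hself I (by omega) hIi
    by_cases hij : i = j
    · have hcx : c x = k := by rw [hci, hij, hk]
      refine false_of_triple (x := v x) (a := avg v I) (b := avg v (S j)) hlam hlam0 hε1
        (hv.inner_self x) hII hSS ?_ (hsparse x (S j) (hLS j) (hij ▸ hsi)) hIS
      rw [real_inner_comm]
      refine inner_avg_le (by omega) fun y hy => ?_
      obtain ⟨-, hcy, -, h | h⟩ := hIN' y hy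
      · rw [real_inner_comm, h.2]; linarith
      · exact absurd (hcx.trans hcy.symm) h.1
    · have hcx : c x ≠ k := fun h => hij (Fin.castLE_injective hqp (by rw [← hci, h, hk]))
      refine false_of_triple (x := v x) (a := avg v (S j)) (b := avg v I) hlam hlam0 hε1
        (hv.inner_self x) hSS hII ?_ ?_ (by rw [real_inner_comm]; exact hIS)
      · refine hdense x (S j) (hLS j) (hnsp x j fun h => hij (hTun x hx i j hsi h))
      · rw [real_inner_comm]
        refine le_inner_avg (by omega) fun y hy => ?_
        obtain ⟨-, hcy, -, h | h⟩ := hIN' y hy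
        · exact absurd (h.1.trans hcy) hcx
        · rw [real_inner_comm, h.2]; linarith

/-- Up to boundedly many vertices, every code is a complete multipartite pattern with at most `p`
parts, up to an error of bounded degree. -/
theorem exists_structure (hβ : -1 ≤ β) (hβ0 : β < 0) (hα0 : 0 ≤ α) (hα : α < 1) {p : ℕ}
    (hp : 0 < p) (hp' : α + p * β < 0) :
    ∃ Δ : ℕ, ∀ (V E : Type) [Fintype V] [NormedAddCommGroup E] [InnerProductSpace ℝ E] (v : V → E),
      IsCodeFamily α β v → ∃ (T : Finset V) (c : V → Fin p), T.card ≤ Δ ∧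
        ∀ x, x ∉ T → (Finset.univ.filter fun y => y ∉ T ∧ (devGraph α β v c).Adj x y).card ≤ Δ := by
  have hαβ : 0 < α - β := by linarith
  set lam := (1 - α) / (α - β) with hlam
  have hlam0 : 0 ≤ lam := div_nonneg (by linarith) hαβ.le
  have hK : 0 < 4 * lam ^ 2 + 8 * lam + 3 := by positivity
  -- The three bounds on `ε` exclude incompatible triples, vertices sparse to two parts, and `p + 1`
  -- parts, respectively.
  obtain ⟨ε, hε0, hε⟩ : ∃ ε : ℝ, 0 < ε ∧
      ε < min ((1 - α) / (4 * lam ^ 2 + 8 * lam + 3)) (min ((α - β) / 8) (-(α + p * β))) :=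
    exists_between (lt_min (div_pos (by linarith) hK) (lt_min (by linarith) (by linarith)))
  rw [lt_min_iff, lt_min_iff, lt_div_iff₀ hK] at hε
  obtain ⟨hε1, hε2, hε3⟩ := hε
  obtain ⟨D, hD⟩ := exists_nat_ge (1 / ε)
  obtain ⟨l, hl⟩ := exists_nat_ge (2 * D / ε + 2 * D)
  obtain ⟨ω, hω⟩ := exists_nat_gt (1 + 1 / (-β))
  have hDε : 0 ≤ 2 * D / ε := by positivity
  refine ⟨∑ k ∈ Finset.range (p + 1), ramseyBound ω (l * (D + 1) ^ k) + p * p * ramseyBound ω l +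
    p * ramseyBound ω l, fun V E _ _ _ v hv => ?_⟩
  have hl2 : ((2 * D : ℕ) : ℝ) ≤ l := by push_cast; linarith
  obtain ⟨T, c, h1, h2⟩ := hv.exists_pattern hβ hβ0 hα0 hα (lam := lam) (ε := ε)
    (by rw [hlam]; field_simp) hlam0 hp hε0 hε1 (by linarith) (by linarith) hD
    (D := D) (l := l) (ω := ω) (by linarith [(Nat.cast_nonneg D : (0 : ℝ) ≤ D)])
    (by exact_mod_cast hl2) hω
  exact ⟨T, c, h1.trans (Nat.le_add_right _ _), fun x hx => (h2 x hx).trans (Nat.le_add_left _ _)⟩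

end Structure

/-! ### From codes to the kernel of `lam - A` -/

section UpperBound

open scoped Classical

variable {V E : Type*} [Fintype V] [DecidableEq V] [NormedAddCommGroup E] [InnerProductSpace ℝ E]
  {α β lam : ℝ} {v : V → E} {p : ℕ}

/-- The vector of sums over color classes. -/
def classSums (c : V → Fin p) : (V → ℝ) →ₗ[ℝ] (Fin p → ℝ) where
  toFun x k := ∑ w, if c w = k then x w else 0
  map_add' x y := by
    ext k
    rw [Pi.add_apply, ← Finset.sum_add_distrib]
    exact Finset.sum_congr rfl fun w _ => by split_ifs <;> simp
  map_smul' a x := by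
    ext k
    simp only [Pi.smul_apply, smul_eq_mul, RingHom.id_apply, Finset.mul_sum]
    exact Finset.sum_congr rfl fun w _ => by split_ifs <;> simp

theorem sum_mul_eq_zero_of_classSums {c : V → Fin p} {x : V → ℝ} (hx : classSums c x = 0)
    (f : Fin p → ℝ) : ∑ w, f (c w) * x w = 0 := by
  have h : ∀ w, f (c w) * x w = ∑ k, f k * if c w = k then x w else 0 := by
    intro w
    rw [Finset.sum_eq_single (c w)]
    · simp
    · intro k _ hk
      simp [Ne.symm hk]
    · simp
  rw [Finset.sum_congr rfl fun w _ => h w, Finset.sum_comm]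
  refine Finset.sum_eq_zero fun k _ => ?_
  rw [← Finset.mul_sum]
  have := congrFun hx k
  simp only [classSums, LinearMap.coe_mk, AddHom.coe_mk, Pi.zero_apply] at this
  rw [this, mul_zero]

theorem IsCodeFamily.inner_eq_shiftMatrix (hv : IsCodeFamily α β v) (hαβ : β < α)
    (hlam : (α - β) * lam = 1 - α) (c : V → Fin p) (u w : V) :
    inner ℝ (v u) (v w) = (α - β) * shiftMatrix lam (devGraph α β v c) c u w +
      if c u = c w then α else β := by
  by_cases huw : u = w
  · subst huw
    rw [hv.inner_self, shiftMatrix_self, if_pos rfl]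
    linarith
  · rw [shiftMatrix_of_ne _ huw, colMatrix_apply]
    have hne : α ≠ β := hαβ.ne'
    rcases hv.inner_eq u w huw with h | h <;> by_cases hc : c u = c w <;>
      simp [devGraph, huw, h, hc, hne, hne.symm]

/-- Zero class sums kill the color pattern in the Gram matrix, so on this subspace of codimension at
most `p` the matrix `lam - A` acts as a multiple of the Gram matrix. -/
theorem IsCodeFamily.shiftMatrix_mulVec (hv : IsCodeFamily α β v) (hαβ : β < α)
    (hlam : (α - β) * lam = 1 - α) {c : V → Fin p} {x : V → ℝ} (hx : classSums c x = 0) (u : V) :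
    (α - β) * (shiftMatrix lam (devGraph α β v c) c *ᵥ x) u =
      inner ℝ (v u) (∑ w, x w • v w) := by
  have h := sum_mul_eq_zero_of_classSums hx fun k => if c u = k then α else β
  simp only [inner_sum, inner_smul_right, hv.inner_eq_shiftMatrix hαβ hlam c u, mul_add,
    Finset.sum_add_distrib, mulVec, dotProduct, Finset.mul_sum]
  rw [Finset.sum_congr rfl fun w _ => mul_comm (x w) (if c u = c w then α else β), h, add_zero]
  exact Finset.sum_congr rfl fun w _ => by ring

theorem IsCodeFamily.form_nonneg (hv : IsCodeFamily α β v) (hαβ : β < α)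
    (hlam : (α - β) * lam = 1 - α) {c : V → Fin p} {x : V → ℝ} (hx : classSums c x = 0) :
    0 ≤ x ⬝ᵥ shiftMatrix lam (devGraph α β v c) c *ᵥ x := by
  have h : (α - β) * (x ⬝ᵥ shiftMatrix lam (devGraph α β v c) c *ᵥ x) =
      inner ℝ (∑ w, x w • v w) (∑ w, x w • v w) := by
    rw [sum_inner, dotProduct, Finset.mul_sum]
    refine Finset.sum_congr rfl fun u _ => ?_
    rw [real_inner_smul_left, ← hv.shiftMatrix_mulVec hαβ hlam hx u]
    ring
  exact nonneg_of_mul_nonneg_right (h ▸ real_inner_self_nonneg) (by linarith)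

/-- Zero class sums are `p` equations, so `p + 1` orthogonal negative vectors have a nonzero
combination satisfying them. Its energy is negative, yet it is a positive multiple of a squared
norm. -/
theorem IsCodeFamily.negRankLE (hv : IsCodeFamily α β v) (hαβ : β < α)
    (hlam : (α - β) * lam = 1 - α) (c : V → Fin p) :
    NegRankLE (shiftMatrix lam (devGraph α β v c) c) p := by
  set M := shiftMatrix lam (devGraph α β v c) c
  intro x hx
  by_contra hcon
  push Not at hcon
  let f : (Fin (p + 1) → ℝ) →ₗ[ℝ] (Fin p → ℝ) :=
    (classSums c).comp (Fintype.linearCombination ℝ x)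
  have hker : LinearMap.ker f ≠ ⊥ := LinearMap.ker_ne_bot_of_finrank_lt (by simp)
  obtain ⟨a, ha, ha0⟩ := (Submodule.ne_bot_iff _).1 hker
  have h1 := hv.form_nonneg hαβ hlam (c := c) (x := Fintype.linearCombination ℝ x a) ha
  have h2 : Fintype.linearCombination ℝ x a ⬝ᵥ M *ᵥ Fintype.linearCombination ℝ x a =
      ∑ i, a i ^ 2 * (x i ⬝ᵥ M *ᵥ x i) := by
    rw [Fintype.linearCombination_apply, mulVec_sum, sum_dotProduct]
    refine Finset.sum_congr rfl fun i _ => ?_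
    rw [dotProduct_sum, Finset.sum_eq_single i]
    · rw [mulVec_smul, smul_dotProduct, dotProduct_smul, smul_eq_mul, smul_eq_mul]
      ring
    · intro j _ hj
      rw [mulVec_smul, smul_dotProduct, dotProduct_smul, hx i j (Ne.symm hj)]
      simp
    · simp
  rw [h2] at h1
  obtain ⟨i, hi⟩ := Function.ne_iff.1 ha0
  have h3 : ∑ i, a i ^ 2 * (x i ⬝ᵥ M *ᵥ x i) < 0 := by
    refine Finset.sum_neg' (fun i _ => mul_nonpos_of_nonneg_of_nonpos (sq_nonneg _) (hcon i).le)
      ⟨i, Finset.mem_univ _, mul_neg_of_pos_of_neg ?_ (hcon i)⟩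
    have : a i ≠ 0 := hi
    positivity
  linarith

/-- Linear relations among the vectors with zero class sums lie in the kernel of `lam - A`, and they
are cut out by at most `finrank E + p` conditions. -/
theorem IsCodeFamily.card_le_nullity_add [FiniteDimensional ℝ E] (hv : IsCodeFamily α β v)
    (hαβ : β < α) (hlam : (α - β) * lam = 1 - α) (c : V → Fin p) :
    Fintype.card V ≤ nullity (shiftMatrix lam (devGraph α β v c) c) + Module.finrank ℝ E + p := by
  let f : (V → ℝ) →ₗ[ℝ] E × (Fin p → ℝ) := (Fintype.linearCombination ℝ v).prod (classSums c)
  have h1 := LinearMap.finrank_range_add_finrank_ker f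
  have h2 : Module.finrank ℝ (LinearMap.range f) ≤ Module.finrank ℝ E + p := by
    simpa using Submodule.finrank_le (LinearMap.range f)
  have h3 : LinearMap.ker f ≤
      LinearMap.ker (shiftMatrix lam (devGraph α β v c) c).mulVecLin := by
    intro x hx
    replace hx := Prod.mk_eq_zero.1 (LinearMap.mem_ker.1 hx)
    rw [LinearMap.mem_ker]
    ext u
    have h4 := hv.shiftMatrix_mulVec hαβ hlam hx.2 u
    have h5 : ∑ w, x w • v w = 0 := by simpa [Fintype.linearCombination_apply] using hx.1
    rw [h5, inner_zero_right] at h4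
    simpa [(sub_pos.2 hαβ).ne'] using h4
  have h4 := Submodule.finrank_mono h3
  rw [Module.finrank_pi] at h1
  unfold nullity
  omega

/-- An upper bound for the nullity of bounded-degree colored graphs bounds the size of codes. -/
theorem exists_upper_bound (hβ : -1 ≤ β) (hβ0 : β < 0) (hα0 : 0 ≤ α) (hα : α < 1)
    (hlam : lam = (1 - α) / (α - β)) (hp : 0 < p) (hp' : α + p * β < 0) {κ : ℝ} (hκ : 0 ≤ κ)
    (hnull : ∀ Δ : ℕ, ∃ C : ℝ, ∀ (V : Type) [Fintype V] [DecidableEq V] (H : SimpleGraph V)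
      (c : V → Fin p), (∀ x, (Finset.univ.filter fun y => H.Adj x y).card ≤ Δ) →
      NegRankLE (shiftMatrix lam H c) p → (nullity (shiftMatrix lam H c) : ℝ) ≤
        κ * Fintype.card V + C) :
    ∃ C : ℝ, ∀ d : ℕ, (1 - κ) * maxCodeSize α β d ≤ d + C := by
  have hαβ : β < α := by linarith
  have hlam' : (α - β) * lam = 1 - α := by
    have : α - β ≠ 0 := by linarith
    rw [hlam]; field_simp
  obtain ⟨Δ, hΔ⟩ := exists_structure hβ hβ0 hα0 hα hp hp'
  obtain ⟨C, hC⟩ := hnull Δ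
  refine ⟨C + p + Δ, fun d => ?_⟩
  obtain ⟨S, ⟨hS1, hS2⟩, hScard⟩ := (isGreatest_maxCodeSize (α := α) (β := β) (by linarith) hα d).1
  rw [← hScard]
  have hv : IsCodeFamily α β (Subtype.val : {x // x ∈ S} → EuclideanSpace ℝ (Fin d)) :=
    ⟨fun i => hS1 i i.2, fun i j hij => hS2 i i.2 j j.2 fun h => hij (Subtype.ext h)⟩
  obtain ⟨T, c, hT, hdeg⟩ := hΔ {x // x ∈ S} (EuclideanSpace ℝ (Fin d)) _ hv
  -- Discarding `T` costs at most `Δ` vectors, which goes into the constant.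
  let V' := {x : {x // x ∈ S} // x ∉ T}
  let v' : V' → EuclideanSpace ℝ (Fin d) := fun x => x.1.1
  have hv' : IsCodeFamily α β v' :=
    ⟨fun i => hv.norm_eq i.1, fun i j hij => hv.inner_eq i.1 j.1 fun h => hij (Subtype.ext h)⟩
  let c' : V' → Fin p := fun x => c x.1
  have hdeg' : ∀ x : V', (Finset.univ.filter fun y => (devGraph α β v' c').Adj x y).card ≤ Δ := by
    intro x
    have hdx : (Finset.univ.filter fun y : {x // x ∈ S} =>
        y ∉ T ∧ (devGraph α β Subtype.val c).Adj x.1 y).card ≤ Δ := by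
      convert hdeg x.1 x.2
    refine le_trans (Finset.card_le_card_of_injOn Subtype.val ?_ ?_) hdx
    · intro y hy
      have hy' := (Finset.mem_filter.1 hy).2
      rw [Finset.mem_coe, Finset.mem_filter]
      exact ⟨Finset.mem_univ _, y.2, fun h => hy'.1 (Subtype.ext h), hy'.2⟩
    · exact fun a _ b _ h => Subtype.ext h
  have h1 := hC V' (devGraph α β v' c') c' hdeg' (hv'.negRankLE hαβ hlam' c')
  have h2 := hv'.card_le_nullity_add hαβ hlam' c'
  rw [finrank_euclideanSpace_fin] at h2
  have h3 : Fintype.card V' = S.card - T.card := by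
    have := Fintype.card_subtype_compl (fun x : {x // x ∈ S} => x ∈ T)
    rw [Fintype.card_coe, Fintype.card_coe] at this
    exact this
  have h4 : (S.card : ℝ) ≤ Fintype.card V' + Δ := by
    have : S.card ≤ Fintype.card V' + Δ := by omega
    exact_mod_cast this
  have h5 : (Fintype.card V' : ℝ) ≤ S.card := by
    have : Fintype.card V' ≤ S.card := by omega
    exact_mod_cast this
  have h6 : (Fintype.card V' : ℝ) ≤ nullity (shiftMatrix lam (devGraph α β v' c') c') + d + p := by
    exact_mod_cast h2
  nlinarith [mul_le_mul_of_nonneg_left h5 hκ]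

end UpperBound

/-! ### Conjugate eigenvalues and matrices with three eigenvalues -/

section Conjugation

open scoped Classical

-- The remainder modulo `X² - k` is a rational linear polynomial, and one vanishing at an irrational
-- number is zero.
open Polynomial in
theorem dvd_of_eval_sqrt_eq_zero {k : ℚ} {s : ℝ} (hs : s ^ 2 = k) (hirr : Irrational s) {P : ℚ[X]}
    (h : (P.map (algebraMap ℚ ℝ)).eval s = 0) : X ^ 2 - C k ∣ P := by
  have hm : (X ^ 2 - C k).Monic := monic_X_pow_sub_C k two_ne_zero
  have hdeg : (P %ₘ (X ^ 2 - C k)).natDegree ≤ 1 := by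
    have := natDegree_modByMonic_lt P hm (by
      intro h1
      have := congrArg natDegree h1
      rw [natDegree_X_pow_sub_C] at this
      simp at this)
    rw [natDegree_X_pow_sub_C] at this
    omega
  obtain ⟨a, b, hab⟩ := exists_eq_X_add_C_of_natDegree_le_one hdeg
  have h1 := modByMonic_add_div P (X ^ 2 - C k)
  rw [hab] at h1
  have h2 := congrArg (fun Q => (Q.map (algebraMap ℚ ℝ)).eval s) h1
  simp only [Polynomial.map_add, Polynomial.map_mul, Polynomial.map_sub, Polynomial.map_pow, map_X,
    map_C, eval_add, eval_mul, eval_sub, eval_pow, eval_X, eval_C, h, hs, eq_ratCast, sub_self,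
    zero_mul, add_zero] at h2
  have ha : a = 0 := by
    by_contra ha
    have ha' : (a : ℝ) ≠ 0 := by exact_mod_cast ha
    refine hirr ⟨-b / a, ?_⟩
    push_cast
    field_simp
    linarith
  rw [ha] at h2
  simp only [Rat.cast_zero, zero_mul, zero_add, Rat.cast_eq_zero] at h2
  rw [← h1, ha, h2]
  simp

-- Divide out `X² - k`, which has simple roots at `s` and `-s`, until neither is a root.
open Polynomial in
theorem rootMultiplicity_sqrt_conj {k : ℚ} {s : ℝ} (hs : s ^ 2 = k) (hirr : Irrational s) :
    ∀ (n : ℕ) (P : ℚ[X]), P ≠ 0 → P.natDegree = n →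
      (P.map (algebraMap ℚ ℝ)).rootMultiplicity s =
        (P.map (algebraMap ℚ ℝ)).rootMultiplicity (-s) := by
  intro n
  induction n using Nat.strong_induction_on with
  | _ n ih =>
    intro P hP hn
    have hP' : P.map (algebraMap ℚ ℝ) ≠ 0 := (Polynomial.map_ne_zero_iff
      (algebraMap ℚ ℝ).injective).2 hP
    have hs' : (-s) ^ 2 = k := by rw [neg_sq, hs]
    have hs0 : s ≠ 0 := hirr.ne_zero
    by_cases hd : X ^ 2 - C k ∣ P
    · obtain ⟨Q, rfl⟩ := hd
      have hQ : Q ≠ 0 := right_ne_zero_of_mul hP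
      have hfac : (X ^ 2 - C k : ℚ[X]).map (algebraMap ℚ ℝ) = (X - C s) * (X - C (-s)) := by
        simp only [Polynomial.map_sub, Polynomial.map_pow, map_X, map_C, eq_ratCast, ← hs]
        simp only [C_neg, C_pow]
        ring
      rw [Polynomial.map_mul] at hP'
      rw [Polynomial.map_mul, rootMultiplicity_mul hP', rootMultiplicity_mul hP']
      rw [natDegree_mul (left_ne_zero_of_mul hP) hQ, natDegree_X_pow_sub_C] at hn
      rw [ih _ (by omega) Q hQ rfl, hfac]
      have hne : (X - C s) * (X - C (-s)) ≠ 0 := mul_ne_zero (X_sub_C_ne_zero _) (X_sub_C_ne_zero _)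
      have hss : s ≠ -s := fun h => hs0 (by linarith)
      rw [rootMultiplicity_mul hne, rootMultiplicity_mul hne, rootMultiplicity_X_sub_C,
        rootMultiplicity_X_sub_C, rootMultiplicity_X_sub_C, rootMultiplicity_X_sub_C]
      simp [hss, hss.symm]
    · rw [rootMultiplicity_eq_zero fun h => hd (dvd_of_eval_sqrt_eq_zero hs hirr h),
        rootMultiplicity_eq_zero fun h => hd (dvd_of_eval_sqrt_eq_zero hs' hirr.neg h)]

variable {V κ : Type*} [Fintype V] [DecidableEq V] {H : SimpleGraph V} {c : V → κ}

theorem card_eigenvalues_eq_rootMultiplicity {A : Matrix V V ℝ} (hA : A.IsHermitian) (lam : ℝ) :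
    Nat.card {i // hA.eigenvalues i = lam} = A.charpoly.rootMultiplicity lam := by
  rw [← Polynomial.count_roots, hA.roots_charpoly_eq_eigenvalues, Multiset.count_map,
    Nat.card_eq_fintype_card, Fintype.card_subtype]
  simp only [Finset.card, Finset.filter_val, Function.comp_apply]
  congr 1
  exact Multiset.filter_congr fun i _ => by simp [eq_comm]

theorem exists_rat_charpoly : ∃ P : Polynomial ℚ, P ≠ 0 ∧
    (colMatrix H c).charpoly = P.map (algebraMap ℚ ℝ) := by
  let A : Matrix V V ℚ := of fun u v => if H.Adj u v then if c u = c v then 1 else -1 else 0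
  refine ⟨A.charpoly, A.charpoly_monic.ne_zero, ?_⟩
  rw [← Matrix.charpoly_map]
  congr 1
  ext u v
  simp only [A, map_apply, of_apply, colMatrix_apply]
  split_ifs <;> simp

/-- Conjugate eigenvalues have equal multiplicities. -/
theorem card_eigenvalues_neg_sqrt {k : ℚ} {s : ℝ} (hs : s ^ 2 = k) (hirr : Irrational s)
    (hA : (colMatrix H c).IsHermitian) :
    Nat.card {i // hA.eigenvalues i = -s} = nullity (shiftMatrix s H c) := by
  obtain ⟨P, hP, hPc⟩ := exists_rat_charpoly (H := H) (c := c)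
  rw [card_eigenvalues_eq_rootMultiplicity, shiftMatrix, ← card_eigenvalues_eq_nullity hA,
    card_eigenvalues_eq_rootMultiplicity, hPc, rootMultiplicity_sqrt_conj hs hirr _ P hP rfl]

theorem card_eigenvalues_sq_eq {k : ℚ} {s : ℝ} (hs : s ^ 2 = k) (hirr : Irrational s)
    (hA : (colMatrix H c).IsHermitian) :
    (Finset.univ.filter fun i => hA.eigenvalues i ^ 2 = k).card =
      2 * nullity (shiftMatrix s H c) := by
  have h1 := card_eigenvalues_neg_sqrt hs hirr hA
  have h2 := card_eigenvalues_eq_nullity hA s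
  rw [Nat.card_eq_fintype_card, Fintype.card_subtype] at h1 h2
  have h3 : (Finset.univ.filter fun i => hA.eigenvalues i ^ 2 = k) =
      (Finset.univ.filter fun i => hA.eigenvalues i = s) ∪
      (Finset.univ.filter fun i => hA.eigenvalues i = -s) := by
    ext i
    simp only [Finset.mem_filter, Finset.mem_univ, true_and, Finset.mem_union, ← hs]
    exact sq_eq_sq_iff_eq_or_eq_neg
  rw [h3, Finset.card_union_of_disjoint, h1, h2, shiftMatrix]
  · ring
  · rw [Finset.disjoint_filter]
    intro i _ hi hi'
    exact hirr.ne_zero (by linarith)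

/-- The characteristic polynomial is rational, so `-s` has the same multiplicity as `s`. No
assumption on `λ₁` is needed. -/
theorem two_mul_nullity_le {k : ℚ} {s : ℝ} (hs : s ^ 2 = k) (hirr : Irrational s) :
    2 * nullity (shiftMatrix s H c) ≤ Fintype.card V := by
  rw [← card_eigenvalues_sq_eq hs hirr isHermitian_colMatrix]
  exact Finset.card_le_univ _

theorem irrational_sqrt_three : Irrational √3 := by
  simpa using Nat.Prime.irrational_sqrt Nat.prime_three

theorem sqrt_two_sq : √2 ^ 2 = ((2 : ℚ) : ℝ) := by
  rw [Real.sq_sqrt (by norm_num)]; norm_num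

theorem sqrt_three_sq : √3 ^ 2 = ((3 : ℚ) : ℝ) := by
  rw [Real.sq_sqrt (by norm_num)]; norm_num

/-- The largest eigenvalue and its multiplicity when `A ^ 3 = lam ^ 2 • A`. -/
theorem posSemidef_and_nullity_of_pow_three {lam : ℝ} (hlam : 0 < lam)
    (h3 : colMatrix H c ^ 3 = lam ^ 2 • colMatrix H c) :
    (shiftMatrix lam H c).PosSemidef ∧
      2 * lam ^ 2 * nullity (shiftMatrix lam H c) = (colMatrix H c ^ 2).trace := by
  have hA : (colMatrix H c).IsHermitian := isHermitian_colMatrix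
  have heig : ∀ i, hA.eigenvalues i ^ 3 = lam ^ 2 * hA.eigenvalues i := by
    intro i
    have h := hA.mulVec_eigenvectorBasis i
    have h' : ∀ k : ℕ, (colMatrix H c ^ k) *ᵥ ⇑(hA.eigenvectorBasis i) =
        hA.eigenvalues i ^ k • ⇑(hA.eigenvectorBasis i) := by
      intro k
      induction k with
      | zero => simp
      | succ k ih => rw [pow_succ, ← mulVec_mulVec, h, mulVec_smul, ih, smul_smul, pow_succ, mul_comm]
    have h4 := h' 3
    rw [h3, smul_mulVec, h, smul_smul] at h4
    have hne : (⇑(hA.eigenvectorBasis i) : V → ℝ) ≠ 0 := by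
      intro h0
      have := hA.eigenvectorBasis.orthonormal.ne_zero i
      exact this (by ext j; exact congrFun h0 j)
    exact (smul_left_injective ℝ hne h4).symm
  have htri : ∀ i, hA.eigenvalues i = 0 ∨ hA.eigenvalues i = lam ∨ hA.eigenvalues i = -lam := by
    intro i
    have : hA.eigenvalues i * ((hA.eigenvalues i - lam) * (hA.eigenvalues i + lam)) = 0 := by
      linear_combination heig i
    rcases mul_eq_zero.1 this with h | h
    · exact Or.inl h
    · rcases mul_eq_zero.1 h with h | h
      · exact Or.inr (Or.inl (by linarith))
      · exact Or.inr (Or.inr (by linarith))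
  refine ⟨(posSemidef_iff_eigenvalues_le hA lam).2 fun i => ?_, ?_⟩
  · rcases htri i with h | h | h <;> linarith
  · have h1 : ∑ i, hA.eigenvalues i = 0 := by
      have := trace_pow_eq_sum hA 1
      simpa [trace_colMatrix] using this.symm
    rw [trace_pow_eq_sum hA 2, shiftMatrix, ← card_eigenvalues_eq_nullity hA,
      Nat.card_eq_fintype_card, Fintype.card_subtype, Finset.card_filter]
    -- Valid for each of the values `0`, `lam`, `-lam`. Summed, the linear term drops out because
    -- the trace vanishes, and the multiplicity of `lam` remains.
    have h2 : ∀ i, hA.eigenvalues i ^ 2 =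
        2 * lam ^ 2 * (if hA.eigenvalues i = lam then 1 else 0) - lam * hA.eigenvalues i := by
      intro i
      rcases htri i with h | h | h
      · rw [h, if_neg hlam.ne]; ring
      · rw [h, if_pos rfl]; ring
      · rw [h, if_neg (by linarith)]; ring
    rw [Finset.sum_congr rfl fun i _ => h2 i, Finset.sum_sub_distrib, ← Finset.mul_sum,
      ← Finset.mul_sum, h1]
    push_cast
    ring

end Conjugation

/-! ### The case `lam = 1` -/

section EigenvalueOne

open scoped Classical

variable {V : Type*} [Fintype V] [DecidableEq V] {H : SimpleGraph V}

/-- An edge `uv` with sign `s` makes `e_u + s e_v` a null vector of the form, hence a kernel vector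
of `1 - A`; reading off row `w` shows that `u` and `v` are twins up to sign. -/
theorem colMatrix_of_posSemidef_one {κ : Type*} {c : V → κ}
    (h : (shiftMatrix 1 H c).PosSemidef) {u v w : V} (huv : H.Adj u v) (hwu : w ≠ u) (hwv : w ≠ v) :
    colMatrix H c w u = - colMatrix H c u v * colMatrix H c w v := by
  set s := colMatrix H c u v with hs
  have hne : u ≠ v := huv.ne
  set x : V → ℝ := Pi.single u 1 + s • Pi.single v 1
  have hM : ∀ y, (shiftMatrix 1 H c *ᵥ x) y =
      shiftMatrix 1 H c y u + s * shiftMatrix 1 H c y v := by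
    intro y
    simp [x, mulVec_add, mulVec_smul]
  have hss : s * s = 1 := colMatrix_sq huv
  have h0 : x ⬝ᵥ shiftMatrix 1 H c *ᵥ x = 0 := by
    rw [show x ⬝ᵥ shiftMatrix 1 H c *ᵥ x = (shiftMatrix 1 H c *ᵥ x) u +
      s * (shiftMatrix 1 H c *ᵥ x) v by simp [x, add_dotProduct, smul_dotProduct]]
    rw [hM, hM, shiftMatrix_self, shiftMatrix_self, shiftMatrix_of_ne _ hne,
      shiftMatrix_of_ne _ hne.symm, colMatrix_symm v u, ← hs]
    linear_combination -hss
  have h1 := congrFun (mulVec_eq_zero_of_posSemidef h h0) w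
  rw [hM, shiftMatrix_of_ne _ hwu, shiftMatrix_of_ne _ hwv] at h1
  simp only [Pi.zero_apply] at h1
  linarith

/-- By the twin relation a positive edge is isolated, since a third vertex would see both ends with
one sign and with opposite signs. If all edges at `v` are negative, two neighbors are joined
negatively, so `v` and its neighbors have distinct colors. -/
theorem degree_lt_of_posSemidef_one {p : ℕ} (hp : 2 ≤ p) {c : V → Fin p}
    (h : (shiftMatrix 1 H c).PosSemidef) (v : V) : H.degree v + 1 ≤ p := by
  by_cases hpos : ∃ u, H.Adj u v ∧ c u = c v
  · obtain ⟨u, huv, hcu⟩ := hpos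
    have : H.neighborFinset v ⊆ {u} := by
      intro w hw
      rw [SimpleGraph.mem_neighborFinset] at hw
      rw [Finset.mem_singleton]
      by_contra hwu
      have h1 := colMatrix_of_posSemidef_one h huv hwu hw.ne'
      have h2 : colMatrix H c u v = 1 := by simp [colMatrix_apply, huv, hcu]
      have h3 : H.Adj w u := by
        rw [← colMatrix_ne_zero_iff (c := c), h1, h2]
        have := colMatrix_ne_zero_iff (c := c).2 hw.symm
        simpa using this
      rw [h2, colMatrix_apply, colMatrix_apply, if_pos h3, if_pos hw.symm, hcu] at h1
      split_ifs at h1 <;> norm_num at h1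
    have h4 := Finset.card_le_card this
    rw [SimpleGraph.card_neighborFinset_eq_degree, Finset.card_singleton] at h4
    omega
  · push Not at hpos
    have hneg : ∀ u, H.Adj u v → colMatrix H c u v = -1 := fun u hu => by
      simp [colMatrix_apply, hu, hpos u hu]
    have hinj : Set.InjOn c (insert v (H.neighborFinset v) : Finset V) := by
      have key : ∀ a ∈ H.neighborFinset v, ∀ b ∈ H.neighborFinset v, c a = c b → a = b := by
        intro a ha b hb hab
        rw [SimpleGraph.mem_neighborFinset] at ha hb
        by_contra hne
        have h1 := colMatrix_of_posSemidef_one h ha.symm (Ne.symm hne) hb.ne'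
        rw [hneg a ha.symm, hneg b hb.symm, colMatrix_apply, hab] at h1
        by_cases hba : H.Adj b a <;> norm_num [hba] at h1
      intro a ha b hb hab
      rw [Finset.coe_insert, Set.mem_insert_iff, Finset.mem_coe] at ha hb
      rcases ha with rfl | ha <;> rcases hb with rfl | hb
      · rfl
      · rw [SimpleGraph.mem_neighborFinset] at hb
        exact absurd hab.symm (hpos b hb.symm)
      · rw [SimpleGraph.mem_neighborFinset] at ha
        exact absurd hab (hpos a ha.symm)
      · exact key a ha b hb hab
    have h4 := Finset.card_le_card_of_injOn (t := Finset.univ) c (fun _ _ => by simp) hinj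
    rw [Finset.card_insert_of_notMem (by simp), SimpleGraph.card_neighborFinset_eq_degree,
      Finset.card_univ, Fintype.card_fin] at h4
    exact h4

/-- Cauchy-Schwarz for `M = 1 - A`: `(tr M)² ≤ rank M * tr M²`, where `tr M = n` and `tr M² = n + ∑
deg ≤ n * p`. -/
theorem nullity_one_le {p : ℕ} (hp : 2 ≤ p) {c : V → Fin p} (h : (shiftMatrix 1 H c).PosSemidef) :
    (p : ℝ) * nullity (shiftMatrix 1 H c) ≤ (p - 1) * Fintype.card V := by
  have hA : (colMatrix H c).IsHermitian := isHermitian_colMatrix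
  set n := Fintype.card V with hn
  set S := Finset.univ.filter fun i => hA.eigenvalues i ≠ 1 with hS
  have hScard : (S.card : ℝ) = n - nullity (shiftMatrix 1 H c) := by
    have h1 := card_eigenvalues_eq_nullity hA 1
    rw [Nat.card_eq_fintype_card, Fintype.card_subtype] at h1
    have h2 := Finset.card_filter_add_card_filter_not (s := (Finset.univ : Finset V))
      (fun i => hA.eigenvalues i = 1)
    rw [h1, Finset.card_univ] at h2
    rw [shiftMatrix, eq_sub_iff_add_eq, add_comm]
    exact_mod_cast h2
  have hsum : ∑ i ∈ S, (1 - hA.eigenvalues i) = n := by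
    have h1 : ∑ i, hA.eigenvalues i = 0 := by
      simpa [trace_colMatrix] using (trace_pow_eq_sum hA 1).symm
    have h2 : ∑ i, (1 - hA.eigenvalues i) = n := by
      rw [Finset.sum_sub_distrib, h1]; simp [hn]
    rw [← h2, hS, Finset.sum_filter]
    refine Finset.sum_congr rfl fun i _ => ?_
    by_cases hi : hA.eigenvalues i = 1 <;> simp [hi]
  have hsq : ∑ i ∈ S, (1 - hA.eigenvalues i) ^ 2 ≤ (n : ℝ) * p := by
    have h1 : ∑ i, hA.eigenvalues i = 0 := by
      simpa [trace_colMatrix] using (trace_pow_eq_sum hA 1).symm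
    have h2 := trace_pow_eq_sum hA 2
    rw [trace_colMatrix_sq] at h2
    calc ∑ i ∈ S, (1 - hA.eigenvalues i) ^ 2 ≤ ∑ i, (1 - hA.eigenvalues i) ^ 2 :=
          Finset.sum_le_univ_sum_of_nonneg fun i => sq_nonneg _
      _ = ∑ i, (1 - 2 * hA.eigenvalues i + hA.eigenvalues i ^ 2) :=
          Finset.sum_congr rfl fun i _ => by ring
      _ = n + ∑ v, (H.degree v : ℝ) := by
          rw [Finset.sum_add_distrib, Finset.sum_sub_distrib, ← Finset.mul_sum, h1, ← h2]
          simp [hn]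
      _ = ∑ v, ((H.degree v : ℝ) + 1) := by
          rw [Finset.sum_add_distrib]; simp [hn, add_comm]
      _ ≤ ∑ _v : V, (p : ℝ) := Finset.sum_le_sum fun v _ => by
          exact_mod_cast degree_lt_of_posSemidef_one hp h v
      _ = n * p := by simp [hn]
  have hcs := sq_sum_le_card_mul_sum_sq (s := S) (f := fun i => 1 - hA.eigenvalues i)
  rw [hsum] at hcs
  rcases Nat.eq_zero_or_pos n with h0 | h0
  · have := nullity_le_card (shiftMatrix 1 H c)
    rw [← hn, h0] at this
    rw [Nat.le_zero.1 this, h0]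
    simp
  · have h0' : (0 : ℝ) < n := by exact_mod_cast h0
    have h3 : (n : ℝ) ^ 2 ≤ S.card * (n * p) :=
      hcs.trans (mul_le_mul_of_nonneg_left hsq (Nat.cast_nonneg _))
    have h4 : (n : ℝ) ≤ S.card * p := by
      by_contra hcon
      nlinarith
    rw [hScard] at h4
    linarith

/-- The negative complete graph attains the previous bound, since `1 - A` is the all-ones matrix, of
rank one. -/
theorem negative_complete (p : ℕ) (hp : 2 ≤ p) :
    (shiftMatrix 1 (⊤ : SimpleGraph (Fin p)) id).PosSemidef ∧
      (nullity (shiftMatrix 1 (⊤ : SimpleGraph (Fin p)) id) : ℝ) = p - 1 := by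
  have hJ : shiftMatrix 1 (⊤ : SimpleGraph (Fin p)) id = vecMulVec 1 1 := by
    ext u v
    by_cases h : u = v
    · subst h
      simp [shiftMatrix_self, vecMulVec_apply]
    · simp [shiftMatrix_of_ne _ h, colMatrix_apply, h, vecMulVec_apply]
  have hpsd : (shiftMatrix 1 (⊤ : SimpleGraph (Fin p)) id).PosSemidef := by
    rw [posSemidef_iff (isHermitian_shiftMatrix 1), hJ]
    intro x
    rw [vecMulVec_mulVec, dotProduct_smul, dotProduct_comm x 1]
    simpa using mul_self_nonneg ((1 : Fin p → ℝ) ⬝ᵥ x)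
  refine ⟨hpsd, le_antisymm ?_ ?_⟩
  · have h1 := nullity_one_le hp hpsd
    rw [Fintype.card_fin] at h1
    have : (0 : ℝ) < p := by positivity
    nlinarith
  · have h1 := nullity_add_rank (shiftMatrix 1 (⊤ : SimpleGraph (Fin p)) id)
    have h2 : (shiftMatrix 1 (⊤ : SimpleGraph (Fin p)) id).rank ≤ 1 := by
      rw [hJ]; exact rank_vecMulVec_le _ _
    rw [Fintype.card_fin] at h1
    have h3 : p ≤ nullity (shiftMatrix 1 (⊤ : SimpleGraph (Fin p)) id) + 1 := by omega
    have h4 : (p : ℝ) ≤ nullity (shiftMatrix 1 (⊤ : SimpleGraph (Fin p)) id) + 1 := by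
      exact_mod_cast h3
    linarith

end EigenvalueOne

/-! ### Extremal signed graphs -/

section Examples

/-- The graph with the given list of edges. -/
def listGraph (n : ℕ) (l : List (Fin n × Fin n)) : SimpleGraph (Fin n) where
  Adj u v := u ≠ v ∧ ((u, v) ∈ l ∨ (v, u) ∈ l)
  symm := ⟨fun _ _ h => ⟨h.1.symm, h.2.symm⟩⟩
  loopless := ⟨fun _ h => h.1 rfl⟩

instance (n : ℕ) (l : List (Fin n × Fin n)) : DecidableRel (listGraph n l).Adj :=
  fun u v => inferInstanceAs (Decidable (u ≠ v ∧ ((u, v) ∈ l ∨ (v, u) ∈ l)))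

/-- The integer version of the signed adjacency matrix. -/
def intMatrix {n t : ℕ} (l : List (Fin n × Fin n)) (c : Fin n → Fin t) :
    Matrix (Fin n) (Fin n) ℤ :=
  of fun u v => if (listGraph n l).Adj u v then if c u = c v then 1 else -1 else 0

theorem colMatrix_listGraph {n t : ℕ} (l : List (Fin n × Fin n)) (c : Fin n → Fin t) :
    colMatrix (listGraph n l) c = (intMatrix l c).map (Int.castRingHom ℝ) := by
  ext u v
  simp only [colMatrix_apply, intMatrix, map_apply, of_apply]
  split_ifs <;> simp

theorem colMatrix_comp {V κ κ' : Type*} (H : SimpleGraph V) (c : V → κ) {f : κ → κ'}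
    (hf : Function.Injective f) : colMatrix H (f ∘ c) = colMatrix H c := by
  ext u v
  by_cases h : c u = c v <;> simp [colMatrix_apply, Function.comp_apply, hf.eq_iff, h]

/-- A signed graph given by a list of edges with `A ^ 3 = k • A`. -/
theorem example_of_list {n t : ℕ} (l : List (Fin n × Fin n)) (c : Fin n → Fin t) {k m : ℕ}
    (hk : 0 < k)
    (h3 : intMatrix l c * intMatrix l c * intMatrix l c = (k : ℤ) • intMatrix l c)
    (htr : (intMatrix l c * intMatrix l c).trace = 2 * k * m) {q : ℕ} (htq : t ≤ q) :
    ∃ c' : Fin n → Fin q, (shiftMatrix √k (listGraph n l) c').PosSemidef ∧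
      nullity (shiftMatrix √k (listGraph n l) c') = m := by
  refine ⟨Fin.castLE htq ∘ c, ?_⟩
  have hk' : (0 : ℝ) < k := by exact_mod_cast hk
  have hsq : √(k : ℝ) ^ 2 = k := Real.sq_sqrt hk'.le
  have hc := colMatrix_comp (listGraph n l) c (Fin.castLE_injective htq)
  have h2 : colMatrix (listGraph n l) c ^ 2 =
      (intMatrix l c * intMatrix l c).map (Int.castRingHom ℝ) := by
    rw [colMatrix_listGraph, pow_two, Matrix.map_mul]
  obtain ⟨h4, h5⟩ := posSemidef_and_nullity_of_pow_three (H := listGraph n l)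
    (c := Fin.castLE htq ∘ c) (Real.sqrt_pos.2 hk') (by
      rw [hc, pow_succ, h2, colMatrix_listGraph, ← Matrix.map_mul, h3, hsq]
      ext u v
      rw [map_apply, Matrix.smul_apply, Matrix.smul_apply, map_apply, smul_eq_mul, map_mul]
      simp)
  refine ⟨h4, ?_⟩
  rw [hc, h2, hsq] at h5
  have h6 : ((intMatrix l c * intMatrix l c).map (Int.castRingHom ℝ)).trace = 2 * k * m := by
    have : ((intMatrix l c * intMatrix l c).map (Int.castRingHom ℝ)).trace =
        ((intMatrix l c * intMatrix l c).trace : ℝ) := by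
      simp [trace]
    rw [this, htr]
    push_cast
    ring
  rw [h6] at h5
  have h7 : (nullity (shiftMatrix √k (listGraph n l) (Fin.castLE htq ∘ c)) : ℝ) = m :=
    mul_left_cancel₀ (by positivity) h5
  exact_mod_cast h7

theorem exists_edge (q : ℕ) (hq : 1 ≤ q) : ∃ (H : SimpleGraph (Fin 2)) (c : Fin 2 → Fin q),
    (shiftMatrix 1 H c).PosSemidef ∧ nullity (shiftMatrix 1 H c) = 1 := by
  obtain ⟨c, h⟩ := example_of_list [((0 : Fin 2), (1 : Fin 2))] (fun _ => (0 : Fin 1)) (k := 1)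
    (m := 1) one_pos (by decide) (by decide) hq
  rw [Nat.cast_one, Real.sqrt_one] at h
  exact ⟨_, c, h⟩

theorem exists_path (q : ℕ) (hq : 1 ≤ q) : ∃ (H : SimpleGraph (Fin 3)) (c : Fin 3 → Fin q),
    (shiftMatrix √2 H c).PosSemidef ∧ nullity (shiftMatrix √2 H c) = 1 := by
  obtain ⟨c, h⟩ := example_of_list [((0 : Fin 3), (1 : Fin 3)), (1, 2)] (fun _ => (0 : Fin 1))
    (k := 2) (m := 1) two_pos (by decide) (by decide) hq
  exact ⟨_, c, h⟩

theorem exists_claw (q : ℕ) (hq : 1 ≤ q) : ∃ (H : SimpleGraph (Fin 4)) (c : Fin 4 → Fin q),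
    (shiftMatrix √3 H c).PosSemidef ∧ nullity (shiftMatrix √3 H c) = 1 := by
  obtain ⟨c, h⟩ := example_of_list [((0 : Fin 4), (1 : Fin 4)), (0, 2), (0, 3)]
    (fun _ => (0 : Fin 1)) (k := 3) (m := 1) three_pos (by decide) (by decide) hq
  exact ⟨_, c, h⟩

/-- A four-cycle with three negative edges satisfies `A² = 2`. Three colors are needed, as
two-colored cycles can be switched to positive ones. -/
theorem exists_square (q : ℕ) (hq : 3 ≤ q) : ∃ (H : SimpleGraph (Fin 4)) (c : Fin 4 → Fin q),
    (shiftMatrix √2 H c).PosSemidef ∧ nullity (shiftMatrix √2 H c) = 2 := by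
  obtain ⟨c, h⟩ := example_of_list [((0 : Fin 4), (1 : Fin 4)), (1, 2), (2, 3), (3, 0)]
    (![0, 0, 1, 2] : Fin 4 → Fin 3) (k := 2) (m := 2) two_pos (by decide) (by decide) hq
  exact ⟨_, c, h⟩

/-- A cube all of whose faces are negative four-cycles satisfies `A² = 3`; four colors realize such
signs. -/
theorem exists_cube (q : ℕ) (hq : 4 ≤ q) : ∃ (H : SimpleGraph (Fin 8)) (c : Fin 8 → Fin q),
    (shiftMatrix √3 H c).PosSemidef ∧ nullity (shiftMatrix √3 H c) = 4 := by
  obtain ⟨c, h⟩ := example_of_list [((0 : Fin 8), (1 : Fin 8)), (2, 3), (4, 5), (6, 7), (0, 2),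
    (1, 3), (4, 6), (5, 7), (0, 4), (1, 5), (2, 6), (3, 7)]
    (![3, 0, 1, 0, 2, 2, 1, 3] : Fin 8 → Fin 4) (k := 3) (m := 4) three_pos
    (by decide +kernel) (by decide +kernel) hq
  exact ⟨_, c, h⟩

/-- The signed cube with a vertex deleted. -/
theorem exists_punctured_cube (q : ℕ) (hq : 3 ≤ q) :
    ∃ (H : SimpleGraph (Fin 7)) (c : Fin 7 → Fin q),
    (shiftMatrix √3 H c).PosSemidef ∧ nullity (shiftMatrix √3 H c) = 3 := by
  -- If `B² = 3`, deleting a vertex with column `b` leaves `A b = 0` and `A² = 3 - b bᵀ`, hence `A³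
  -- = 3 A`; three colors now suffice.
  obtain ⟨c, h⟩ := example_of_list [((0 : Fin 7), (1 : Fin 7)), (0, 2), (2, 3), (1, 4), (1, 5),
    (2, 5), (3, 6), (4, 6), (5, 6)]
    (![0, 0, 1, 0, 1, 2, 2] : Fin 7 → Fin 3) (k := 3) (m := 3) three_pos
    (by decide +kernel) (by decide +kernel) hq
  exact ⟨_, c, h⟩

end Examples

/-! ### Balls and geodesics in graphs -/

section Balls

open scoped Classical

variable {V : Type*} [Fintype V]

/-- The ball of radius `r` around `v` in a graph. -/
noncomputable def graphBall (H : SimpleGraph V) (v : V) : ℕ → Finset V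
  | 0 => {v}
  | r + 1 => graphBall H v r ∪ (graphBall H v r).biUnion fun w => Finset.univ.filter fun y => H.Adj w y

variable {H : SimpleGraph V} {v w : V} {r : ℕ}

theorem mem_graphBall_succ : w ∈ graphBall H v (r + 1) ↔
    w ∈ graphBall H v r ∨ ∃ y ∈ graphBall H v r, H.Adj y w := by
  simp [graphBall]

theorem self_mem_graphBall : v ∈ graphBall H v r := by
  induction r with
  | zero => simp [graphBall]
  | succ r ih => exact mem_graphBall_succ.2 (Or.inl ih)

theorem graphBall_mono {s : ℕ} (h : r ≤ s) : graphBall H v r ⊆ graphBall H v s := by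
  induction h with
  | refl => exact subset_rfl
  | step _ ih => exact fun y hy => mem_graphBall_succ.2 (Or.inl (ih hy))

theorem card_graphBall_le {Δ : ℕ} (hdeg : ∀ x, (Finset.univ.filter fun y => H.Adj x y).card ≤ Δ)
    (v : V) (r : ℕ) : (graphBall H v r).card ≤ (Δ + 1) ^ r := by
  induction r with
  | zero => simp [graphBall]
  | succ r ih =>
    have h1 := Finset.card_biUnion_le_card_mul (graphBall H v r)
      (fun w => Finset.univ.filter fun y => H.Adj w y) Δ fun w _ => hdeg w
    calc (graphBall H v (r + 1)).card ≤ (graphBall H v r).card + (graphBall H v r).card * Δ :=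
          (Finset.card_union_le _ _).trans (by gcongr)
      _ = (graphBall H v r).card * (Δ + 1) := by ring
      _ ≤ (Δ + 1) ^ r * (Δ + 1) := by gcongr
      _ = (Δ + 1) ^ (r + 1) := by ring

/-- A geodesic path ending at a vertex of a sphere. -/
theorem exists_geodesic (v : V) : ∀ (r : ℕ) (w : V), w ∈ graphBall H v r →
    (∀ s < r, w ∉ graphBall H v s) →
    ∃ u : ℕ → V, u r = w ∧ (∀ i ≤ r, u i ∈ graphBall H v i ∧ ∀ s < i, u i ∉ graphBall H v s) ∧
      ∀ i < r, H.Adj (u i) (u (i + 1))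
  | 0, w, hw, hw' => ⟨fun _ => w, rfl, fun i hi => by
      obtain rfl : i = 0 := by omega
      exact ⟨hw, hw'⟩, fun i hi => by omega⟩
  | r + 1, w, hw, hw' => by
    rcases mem_graphBall_succ.1 hw with h | ⟨y, hy, hyw⟩
    · exact absurd h (hw' r (by omega))
    · obtain ⟨u, hu, hu1, hu2⟩ := exists_geodesic v r y hy fun s hs h =>
        hw' (s + 1) (by omega) (mem_graphBall_succ.2 (Or.inr ⟨y, h, hyw⟩))
      refine ⟨fun i => if i ≤ r then u i else w, by simp, fun i hi => ?_, fun i hi => ?_⟩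
      · by_cases h : i ≤ r
        · simp only [h, if_true]
          exact hu1 i h
        · obtain rfl : i = r + 1 := by omega
          simpa using ⟨hw, fun s hs => hw' s (by omega)⟩
      · by_cases h : i + 1 ≤ r
        · simp only [h, show i ≤ r by omega, if_true]
          exact hu2 i (by omega)
        · obtain rfl : i = r := by omega
          simpa [hu] using hyw

end Balls

/-! ### Deleting a bounded set when long paths are negative -/

section LocalToGlobal

open scoped Classical

variable {V κ : Type*} [Fintype V] [DecidableEq V] {H : SimpleGraph V} {c : V → κ} {lam : ℝ}

/-- Consecutive vertices adjacent, all other pairs distinct and nonadjacent. -/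
def IsInducedPath (H : SimpleGraph V) (D : ℕ) (u : ℕ → V) : Prop :=
  (∀ i < D, H.Adj (u i) (u (i + 1))) ∧
    ∀ i j, i + 1 < j → j ≤ D → u i ≠ u j ∧ ¬ H.Adj (u i) (u j)

/-- Signs along a path making all its edges positive. -/
noncomputable def pathSign (H : SimpleGraph V) (c : V → κ) (u : ℕ → V) : ℕ → ℝ
  | 0 => 1
  | i + 1 => pathSign H c u i * colMatrix H c (u i) (u (i + 1))

/-- The signed weighted indicator of a path. -/
noncomputable def pathVec (H : SimpleGraph V) (c : V → κ) (u : ℕ → V) (w : ℕ → ℝ) (n : ℕ) :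
    V → ℝ := ∑ i ∈ Finset.range (n + 1), (pathSign H c u i * w i) • Pi.single (u i) 1

theorem pathSign_sq {D : ℕ} {u : ℕ → V} (hu : IsInducedPath H D u) :
    ∀ i ≤ D, pathSign H c u i * pathSign H c u i = 1
  | 0, _ => by simp [pathSign]
  | i + 1, hi => by
    rw [pathSign]
    have h1 := pathSign_sq hu i (by omega)
    have h2 := colMatrix_sq (c := c) (hu.1 i (by omega))
    linear_combination (colMatrix H c (u i) (u (i + 1)) * colMatrix H c (u i) (u (i + 1))) * h1 + h2

theorem mulVec_pathVec (u : ℕ → V) (w : ℕ → ℝ) (n : ℕ) (y : V) :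
    (shiftMatrix lam H c *ᵥ pathVec H c u w n) y =
      ∑ i ∈ Finset.range (n + 1), pathSign H c u i * w i * shiftMatrix lam H c y (u i) := by
  simp [pathVec, mulVec_sum, mulVec_smul]

/-- The signs switch every edge of an induced path to positive, so the energy is that of an unsigned
weighted path. It is negative for suitable weights as soon as the path has radius above `lam`. -/
theorem pathVec_form {D : ℕ} {u : ℕ → V} (hu : IsInducedPath H D u) (w : ℕ → ℝ) :
    ∀ n ≤ D, pathVec H c u w n ⬝ᵥ shiftMatrix lam H c *ᵥ pathVec H c u w n =
      lam * ∑ i ∈ Finset.range (n + 1), w i ^ 2 - 2 * ∑ i ∈ Finset.range n, w i * w (i + 1)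
  | 0, _ => by
    simp [pathVec, pathSign, mulVec_smul, shiftMatrix_self]
    ring
  | n + 1, hn => by
    have ih := pathVec_form hu w n (by omega)
    have hstep : pathVec H c u w (n + 1) = pathVec H c u w n +
        (pathSign H c u (n + 1) * w (n + 1)) • Pi.single (u (n + 1)) 1 := by
      rw [pathVec, Finset.sum_range_succ, pathVec]
    have hlast : (shiftMatrix lam H c *ᵥ pathVec H c u w n) (u (n + 1)) =
        - (pathSign H c u n * w n * colMatrix H c (u n) (u (n + 1))) := by
      rw [mulVec_pathVec, Finset.sum_eq_single n]
      · have := (hu.1 n (by omega)).ne'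
        rw [shiftMatrix_of_ne _ this, colMatrix_symm]
        ring
      · intro i hi hin
        rw [Finset.mem_range] at hi
        have h1 := hu.2 i (n + 1) (by omega) hn
        rw [shiftMatrix_eq_zero _ h1.1.symm fun h => h1.2 h.symm, mul_zero]
      · simp
    set x := pathVec H c u w n with hx
    set e : V → ℝ := Pi.single (u (n + 1)) 1 with he
    set M := shiftMatrix lam H c with hM
    have h1 : e ⬝ᵥ M *ᵥ x = (M *ᵥ x) (u (n + 1)) := by simp [he]
    have h2 : x ⬝ᵥ M *ᵥ e = (M *ᵥ x) (u (n + 1)) := by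
      rw [dotProduct_mulVec_symm (isHermitian_shiftMatrix lam), h1]
    have h3 : e ⬝ᵥ M *ᵥ e = lam := by simp [he, hM, shiftMatrix_self]
    have h4 := pathSign_sq (c := c) hu (n + 1) hn
    have h5 : pathSign H c u (n + 1) = pathSign H c u n * colMatrix H c (u n) (u (n + 1)) := rfl
    rw [hstep, mulVec_add, mulVec_smul, add_dotProduct, dotProduct_add, dotProduct_add,
      smul_dotProduct, smul_dotProduct, dotProduct_smul, dotProduct_smul, h1, h2, h3, ih, hlast,
      Finset.sum_range_succ _ (n + 1), Finset.sum_range_succ _ n]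
    simp only [smul_eq_mul]
    rw [Finset.sum_range_succ (fun i => w i * w (i + 1)) n]
    linear_combination (lam * w (n + 1) ^ 2 - 2 * w n * w (n + 1)) * h4 +
      2 * w n * w (n + 1) * pathSign H c u (n + 1) * h5

theorem pathVec_support {u : ℕ → V} {w : ℕ → ℝ} {n : ℕ} {y : V}
    (hy : y ∉ (Finset.range (n + 1)).image u) : pathVec H c u w n y = 0 := by
  rw [pathVec, Finset.sum_apply]
  refine Finset.sum_eq_zero fun i hi => ?_
  have : y ≠ u i := fun h => hy (Finset.mem_image.2 ⟨i, hi, h.symm⟩)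
  simp [this]

theorem form_split {M : Matrix V V ℝ} (B : Finset V) (h1 : ∀ u v, u ∈ B → v ∉ B → M u v = 0)
    (h2 : ∀ u v, u ∉ B → v ∈ B → M u v = 0) (y : V → ℝ) :
    y ⬝ᵥ M *ᵥ y = (fun v => if v ∈ B then y v else 0) ⬝ᵥ M *ᵥ (fun v => if v ∈ B then y v else 0) +
      (fun v => if v ∈ B then 0 else y v) ⬝ᵥ M *ᵥ (fun v => if v ∈ B then 0 else y v) := by
  simp only [dotProduct, mulVec, Finset.mul_sum, ← Finset.sum_add_distrib]
  refine Finset.sum_congr rfl fun u _ => Finset.sum_congr rfl fun v _ => ?_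
  by_cases hu : u ∈ B <;> by_cases hv : v ∈ B <;> simp [hu, hv, h1, h2]

/-- If geodesic paths of length `D` are negative, a negative form is negative on a small set. -/
theorem exists_small_negative {Δ D : ℕ} (hD : 0 < D)
    (hdeg : ∀ x, (Finset.univ.filter fun y => H.Adj x y).card ≤ Δ) {w : ℕ → ℝ}
    (hw : lam * ∑ i ∈ Finset.range (D + 1), w i ^ 2 < 2 * ∑ i ∈ Finset.range D, w i * w (i + 1)) :
    ∀ (n : ℕ) (y : V → ℝ), (Finset.univ.filter fun v => y v ≠ 0).card = n →
      y ⬝ᵥ shiftMatrix lam H c *ᵥ y < 0 →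
      ∃ (W : Finset V) (z : V → ℝ), W.card ≤ D + 1 + (Δ + 1) ^ D ∧ (∀ v, v ∉ W → z v = 0) ∧
        z ⬝ᵥ shiftMatrix lam H c *ᵥ z < 0 := by
  intro n
  induction n using Nat.strong_induction_on with
  | _ n ih =>
    intro y hn hy
    have hex : ∃ v, y v ≠ 0 := by
      by_contra hcon
      push Not at hcon
      have : y = 0 := funext hcon
      rw [this] at hy
      simp at hy
    obtain ⟨v₀, hv₀⟩ := hex
    -- Either the ball still grows at radius `D`, and a geodesic to its last layer is an induced
    -- path with negative energy, or the ball is a full component.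
    by_cases hlayer : ∃ x ∈ graphBall H v₀ D, x ∉ graphBall H v₀ (D - 1)
    · obtain ⟨x, hx, hx'⟩ := hlayer
      obtain ⟨u, -, hu1, hu2⟩ := exists_geodesic v₀ D x hx fun s hs h =>
        hx' (graphBall_mono (by omega) h)
      have hu : IsInducedPath H D u := by
        refine ⟨hu2, fun i j hij hj => ⟨fun h => ?_, fun h => ?_⟩⟩
        · exact (hu1 j hj).2 i (by omega) (h ▸ (hu1 i (by omega)).1)
        · exact (hu1 j hj).2 (i + 1) hij
            (mem_graphBall_succ.2 (Or.inr ⟨u i, (hu1 i (by omega)).1, h⟩))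
      refine ⟨(Finset.range (D + 1)).image u, pathVec H c u w D, ?_, fun v hv => pathVec_support hv,
        ?_⟩
      · refine Finset.card_image_le.trans ?_
        rw [Finset.card_range]
        omega
      · rw [pathVec_form hu w D le_rfl]
        linarith
    · push Not at hlayer
      set B := graphBall H v₀ D with hB
      have hclosed : ∀ u v, u ∈ B → H.Adj u v → v ∈ B := by
        intro u v hu huv
        have h1 := hlayer u hu
        have h2 : v ∈ graphBall H v₀ (D - 1 + 1) := mem_graphBall_succ.2 (Or.inr ⟨u, h1, huv⟩)
        rwa [show D - 1 + 1 = D by omega] at h2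
      have hz : ∀ u v, u ∈ B → v ∉ B → shiftMatrix lam H c u v = 0 := fun u v hu hv =>
        shiftMatrix_eq_zero _ (fun h => hv (h ▸ hu)) fun h => hv (hclosed u v hu h)
      have hz' : ∀ u v, u ∉ B → v ∈ B → shiftMatrix lam H c u v = 0 := fun u v hu hv =>
        shiftMatrix_eq_zero _ (fun h => hu (h ▸ hv)) fun h => hu (hclosed v u hv h.symm)
      -- The energy splits along the component: either it is negative on the component, which is
      -- small, or the component can be dropped, removing `v₀` from the support.
      have hsplit := form_split B hz hz' y
      by_cases hneg : (fun v => if v ∈ B then y v else 0) ⬝ᵥ shiftMatrix lam H c *ᵥ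
          (fun v => if v ∈ B then y v else 0) < 0
      · refine ⟨B, _, (card_graphBall_le hdeg v₀ D).trans (by omega), fun v hv => ?_, hneg⟩
        simp [hv]
      · refine ih _ ?_ (fun v => if v ∈ B then 0 else y v) rfl (by linarith)
        rw [← hn]
        refine Finset.card_lt_card ⟨fun v hv => ?_, fun hsub => ?_⟩
        · rw [Finset.mem_filter] at hv ⊢
          refine ⟨hv.1, fun h => hv.2 ?_⟩
          simp [h]
        · have := hsub (Finset.mem_filter.2 ⟨Finset.mem_univ v₀, hv₀⟩)
          rw [Finset.mem_filter] at this
          exact this.2 (by simp [hB, self_mem_graphBall])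

theorem cross_form_eq_zero {W W' : Finset V} (h : ∀ a ∈ W, ∀ b ∈ W', a ≠ b ∧ ¬ H.Adj a b)
    {x y : V → ℝ} (hx : ∀ v, v ∉ W → x v = 0) (hy : ∀ v, v ∉ W' → y v = 0) :
    x ⬝ᵥ shiftMatrix lam H c *ᵥ y = 0 := by
  simp only [dotProduct, mulVec, Finset.mul_sum]
  refine Finset.sum_eq_zero fun a _ => Finset.sum_eq_zero fun b _ => ?_
  by_cases ha : a ∈ W
  · by_cases hb : b ∈ W'
    · rw [shiftMatrix_eq_zero _ (h a ha b hb).1 (h a ha b hb).2]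
      simp
    · simp [hy b hb]
  · simp [hx a ha]

/-- A family of `j` negative vectors supported on small sets that do not touch each other. -/
def HasNegFamily (H : SimpleGraph V) (c : V → κ) (lam : ℝ) (S j : ℕ) : Prop :=
  ∃ (W : Fin j → Finset V) (x : Fin j → V → ℝ), (∀ i, (W i).card ≤ S) ∧
    (∀ i v, v ∉ W i → x i v = 0) ∧ (∀ i, x i ⬝ᵥ shiftMatrix lam H c *ᵥ x i < 0) ∧
    ∀ i k, i ≠ k → ∀ a ∈ W i, ∀ b ∈ W k, a ≠ b ∧ ¬ H.Adj a b

/-- A maximal family of small negative vectors; its neighborhood is bounded. -/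
theorem exists_maximal_negFamily {Δ s : ℕ} (S : ℕ)
    (hdeg : ∀ x, (Finset.univ.filter fun y => H.Adj x y).card ≤ Δ)
    (hs : NegRankLE (shiftMatrix lam H c) s) :
    ∃ T : Finset V, T.card ≤ s * (S * (Δ + 1)) ∧
      ∀ (W : Finset V) (z : V → ℝ), W.card ≤ S → (∀ v ∈ W, v ∉ T) → (∀ v, v ∉ W → z v = 0) →
        0 ≤ z ⬝ᵥ shiftMatrix lam H c *ᵥ z := by
  -- Vectors whose supports do not touch are orthogonal for the form, so at most `s` of them are
  -- negative. The set to delete is the closed neighborhood of the supports of a longest such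
  -- family.
  obtain ⟨j, hj, ⟨W, x, hW, hx, hneg, hsep⟩, hmax⟩ : ∃ j ≤ s, HasNegFamily H c lam S j ∧
      ¬ HasNegFamily H c lam S (j + 1) := by
    by_contra hcon
    push Not at hcon
    have : ∀ j ≤ s + 1, HasNegFamily H c lam S j := by
      intro j
      induction j with
      | zero => exact fun _ => ⟨fun i => i.elim0, fun i => i.elim0, fun i => i.elim0,
          fun i => i.elim0, fun i => i.elim0, fun i => i.elim0⟩
      | succ j ih => exact fun hj => hcon j (by omega) (ih (by omega))
    obtain ⟨W, x, hW, hx, hneg, hsep⟩ := this (s + 1) le_rfl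
    obtain ⟨i, hi⟩ := hs x fun i k hik => cross_form_eq_zero (hsep i k hik) (hx i) (hx k)
    linarith [hneg i]
  let N : Finset V → Finset V := fun W => W ∪ W.biUnion fun a => Finset.univ.filter fun y => H.Adj a y
  have hN : ∀ i, (N (W i)).card ≤ S * (Δ + 1) := by
    intro i
    refine (Finset.card_union_le _ _).trans ?_
    have := Finset.card_biUnion_le_card_mul (W i) (fun a => Finset.univ.filter fun y => H.Adj a y)
      Δ fun a _ => hdeg a
    calc _ ≤ (W i).card + (W i).card * Δ := by gcongr
      _ = (W i).card * (Δ + 1) := by ring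
      _ ≤ S * (Δ + 1) := by gcongr; exact hW i
  refine ⟨Finset.univ.biUnion fun i => N (W i), ?_, ?_⟩
  · refine (Finset.card_biUnion_le_card_mul _ _ _ fun i _ => hN i).trans ?_
    rw [Finset.card_univ, Fintype.card_fin]
    gcongr
  · intro W' z hW' hT hz
    by_contra hcon
    push Not at hcon
    have hfar : ∀ i, ∀ a ∈ W i, ∀ b ∈ W', a ≠ b ∧ ¬ H.Adj a b := by
      intro i a ha b hb
      have hb' : b ∉ N (W i) := fun h => hT b hb (Finset.mem_biUnion.2 ⟨i, Finset.mem_univ _, h⟩)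
      refine ⟨fun h => hb' (Finset.mem_union_left _ (h ▸ ha)), fun h => hb' ?_⟩
      exact Finset.mem_union_right _ (Finset.mem_biUnion.2 ⟨a, ha, by simpa using h⟩)
    refine hmax ⟨Fin.cons W' W, Fin.cons z x, ?_, ?_, ?_, ?_⟩
    · exact fun i => Fin.cases hW' hW i
    · exact fun i => Fin.cases hz hx i
    · exact fun i => Fin.cases hcon hneg i
    · intro i k
      refine Fin.cases ?_ (fun i => ?_) i <;> refine Fin.cases ?_ (fun k => ?_) k
      · simp
      · intro _ a ha b hb
        have := hfar k b hb a ha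
        exact ⟨this.1.symm, fun h => this.2 h.symm⟩
      · intro _ a ha b hb
        exact hfar i a ha b hb
      · intro hik a ha b hb
        exact hsep i k (fun h => hik (by rw [h])) a ha b hb

/-- Deleting a bounded set of vertices makes the form positive semidefinite. -/
theorem exists_restr_posSemidef {Δ D s : ℕ} (hD : 0 < D)
    (hdeg : ∀ x, (Finset.univ.filter fun y => H.Adj x y).card ≤ Δ) {w : ℕ → ℝ}
    (hw : lam * ∑ i ∈ Finset.range (D + 1), w i ^ 2 < 2 * ∑ i ∈ Finset.range D, w i * w (i + 1))
    (hs : NegRankLE (shiftMatrix lam H c) s) :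
    ∃ T : Finset V, T.card ≤ s * ((D + 1 + (Δ + 1) ^ D) * (Δ + 1)) ∧
      (restr (shiftMatrix lam H c) fun v => v ∉ T).PosSemidef := by
  obtain ⟨T, hT, hpos⟩ := exists_maximal_negFamily (D + 1 + (Δ + 1) ^ D) hdeg hs
  refine ⟨T, hT, ?_⟩
  rw [posSemidef_iff (isHermitian_restr (isHermitian_shiftMatrix lam) _)]
  intro y
  by_contra hcon
  push Not at hcon
  rw [restr_shiftMatrix] at hcon
  have hdeg' : ∀ x : {v // v ∉ T},
      (Finset.univ.filter fun y => (H.comap Subtype.val).Adj x y).card ≤ Δ := by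
    intro x
    refine le_trans (Finset.card_le_card_of_injOn Subtype.val ?_ ?_) (hdeg x.1)
    · intro y hy
      simpa using hy
    · exact fun a _ b _ h => Subtype.ext h
  obtain ⟨W, z, hW, hz, hneg⟩ := exists_small_negative hD hdeg' hw _ y rfl hcon
  rw [← restr_shiftMatrix, ← extendZero_dotProduct_mulVec] at hneg
  refine absurd (hpos (W.map (Function.Embedding.subtype _)) (extendZero z) (by simpa using hW)
    ?_ ?_) (not_le.2 hneg)
  · intro v hv
    obtain ⟨a, -, rfl⟩ := Finset.mem_map.1 hv
    exact a.2
  · intro v hv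
    by_cases h : v ∉ T
    · refine (extendZero_val z ⟨v, h⟩).trans ?_
      exact hz _ fun hW => hv (Finset.mem_map.2 ⟨⟨v, h⟩, hW, rfl⟩)
    · exact extendZero_of_not z h

/-- A bound for positive semidefinite colored graphs extends to bounded negative index. -/
theorem exists_nullity_bound {p s D : ℕ} {κ lam : ℝ} (hκ : 0 ≤ κ) (hD : 0 < D) {w : ℕ → ℝ}
    (hw : lam * ∑ i ∈ Finset.range (D + 1), w i ^ 2 < 2 * ∑ i ∈ Finset.range D, w i * w (i + 1))
    (hpsd : ∀ (V : Type) [Fintype V] [DecidableEq V] (H : SimpleGraph V) (c : V → Fin p),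
      (shiftMatrix lam H c).PosSemidef →
      (nullity (shiftMatrix lam H c) : ℝ) ≤ κ * Fintype.card V) (Δ : ℕ) :
    ∃ C : ℝ, ∀ (V : Type) [Fintype V] [DecidableEq V] (H : SimpleGraph V) (c : V → Fin p),
      (∀ x, (Finset.univ.filter fun y => H.Adj x y).card ≤ Δ) →
      NegRankLE (shiftMatrix lam H c) s →
      (nullity (shiftMatrix lam H c) : ℝ) ≤ κ * Fintype.card V + C := by
  refine ⟨(s * ((D + 1 + (Δ + 1) ^ D) * (Δ + 1)) : ℕ), fun V _ _ H c hdeg hs => ?_⟩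
  obtain ⟨T, hT, hpos⟩ := exists_restr_posSemidef hD hdeg hw hs
  have h1 := nullity_le_restr_add (shiftMatrix lam H c) fun v => v ∉ T
  rw [restr_shiftMatrix] at hpos h1
  have h2 := hpsd _ _ _ hpos
  have h3 : Fintype.card {v // ¬ v ∉ T} ≤ s * ((D + 1 + (Δ + 1) ^ D) * (Δ + 1)) := by
    refine le_trans ?_ hT
    rw [Fintype.card_subtype]
    exact Finset.card_le_card fun v hv => by simpa using hv
  have h4 : (Fintype.card {v // v ∉ T} : ℝ) ≤ Fintype.card V := by
    exact_mod_cast Fintype.card_subtype_le _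
  have h5 : (nullity (shiftMatrix lam H c) : ℝ) ≤
      nullity (shiftMatrix lam (H.comap (Subtype.val : {v // v ∉ T} → V)) (c ∘ Subtype.val)) +
      (s * ((D + 1 + (Δ + 1) ^ D) * (Δ + 1)) : ℕ) := by
    exact_mod_cast h1.trans (Nat.add_le_add_left h3 _)
  linarith [mul_le_mul_of_nonneg_left h4 hκ]

end LocalToGlobal

/-! ### Connected graphs, nets and components -/

section Connectivity

open scoped Classical

variable {V : Type*} [Fintype V] {H : SimpleGraph V}

/-- A graph without nontrivial sets closed under adjacency. -/
def NoSplit {V : Type*} (H : SimpleGraph V) : Prop :=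
  ∀ P : V → Prop, (∀ u v, H.Adj u v → P u → P v) → ∀ u, P u → ∀ v, P v

theorem graphBall_trans {v x y : V} {r : ℕ} (hx : x ∈ graphBall H v r) :
    ∀ {s : ℕ}, y ∈ graphBall H x s → y ∈ graphBall H v (r + s)
  | 0, hy => by
    obtain rfl : y = x := by simpa [graphBall] using hy
    exact hx
  | s + 1, hy => by
    rw [← add_assoc, mem_graphBall_succ]
    rcases mem_graphBall_succ.1 hy with h | ⟨z, hz, hzy⟩
    · exact Or.inl (graphBall_trans hx h)
    · exact Or.inr ⟨z, graphBall_trans hx hz, hzy⟩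

theorem graphBall_symm {v : V} : ∀ {r : ℕ} {w : V}, w ∈ graphBall H v r → v ∈ graphBall H w r
  | 0, w, hw => by
    obtain rfl : w = v := by simpa [graphBall] using hw
    exact hw
  | r + 1, w, hw => by
    rcases mem_graphBall_succ.1 hw with h | ⟨y, hy, hyw⟩
    · exact graphBall_mono (by omega) (graphBall_symm h)
    · have h1 : y ∈ graphBall H w 1 :=
        mem_graphBall_succ.2 (Or.inr ⟨w, self_mem_graphBall, hyw.symm⟩)
      rw [add_comm]
      exact graphBall_trans h1 (graphBall_symm hy)

/-- A ball that stops growing is closed under adjacency, hence is everything. -/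
theorem NoSplit.graphBall_growth (hH : NoSplit H) (v : V) :
    ∀ r, (∀ w, w ∈ graphBall H v r) ∨ r + 1 ≤ (graphBall H v r).card
  | 0 => Or.inr (by simp [graphBall])
  | r + 1 => by
    rcases hH.graphBall_growth v r with h | h
    · exact Or.inl fun w => graphBall_mono (by omega) (h w)
    · by_cases heq : graphBall H v (r + 1) ⊆ graphBall H v r
      · left
        intro w
        refine graphBall_mono (Nat.le_succ r) (hH (fun y => y ∈ graphBall H v r) ?_ v
          self_mem_graphBall w)
        exact fun a b hab ha => heq (mem_graphBall_succ.2 (Or.inr ⟨a, ha, hab⟩))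
      · right
        have : (graphBall H v r).card < (graphBall H v (r + 1)).card :=
          Finset.card_lt_card ⟨graphBall_mono (Nat.le_succ r), heq⟩
        omega

/-- A connected graph has a sparse net. -/
theorem NoSplit.exists_net (hH : NoSplit H) (ρ : ℕ) :
    ∃ Z : Finset V, (Z.card : ℝ) ≤ Fintype.card V / (ρ + 1) + 1 ∧
      ∀ u, ∃ z ∈ Z, z ∈ graphBall H u (2 * ρ) := by
  -- A maximal packing of balls of radius `ρ` is a net for radius `2 * ρ`. In a packing with at
  -- least two balls none of them is everything, so each has at least `ρ + 1` vertices.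
  let good : Finset V → Prop := fun Z =>
    ∀ a ∈ Z, ∀ b ∈ Z, a ≠ b → Disjoint (graphBall H a ρ) (graphBall H b ρ)
  obtain ⟨Z, hZ, hmax⟩ := Finset.exists_max_image (Finset.univ.filter good) Finset.card
    ⟨∅, by simp [good]⟩
  have hgood : good Z := (Finset.mem_filter.1 hZ).2
  refine ⟨Z, ?_, fun u => ?_⟩
  · by_cases h1 : Z.card ≤ 1
    · have : (Z.card : ℝ) ≤ 1 := by exact_mod_cast h1
      have : 0 ≤ (Fintype.card V : ℝ) / (ρ + 1) := by positivity
      linarith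
    · have hbig : ∀ a ∈ Z, ρ + 1 ≤ (graphBall H a ρ).card := by
        intro a ha
        rcases hH.graphBall_growth a ρ with h | h
        · obtain ⟨b, hb, hab⟩ := Finset.exists_mem_ne (by omega : 1 < Z.card) a
          exact absurd (h b) (Finset.disjoint_right.1 (hgood a ha b hb hab.symm) self_mem_graphBall)
        · exact h
      have h2 : Z.card * (ρ + 1) ≤ Fintype.card V := by
        calc Z.card * (ρ + 1) = ∑ _a ∈ Z, (ρ + 1) := by simp
          _ ≤ ∑ a ∈ Z, (graphBall H a ρ).card := Finset.sum_le_sum hbig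
          _ = (Z.biUnion fun a => graphBall H a ρ).card := by
            rw [Finset.card_biUnion fun a ha b hb hab => hgood a ha b hb hab]
          _ ≤ Fintype.card V := Finset.card_le_univ _
      have h3 : (Z.card : ℝ) * (ρ + 1) ≤ Fintype.card V := by exact_mod_cast h2
      rw [← le_div_iff₀ (by positivity)] at h3
      linarith
  · by_contra hcon
    push Not at hcon
    have huZ : u ∉ Z := fun h => hcon u h self_mem_graphBall
    have hdis : ∀ z ∈ Z, Disjoint (graphBall H u ρ) (graphBall H z ρ) := by
      intro z hz
      rw [Finset.disjoint_left]
      intro y hy hy'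
      refine hcon z hz ?_
      rw [two_mul]
      exact graphBall_trans hy (graphBall_symm hy')
    have hins : good (insert u Z) := by
      intro a ha b hb hab
      rcases Finset.mem_insert.1 ha with ha' | ha' <;>
        rcases Finset.mem_insert.1 hb with hb' | hb'
      · exact absurd (ha'.trans hb'.symm) hab
      · rw [ha']
        exact hdis b hb'
      · rw [hb']
        exact (hdis a ha').symm
      · exact hgood a ha' b hb' hab
    have := hmax (insert u Z) (Finset.mem_filter.2 ⟨Finset.mem_univ _, hins⟩)
    rw [Finset.card_insert_of_notMem huZ] at this
    omega

/-- The connected component of a vertex. -/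
def InComponent (H : SimpleGraph V) (v w : V) : Prop := ∃ r, w ∈ graphBall H v r

theorem InComponent.adj {v u w : V} (h : InComponent H v u) (huw : H.Adj u w) :
    InComponent H v w := by
  obtain ⟨r, hr⟩ := h
  exact ⟨r + 1, mem_graphBall_succ.2 (Or.inr ⟨u, hr, huw⟩)⟩

theorem noSplit_component (v : V) :
    NoSplit (H.comap (Subtype.val : {w // InComponent H v w} → V)) := by
  intro Q hQ a ha b
  let Q' : V → Prop := fun w => ∃ h : InComponent H v w, Q ⟨w, h⟩
  have hcl : ∀ u w, H.Adj u w → Q' u → Q' w := fun u w huw ⟨h, hq⟩ =>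
    ⟨h.adj huw, hQ ⟨u, h⟩ ⟨w, h.adj huw⟩ huw hq⟩
  have hball : ∀ r w, w ∈ graphBall H a.1 r → Q' w := by
    intro r
    induction r with
    | zero =>
      intro w hw
      obtain rfl : w = a.1 := by simpa [graphBall] using hw
      exact ⟨a.2, ha⟩
    | succ r ih =>
      intro w hw
      rcases mem_graphBall_succ.1 hw with h | ⟨y, hy, hyw⟩
      · exact ih w h
      · exact hcl y w hyw (ih y hy)
  obtain ⟨r, hr⟩ := a.2
  obtain ⟨r', hr'⟩ := b.2
  obtain ⟨_, hq⟩ := hball _ _ (graphBall_trans (graphBall_symm hr) hr')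
  exact hq

variable {κ : Type*} {c : V → κ} {lam : ℝ}

theorem shiftMatrix_component_split [DecidableEq V] (v : V) :
    (∀ u w, InComponent H v u → ¬ InComponent H v w → shiftMatrix lam H c u w = 0) ∧
    ∀ u w, ¬ InComponent H v u → InComponent H v w → shiftMatrix lam H c u w = 0 :=
  ⟨fun _ _ hu hw => shiftMatrix_eq_zero _ (fun h => hw (h ▸ hu)) fun h => hw (hu.adj h),
    fun _ _ hu hw => shiftMatrix_eq_zero _ (fun h => hu (h ▸ hw)) fun h => hu (hw.adj h.symm)⟩

theorem card_filter_comap_le {Δ : ℕ} (P : V → Prop) [Fintype {v // P v}]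
    (hdeg : ∀ x, (Finset.univ.filter fun y => H.Adj x y).card ≤ Δ) (x : {v // P v}) :
    (Finset.univ.filter fun y => (H.comap Subtype.val).Adj x y).card ≤ Δ := by
  refine le_trans (Finset.card_le_card_of_injOn Subtype.val ?_ ?_) (hdeg x.1)
  · intro y hy
    simpa using hy
  · exact fun a _ b _ h => Subtype.ext h

theorem NegRankLE.mono [DecidableEq V] {M : Matrix V V ℝ} {s t : ℕ} (h : NegRankLE M s)
    (hst : s ≤ t) : NegRankLE M t := by
  intro x hx
  obtain ⟨i, hi⟩ := h (fun i => x (Fin.castLE (by omega) i)) fun i j hij =>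
    hx _ _ fun h => hij (Fin.castLE_injective _ h)
  exact ⟨_, hi⟩

theorem PosSemidef.negRankLE {M : Matrix V V ℝ} (h : M.PosSemidef) (s : ℕ) : NegRankLE M s :=
  fun x _ => ⟨0, by simpa using h.dotProduct_mulVec_nonneg (x 0)⟩

/-- Bounds for the nullity of connected graphs add up over components. -/
theorem nullity_le_of_components {K : Type} {lam κ C : ℝ} (hC : 0 ≤ C) (s Δ : ℕ)
    (hpsd : ∀ (V : Type) [Fintype V] [DecidableEq V] (H : SimpleGraph V) (c : V → K), NoSplit H →
      (shiftMatrix lam H c).PosSemidef → (nullity (shiftMatrix lam H c) : ℝ) ≤ κ * Fintype.card V)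
    (hneg : 0 < s → ∀ (V : Type) [Fintype V] [DecidableEq V] (H : SimpleGraph V) (c : V → K),
      NoSplit H → (∀ x, (Finset.univ.filter fun y => H.Adj x y).card ≤ Δ) →
      NegRankLE (shiftMatrix lam H c) s →
      (nullity (shiftMatrix lam H c) : ℝ) ≤ κ * Fintype.card V + C) :
    ∀ (n : ℕ) (V : Type) [Fintype V] [DecidableEq V] (H : SimpleGraph V) (c : V → K),
      Fintype.card V = n → (∀ x, (Finset.univ.filter fun y => H.Adj x y).card ≤ Δ) →
      ∀ t ≤ s, NegRankLE (shiftMatrix lam H c) t →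
      (nullity (shiftMatrix lam H c) : ℝ) ≤ κ * Fintype.card V + t * C := by
  intro n
  induction n using Nat.strong_induction_on with
  | _ n ih =>
    intro V _ _ H c hn hdeg t hts ht
    rcases isEmpty_or_nonempty V with hV | ⟨⟨v⟩⟩
    · have h1 := nullity_le_card (shiftMatrix lam H c)
      rw [Fintype.card_eq_zero] at h1 ⊢
      rw [Nat.le_zero.1 h1]
      simpa using mul_nonneg (Nat.cast_nonneg t) hC
    · obtain ⟨hs1, hs2⟩ := shiftMatrix_component_split (H := H) (c := c) (lam := lam) v
      have hsum := nullity_le_add_of_split _ _ hs1 hs2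
      have hsum' : (nullity (shiftMatrix lam H c) : ℝ) ≤
          nullity (restr (shiftMatrix lam H c) (InComponent H v)) +
          nullity (restr (shiftMatrix lam H c) fun w => ¬ InComponent H v w) := by
        exact_mod_cast hsum
      have hcard : (Fintype.card V : ℝ) = Fintype.card {w // InComponent H v w} +
          Fintype.card {w // ¬ InComponent H v w} := by
        have h1 := Fintype.card_subtype_compl (InComponent H v)
        have h2 := Fintype.card_subtype_le (InComponent H v)
        have h3 : Fintype.card V = Fintype.card {w // InComponent H v w} +
          Fintype.card {w // ¬ InComponent H v w} := by omega
        exact_mod_cast h3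
      have hlt : Fintype.card {w // ¬ InComponent H v w} < n := by
        rw [← hn]
        exact Fintype.card_subtype_lt (x := v) (not_not.2 ⟨0, self_mem_graphBall⟩)
      have hrest : ∀ t' ≤ s, NegRankLE (restr (shiftMatrix lam H c) fun w => ¬ InComponent H v w) t' →
          (nullity (restr (shiftMatrix lam H c) fun w => ¬ InComponent H v w) : ℝ) ≤
            κ * Fintype.card {w // ¬ InComponent H v w} + t' * C := by
        intro t' ht' h
        rw [restr_shiftMatrix] at h ⊢
        exact ih _ hlt _ _ _ rfl (card_filter_comap_le _ hdeg) t' ht' h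
      -- A positive semidefinite component causes no error. Any other one uses up a negative
      -- direction, so `C` is paid at most `t` times.
      by_cases hP : (restr (shiftMatrix lam H c) (InComponent H v)).PosSemidef
      · have h1 := hrest t hts (ht.restr _)
        rw [restr_shiftMatrix] at hP
        have h2 := hpsd _ _ _ (noSplit_component v) hP
        rw [← restr_shiftMatrix] at h2
        rw [hcard]
        linarith
      · rw [posSemidef_iff (isHermitian_restr (isHermitian_shiftMatrix lam) _)] at hP
        push Not at hP
        obtain ⟨x, hx⟩ := hP
        obtain ⟨ht0, ht'⟩ := ht.of_split _ hs1 hs2 x hx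
        have h1 := hrest (t - 1) (by omega) ht'
        have h3 := (ht.mono hts).restr (InComponent H v)
        rw [restr_shiftMatrix] at h3
        have h2 := hneg (by omega) _ _ _ (noSplit_component v) (card_filter_comap_le _ hdeg) h3
        rw [← restr_shiftMatrix] at h2
        rw [hcard]
        rw [Nat.cast_sub (by omega)] at h1
        push_cast at h1
        linarith

/-- The positive semidefinite case. -/
theorem nullity_le_of_components_posSemidef {K : Type} {lam κ : ℝ}
    (hpsd : ∀ (V : Type) [Fintype V] [DecidableEq V] (H : SimpleGraph V) (c : V → K), NoSplit H →
      (shiftMatrix lam H c).PosSemidef → (nullity (shiftMatrix lam H c) : ℝ) ≤ κ * Fintype.card V)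
    (V : Type) [Fintype V] [DecidableEq V] (H : SimpleGraph V) (c : V → K)
    (h : (shiftMatrix lam H c).PosSemidef) :
    (nullity (shiftMatrix lam H c) : ℝ) ≤ κ * Fintype.card V := by
  have := nullity_le_of_components (lam := lam) (κ := κ) le_rfl 0 (Fintype.card V) hpsd
    (fun h => absurd h (lt_irrefl 0)) _ V H c rfl (fun x => Finset.card_le_univ _) 0 le_rfl
    (PosSemidef.negRankLE h 0)
  simpa using this

end Connectivity

/-! ### Powers of nonnegative symmetric matrices -/

section NonnegMatrices

open scoped Classical

variable {V : Type*} [Fintype V] [DecidableEq V]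

theorem pow_entry_nonneg {X : Matrix V V ℝ} (hX : ∀ a b, 0 ≤ X a b) :
    ∀ (j : ℕ) (a b : V), 0 ≤ (X ^ j) a b
  | 0, a, b => by
    rw [pow_zero, one_apply]
    split_ifs <;> norm_num
  | j + 1, a, b => by
    rw [pow_succ, mul_apply]
    exact Finset.sum_nonneg fun y _ => mul_nonneg (pow_entry_nonneg hX j a y) (hX y b)

theorem pow_entry_mono {X Y : Matrix V V ℝ} (hX : ∀ a b, 0 ≤ X a b) (hXY : ∀ a b, X a b ≤ Y a b) :
    ∀ (j : ℕ) (a b : V), (X ^ j) a b ≤ (Y ^ j) a b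
  | 0, a, b => by simp
  | j + 1, a, b => by
    rw [pow_succ, pow_succ, mul_apply, mul_apply]
    exact Finset.sum_le_sum fun y _ => mul_le_mul (pow_entry_mono hX hXY j a y) (hXY y b) (hX y b)
      (pow_entry_nonneg (fun a b => (hX a b).trans (hXY a b)) j a y)

theorem abs_form_le {X : Matrix V V ℝ} (hX : ∀ a b, 0 ≤ X a b) (x : V → ℝ) :
    |x ⬝ᵥ X *ᵥ x| ≤ (fun v => |x v|) ⬝ᵥ X *ᵥ (fun v => |x v|) := by
  simp only [dotProduct, mulVec, Finset.mul_sum]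
  refine (Finset.abs_sum_le_sum_abs _ _).trans (Finset.sum_le_sum fun a _ => ?_)
  refine (Finset.abs_sum_le_sum_abs _ _).trans (Finset.sum_le_sum fun b _ => ?_)
  rw [abs_mul, abs_mul, abs_of_nonneg (hX a b)]

/-- A symmetric nonnegative matrix whose form is bounded by `κ` on nonnegative vectors has powers
bounded by powers of `κ`. -/
theorem pow_form_le {X : Matrix V V ℝ} (hsymm : X.IsHermitian) (hX : ∀ a b, 0 ≤ X a b) {κ : ℝ}
    (h : ∀ x : V → ℝ, (∀ v, 0 ≤ x v) → x ⬝ᵥ X *ᵥ x ≤ κ * (x ⬝ᵥ x)) (j : ℕ) (x : V → ℝ) :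
    x ⬝ᵥ (X ^ j) *ᵥ x ≤ κ ^ j * (x ⬝ᵥ x) := by
  -- Passing to `|x|` bounds the negative eigenvalues as well, as powers of the matrix require.
  have habs : ∀ x : V → ℝ, |x ⬝ᵥ X *ᵥ x| ≤ κ * (x ⬝ᵥ x) := by
    intro x
    refine (abs_form_le hX x).trans ((h _ fun v => abs_nonneg _).trans_eq ?_)
    simp [dotProduct]
  obtain ⟨U, hU1, hU2, hA⟩ := exists_spectral hsymm
  set D := diagonal hsymm.eigenvalues with hD
  have hpow : ∀ j, X ^ j = U * D ^ j * Uᵀ := by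
    intro j
    induction j with
    | zero => simp [hU1]
    | succ j ih =>
      rw [pow_succ, ih, pow_succ]
      calc U * D ^ j * Uᵀ * X = U * D ^ j * Uᵀ * (U * D * Uᵀ) := by rw [← hA]
        _ = U * D ^ j * (Uᵀ * U) * D * Uᵀ := by simp only [Matrix.mul_assoc]
        _ = U * (D ^ j * D) * Uᵀ := by rw [hU2]; simp only [Matrix.mul_one, Matrix.mul_assoc]
  have hform : ∀ j (x : V → ℝ), x ⬝ᵥ (X ^ j) *ᵥ x =
      ∑ i, hsymm.eigenvalues i ^ j * ((Uᵀ *ᵥ x) i) ^ 2 := by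
    intro j x
    rw [hpow, ← mulVec_mulVec, ← mulVec_mulVec, dotProduct_mulVec, ← mulVec_transpose, hD,
      diagonal_pow, dotProduct]
    refine Finset.sum_congr rfl fun i _ => ?_
    rw [mulVec_diagonal]
    simp only [Pi.pow_apply]
    ring
  have heig : ∀ i, |hsymm.eigenvalues i| ≤ κ := by
    intro i
    have h1 := habs (U *ᵥ Pi.single i 1)
    have h2 := hform 1 (U *ᵥ Pi.single i 1)
    have h3 := hform 0 (U *ᵥ Pi.single i 1)
    have h4 : Uᵀ *ᵥ U *ᵥ Pi.single i 1 = (Pi.single i 1 : V → ℝ) := by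
      rw [mulVec_mulVec, hU2, one_mulVec]
    rw [h4, Finset.sum_eq_single i (by
      intro b _ hb
      simp [hb]) (by simp)] at h2 h3
    simp only [pow_one, pow_zero, Pi.single_eq_same, one_pow, mul_one, one_mulVec] at h2 h3
    rw [h2, h3, mul_one] at h1
    exact h1
  have hx : x ⬝ᵥ x = ∑ i, ((Uᵀ *ᵥ x) i) ^ 2 := by
    have := hform 0 x
    simpa using this
  rw [hform, hx, Finset.mul_sum]
  refine Finset.sum_le_sum fun i _ => mul_le_mul_of_nonneg_right ?_ (sq_nonneg _)
  calc hsymm.eigenvalues i ^ j ≤ |hsymm.eigenvalues i ^ j| := le_abs_self _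
    _ = |hsymm.eigenvalues i| ^ j := abs_pow _ _
    _ ≤ κ ^ j := pow_le_pow_left₀ (abs_nonneg _) (heig i) j

/-- The part of a matrix supported on a set of vertices, the other entries being zero. -/
def mask (N : Matrix V V ℝ) (W : Finset V) : Matrix V V ℝ :=
  of fun a b => if a ∈ W ∧ b ∈ W then N a b else 0

variable {N : Matrix V V ℝ} {W : Finset V}

theorem mask_apply (a b : V) : mask N W a b = if a ∈ W ∧ b ∈ W then N a b else 0 := rfl

theorem mask_of_mem {a b : V} (ha : a ∈ W) (hb : b ∈ W) : mask N W a b = N a b := by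
  simp [mask_apply, ha, hb]

theorem mask_of_notMem_left {a : V} (ha : a ∉ W) (b : V) : mask N W a b = 0 := by
  simp [mask_apply, ha]

theorem mask_of_notMem_right {b : V} (a : V) (hb : b ∉ W) : mask N W a b = 0 := by
  simp [mask_apply, hb]

theorem isHermitian_mask (hN : N.IsHermitian) : (mask N W).IsHermitian := by
  ext a b
  have := hN.apply a b
  simp only [star_trivial] at this
  simp [mask_apply, and_comm, this]

theorem mask_nonneg (hN : ∀ a b, 0 ≤ N a b) (a b : V) : 0 ≤ mask N W a b := by
  rw [mask_apply]
  split_ifs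
  · exact hN a b
  · rfl

theorem mask_mono (hN : ∀ a b, 0 ≤ N a b) {W' : Finset V} (h : W' ⊆ W) (a b : V) :
    mask N W' a b ≤ mask N W a b := by
  rw [mask_apply]
  split_ifs with h'
  · rw [mask_of_mem (h h'.1) (h h'.2)]
  · exact mask_nonneg hN a b

theorem mask_pow_eq_zero {a b : V} (hab : a ≠ b) (hb : b ∉ W) (j : ℕ) : (mask N W ^ j) a b = 0 := by
  cases j with
  | zero => simp [hab]
  | succ j =>
    rw [pow_succ, mul_apply]
    exact Finset.sum_eq_zero fun y _ => by rw [mask_of_notMem_right _ hb, mul_zero]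

theorem mask_pow_right {b : V} (a : V) (hb : b ∉ W) {j : ℕ} (hj : 0 < j) :
    (mask N W ^ j) a b = 0 := by
  obtain ⟨j, rfl⟩ := Nat.exists_eq_succ_of_ne_zero hj.ne'
  rw [Nat.succ_eq_add_one, pow_succ, mul_apply]
  exact Finset.sum_eq_zero fun y _ => by rw [mask_of_notMem_right _ hb, mul_zero]

theorem mask_pow_left {a : V} (ha : a ∉ W) (b : V) {j : ℕ} (hj : 0 < j) :
    (mask N W ^ j) a b = 0 := by
  obtain ⟨j, rfl⟩ := Nat.exists_eq_succ_of_ne_zero hj.ne'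
  rw [Nat.succ_eq_add_one, pow_succ', mul_apply]
  exact Finset.sum_eq_zero fun y _ => by rw [mask_of_notMem_left ha, zero_mul]

theorem mask_form (x : V → ℝ) :
    x ⬝ᵥ mask N W *ᵥ x =
      (fun v => if v ∈ W then x v else 0) ⬝ᵥ N *ᵥ (fun v => if v ∈ W then x v else 0) := by
  simp only [dotProduct, mulVec, Finset.mul_sum, mask_apply]
  refine Finset.sum_congr rfl fun a _ => Finset.sum_congr rfl fun b _ => ?_
  by_cases ha : a ∈ W <;> by_cases hb : b ∈ W <;> simp [ha, hb]

theorem sum_sq_ite_le (x : V → ℝ) :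
    (fun v => if v ∈ W then x v else 0) ⬝ᵥ (fun v => if v ∈ W then x v else 0) ≤ x ⬝ᵥ x := by
  refine Finset.sum_le_sum fun v _ => ?_
  by_cases h : v ∈ W
  · simp [h]
  · simpa [h] using mul_self_nonneg (x v)

end NonnegMatrices

/-! ### Sublinear multiplicity for connected unsigned graphs -/

section Sublinear

open scoped Classical

variable {V K : Type*} [Fintype V] [DecidableEq V] {H : SimpleGraph V} {c : V → K} {lam : ℝ}

/-- The matrix of lazy walks. -/
noncomputable def lazyMatrix (H : SimpleGraph V) (c : V → K) : Matrix V V ℝ := 1 + colMatrix H c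

theorem isHermitian_lazyMatrix : (lazyMatrix H c).IsHermitian :=
  (isHermitian_one).add isHermitian_colMatrix

theorem lazyMatrix_eq_one_of_adj (hc : ∀ u v, c u = c v) {a b : V} (h : H.Adj a b) :
    lazyMatrix H c a b = 1 := by
  simp [lazyMatrix, h.ne, colMatrix_apply, h, hc a b]

theorem lazyMatrix_self (a : V) : lazyMatrix H c a a = 1 := by
  simp [lazyMatrix, colMatrix_self]

theorem lazyMatrix_eq_zero {a b : V} (h : a ≠ b) (h' : ¬ H.Adj a b) : lazyMatrix H c a b = 0 := by
  simp [lazyMatrix, h, colMatrix_of_not_adj h']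

theorem lazyMatrix_nonneg (hc : ∀ u v, c u = c v) (a b : V) : 0 ≤ lazyMatrix H c a b := by
  by_cases h : a = b
  · rw [h, lazyMatrix_self]
    exact zero_le_one
  · by_cases h' : H.Adj a b
    · rw [lazyMatrix_eq_one_of_adj hc h']
      exact zero_le_one
    · rw [lazyMatrix_eq_zero h h']

theorem shiftMatrix_eq_sub_lazyMatrix :
    shiftMatrix lam H c = (lam + 1) • (1 : Matrix V V ℝ) - lazyMatrix H c := by
  rw [shiftMatrix, lazyMatrix, add_smul, one_smul]
  abel

theorem lazyMatrix_form (x : V → ℝ) :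
    x ⬝ᵥ lazyMatrix H c *ᵥ x = (lam + 1) * (x ⬝ᵥ x) - x ⬝ᵥ shiftMatrix lam H c *ᵥ x := by
  rw [shiftMatrix_eq_sub_lazyMatrix, sub_mulVec, dotProduct_sub, smul_mulVec, one_mulVec,
    dotProduct_smul, smul_eq_mul]
  ring

/-- Short walks inside a ball are counted by the masked matrix. -/
theorem one_le_mask_pow (hc : ∀ u v, c u = c v) {W : Finset V} {a : V} {r : ℕ}
    (hW : graphBall H a r ⊆ W) : ∀ j ≤ r, ∀ w ∈ graphBall H a j,
      1 ≤ (mask (lazyMatrix H c) W ^ j) a w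
  | 0, _, w, hw => by
    obtain rfl : w = a := by simpa [graphBall] using hw
    simp
  | j + 1, hj, w, hw => by
    have hnn := mask_nonneg (W := W) (lazyMatrix_nonneg (H := H) hc)
    have key : ∀ y ∈ graphBall H a j, lazyMatrix H c y w = 1 →
        1 ≤ (mask (lazyMatrix H c) W ^ (j + 1)) a w := by
      intro y hy hyw
      have h1 := one_le_mask_pow hc hW j (by omega) y hy
      rw [pow_succ, mul_apply]
      refine le_trans ?_ (Finset.single_le_sum (f := fun y => (mask (lazyMatrix H c) W ^ j) a y *
        mask (lazyMatrix H c) W y w) (fun b _ => mul_nonneg (pow_entry_nonneg hnn j a b) (hnn b w))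
        (Finset.mem_univ y))
      rw [mask_of_mem (hW (graphBall_mono (by omega) hy)) (hW (graphBall_mono hj hw)), hyw, mul_one]
      exact h1
    rcases mem_graphBall_succ.1 hw with h | ⟨y, hy, hyw⟩
    · exact key w h (lazyMatrix_self w)
    · exact key y hy (lazyMatrix_eq_one_of_adj hc hyw)

/-- Walks of length `j` from `v` only see the ball of radius `j`. -/
theorem mask_pow_local {Z : Finset V} {v : V} (hv : v ∉ Z) {R : ℕ} : ∀ j ≤ R, ∀ w,
    (mask (lazyMatrix H c) Zᶜ ^ j) v w = (mask (lazyMatrix H c) (graphBall H v R \ Z) ^ j) v w ∧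
      (w ∉ graphBall H v j → (mask (lazyMatrix H c) Zᶜ ^ j) v w = 0)
  | 0, _, w => by
    refine ⟨by simp, fun hw => ?_⟩
    have : v ≠ w := fun h => hw (h ▸ self_mem_graphBall)
    simp [this]
  | j + 1, hj, w => by
    have ih := mask_pow_local (R := R) hv j (by omega)
    rw [pow_succ, pow_succ, mul_apply, mul_apply]
    refine ⟨Finset.sum_congr rfl fun y _ => ?_, fun hw => Finset.sum_eq_zero fun y _ => ?_⟩
    · by_cases hy : y ∈ graphBall H v j
      · rw [(ih y).1]
        congr 1
        by_cases hyw : y = w ∨ H.Adj y w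
        · have hyR : y ∈ graphBall H v R := graphBall_mono (by omega) hy
          have hwR : w ∈ graphBall H v R := by
            refine graphBall_mono hj (mem_graphBall_succ.2 ?_)
            rcases hyw with h | h
            · exact Or.inl (h ▸ hy)
            · exact Or.inr ⟨y, hy, h⟩
          simp [mask_apply, hyR, hwR]
        · push Not at hyw
          simp [mask_apply, lazyMatrix_eq_zero hyw.1 hyw.2]
      · rw [← (ih y).1, (ih y).2 hy, zero_mul, zero_mul]
    · by_cases hy : y ∈ graphBall H v j
      · rw [mask_apply, lazyMatrix_eq_zero, ite_self, mul_zero]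
        · exact fun h => hw (mem_graphBall_succ.2 (Or.inl (h ▸ hy)))
        · exact fun h => hw (mem_graphBall_succ.2 (Or.inr ⟨y, hy, h⟩))
      · rw [(ih y).2 hy, zero_mul]

/-- Deleting a net decreases the number of closed walks. -/
theorem mask_pow_diag_le (hc : ∀ u v, c u = c v) (hlam : 0 ≤ lam) {Z : Finset V} {v : V}
    (hv : v ∉ Z) {r T : ℕ} (hr : 0 < r)
    (hnet : ∀ a, ∃ z ∈ Z, z ∈ graphBall H a r)
    (hpos : ∀ x : V → ℝ, (∀ w, w ∉ graphBall H v (2 * r * T + r) → x w = 0) →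
      0 ≤ x ⬝ᵥ shiftMatrix lam H c *ᵥ x) :
    (mask (lazyMatrix H c) Zᶜ ^ (2 * r * T)) v v ≤ ((lam + 1) ^ (2 * r) - 1) ^ T := by
  set N := lazyMatrix H c with hN
  set R := 2 * r * T with hR
  set W := graphBall H v (R + r) with hW
  set W' := graphBall H v R \ Z with hW'
  have hNn : ∀ a b, 0 ≤ N a b := lazyMatrix_nonneg hc
  have hsub : W' ⊆ W := fun y hy => graphBall_mono (by omega) (Finset.mem_sdiff.1 hy).1
  have hmono := mask_mono hNn hsub
  have hBn := mask_nonneg (W := W') hNn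
  have hCn := mask_nonneg (W := W) hNn
  -- Where `lam - A` has nonnegative form, the lazy walk matrix has form at most `lam + 1`.
  have hCbound : ∀ x : V → ℝ, (∀ v, 0 ≤ x v) →
      x ⬝ᵥ mask N W *ᵥ x ≤ (lam + 1) * (x ⬝ᵥ x) := by
    intro x _
    rw [mask_form, hN, lazyMatrix_form (lam := lam)]
    have h1 := hpos (fun v => if v ∈ W then x v else 0) fun w hw => if_neg hw
    have h2 := mul_le_mul_of_nonneg_left (sum_sq_ite_le (W := W) x) (by linarith : 0 ≤ lam + 1)
    linarith
  have hCpow := pow_form_le (isHermitian_mask isHermitian_lazyMatrix) hCn hCbound (2 * r)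
  -- From `a` one can walk to a net vertex in `r` steps and back in `r` more. This closed walk
  -- exists in `W` but not in `W'`, where the net is deleted, so each diagonal entry loses at least
  -- one.
  have hentry : ∀ a b, a ∈ W' → b ∈ W' →
      (mask N W' ^ (2 * r)) a b + (1 : Matrix V V ℝ) a b ≤ (mask N W ^ (2 * r)) a b := by
    intro a b ha hb
    by_cases hab : a = b
    · subst hab
      obtain ⟨z, hzZ, hz⟩ := hnet a
      have haz : a ≠ z := fun h => (Finset.mem_sdiff.1 ha).2 (h ▸ hzZ)
      have hzW' : z ∉ W' := fun h => (Finset.mem_sdiff.1 h).2 hzZ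
      have hball : graphBall H a r ⊆ W := fun y hy =>
        graphBall_trans (Finset.mem_sdiff.1 ha).1 hy
      have h1 := one_le_mask_pow hc hball r le_rfl z hz
      have hdiag : ∀ W₀ : Finset V, (mask N W₀ ^ (2 * r)) a a =
          ∑ y, (mask N W₀ ^ r) a y ^ 2 := by
        intro W₀
        rw [two_mul, pow_add, mul_apply]
        refine Finset.sum_congr rfl fun y _ => ?_
        have := ((isHermitian_mask (W := W₀) (isHermitian_lazyMatrix (H := H) (c := c))).pow r).apply a y
        rw [star_trivial] at this
        rw [this, sq]
      rw [hdiag, hdiag, one_apply_eq, ← Finset.sum_erase_add _ _ (Finset.mem_univ z),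
        ← Finset.sum_erase_add _ (fun y => (mask N W ^ r) a y ^ 2) (Finset.mem_univ z),
        mask_pow_eq_zero haz hzW']
      have h2 : ∑ y ∈ Finset.univ.erase z, (mask N W' ^ r) a y ^ 2 ≤
          ∑ y ∈ Finset.univ.erase z, (mask N W ^ r) a y ^ 2 :=
        Finset.sum_le_sum fun y _ => pow_le_pow_left₀ (pow_entry_nonneg hBn r a y)
          (pow_entry_mono hBn hmono r a y) 2
      have h3 : 1 ≤ (mask N W ^ r) a z ^ 2 := one_le_pow₀ h1
      linarith
    · rw [one_apply_ne hab, add_zero]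
      exact pow_entry_mono hBn hmono _ a b
  have hθ : 1 ≤ (lam + 1) ^ (2 * r) := one_le_pow₀ (by linarith)
  -- Entrywise domination on nonnegative vectors yields the norm `(lam + 1) ^ (2 * r) - 1`, strictly
  -- smaller than before the deletion.
  have hBbound : ∀ x : V → ℝ, (∀ v, 0 ≤ x v) →
      x ⬝ᵥ (mask N W' ^ (2 * r)) *ᵥ x ≤ ((lam + 1) ^ (2 * r) - 1) * (x ⬝ᵥ x) := by
    intro x hx
    set y : V → ℝ := fun v => if v ∈ W' then x v else 0 with hy
    have h1 : x ⬝ᵥ (mask N W' ^ (2 * r)) *ᵥ x ≤ y ⬝ᵥ (mask N W ^ (2 * r)) *ᵥ y - y ⬝ᵥ y := by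
      have : y ⬝ᵥ (mask N W ^ (2 * r)) *ᵥ y - y ⬝ᵥ y =
          y ⬝ᵥ (mask N W ^ (2 * r) - 1) *ᵥ y := by
        rw [sub_mulVec, one_mulVec, dotProduct_sub]
      rw [this]
      simp only [dotProduct, mulVec, Finset.mul_sum]
      refine Finset.sum_le_sum fun a _ => Finset.sum_le_sum fun b _ => ?_
      by_cases ha : a ∈ W'
      · by_cases hb : b ∈ W'
        · simp only [hy, ha, hb, if_true]
          refine mul_le_mul_of_nonneg_left (mul_le_mul_of_nonneg_right ?_ (hx b)) (hx a)
          rw [Matrix.sub_apply]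
          linarith [hentry a b ha hb]
        · simp [hy, hb, mask_pow_right a hb (by omega : 0 < 2 * r)]
      · simp [hy, ha, mask_pow_left ha b (by omega : 0 < 2 * r)]
    have h2 := hCpow y
    have h3 := mul_le_mul_of_nonneg_left (sum_sq_ite_le (W := W') x)
      (by linarith : 0 ≤ (lam + 1) ^ (2 * r) - 1)
    rw [← hy] at h3
    linarith
  have hfin := pow_form_le ((isHermitian_mask isHermitian_lazyMatrix).pow _)
    (pow_entry_nonneg hBn (2 * r)) hBbound T (Pi.single v 1)
  rw [(mask_pow_local hv R le_rfl v).1, hR, pow_mul]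
  simpa using hfin

/-- Kernel vectors of a principal submatrix extend by zero if the other rows vanish on it. -/
theorem nullity_restr_le (M : Matrix V V ℝ) (P : V → Prop) [Fintype {v // P v}]
    (hM : ∀ u v, ¬ P u → P v → M u v = 0) : nullity (restr M P) ≤ nullity M := by
  let e : ({v // P v} → ℝ) →ₗ[ℝ] (V → ℝ) :=
    { toFun := extendZero
      map_add' := fun x y => by
        funext v
        by_cases h : P v <;> simp [extendZero, h]
      map_smul' := fun r x => by
        funext v
        by_cases h : P v <;> simp [extendZero, h] }
  let g : LinearMap.ker (restr M P).mulVecLin →ₗ[ℝ] LinearMap.ker M.mulVecLin :=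
    LinearMap.codRestrict _ (e.comp (Submodule.subtype _)) (by
      intro x
      rw [LinearMap.mem_ker]
      ext u
      change (M *ᵥ extendZero x.1) u = 0
      by_cases hu : P u
      · have h := mulVec_restr_of_support M (extendZero x.1) (fun v hv => extendZero_of_not _ hv)
          ⟨u, hu⟩
        have h' : restr M P *ᵥ x.1 = 0 := x.2
        simp only [extendZero_val] at h
        rw [← h, h']
        rfl
      · simp only [mulVec, dotProduct]
        refine Finset.sum_eq_zero fun v _ => ?_
        by_cases hv : P v
        · rw [hM u v hu hv, zero_mul]
        · rw [extendZero_of_not _ hv, mul_zero])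
  refine LinearMap.finrank_le_finrank_of_injective (f := g) fun x y hxy => ?_
  apply Subtype.ext
  funext v
  have h : extendZero x.1 v.1 = extendZero y.1 v.1 := congrFun (congrArg Subtype.val hxy) v.1
  rwa [extendZero_val, extendZero_val] at h

/-- Eigenvectors of an induced subgraph, via the masked matrix. -/
theorem nullity_restr_le_mask (Z : Finset V) :
    nullity (restr (shiftMatrix lam H c) fun v => v ∉ Z) ≤
      nullity ((lam + 1) • (1 : Matrix V V ℝ) - mask (lazyMatrix H c) Zᶜ) := by
  have h : restr (shiftMatrix lam H c) (fun v => v ∉ Z) =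
      restr ((lam + 1) • (1 : Matrix V V ℝ) - mask (lazyMatrix H c) Zᶜ) fun v => v ∉ Z := by
    ext u v
    rw [shiftMatrix_eq_sub_lazyMatrix]
    simp only [restr, submatrix_apply, Matrix.sub_apply]
    rw [mask_of_mem (Finset.mem_compl.2 u.2) (Finset.mem_compl.2 v.2)]
  rw [h]
  refine nullity_restr_le _ _ fun u v hu hv => ?_
  have huv : u ≠ v := fun h => hu (h ▸ hv)
  rw [Matrix.sub_apply, mask_of_notMem_left (by simpa using hu)]
  simp [huv]

theorem nullity_mul_pow_le_trace {B : Matrix V V ℝ} (hB : B.IsHermitian) (θ : ℝ) {j : ℕ}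
    (hj : Even j) : (nullity (θ • (1 : Matrix V V ℝ) - B) : ℝ) * θ ^ j ≤ (B ^ j).trace := by
  rw [trace_pow_eq_sum hB, ← card_eigenvalues_eq_nullity hB, Nat.card_eq_fintype_card,
    Fintype.card_subtype]
  calc _ = ∑ i ∈ Finset.univ.filter fun i => hB.eigenvalues i = θ, hB.eigenvalues i ^ j := by
        rw [Finset.sum_congr rfl fun i hi => by rw [(Finset.mem_filter.1 hi).2]]
        simp
    _ ≤ ∑ i, hB.eigenvalues i ^ j :=
        Finset.sum_le_sum_of_subset_of_nonneg (Finset.filter_subset _ _)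
          fun i _ _ => hj.pow_nonneg _

/-- Connected graphs of bounded degree have sublinear multiplicity at eigenvalues of bounded rank. -/
theorem exists_sublinear_bound {K : Type} {lam κ : ℝ} (hlam : 0 ≤ lam) (hκ : 0 < κ) (s Δ : ℕ) :
    ∃ C : ℝ, 0 ≤ C ∧ ∀ (V : Type) [Fintype V] [DecidableEq V] (H : SimpleGraph V) (c : V → K),
      (∀ u v, c u = c v) → NoSplit H →
      (∀ x, (Finset.univ.filter fun y => H.Adj x y).card ≤ Δ) →
      NegRankLE (shiftMatrix lam H c) s →
      (nullity (shiftMatrix lam H c) : ℝ) ≤ κ * Fintype.card V + C := by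
  -- `ρ` makes the net smaller than `κ / 2 * n + 1`; below, `T` is so large that the relative loss
  -- of closed walks beats `κ / 2`.
  obtain ⟨ρ', hρ'⟩ := exists_nat_one_div_lt (half_pos hκ)
  set ρ := ρ' + 1 with hρ
  have hρκ : 1 / ((ρ : ℝ) + 1) ≤ κ / 2 := by
    refine le_trans ?_ hρ'.le
    rw [hρ]
    push_cast
    gcongr
    linarith
  set r := 2 * ρ with hr
  have hr0 : 0 < r := by omega
  set θ := (lam + 1) ^ (2 * r) with hθ
  have hθ1 : 1 ≤ θ := one_le_pow₀ (by linarith)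
  obtain ⟨T, hT⟩ := exists_pow_lt_of_lt_one (half_pos hκ)
    (show (θ - 1) / θ < 1 by rw [div_lt_one (by linarith)]; linarith)
  set R' := 2 * r * T + r with hR'
  set S := (Δ + 1) ^ R' with hS
  refine ⟨1 + s * (S * (Δ + 1)) * S, by positivity, ?_⟩
  intro V _ _ H c hc hH hdeg hs
  obtain ⟨Z₀, hZ₀, hnet⟩ := hH.exists_net ρ
  obtain ⟨T₀, hT₀, hpos⟩ := exists_maximal_negFamily S hdeg hs
  -- Outside `U`, balls of radius `R'` avoid `T₀`, so the form is nonnegative on vectors supported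
  -- there. The set `U` is bounded, while the net is only sparse.
  set U := T₀.biUnion fun t => graphBall H t R' with hU
  have hUcard : U.card ≤ s * (S * (Δ + 1)) * S := by
    refine (Finset.card_biUnion_le_card_mul _ _ S fun t _ => card_graphBall_le hdeg t R').trans ?_
    gcongr
  set Z := Z₀ ∪ U with hZ
  have hdiag : ∀ v, (mask (lazyMatrix H c) Zᶜ ^ (2 * r * T)) v v ≤ (θ - 1) ^ T := by
    intro v
    by_cases hv : v ∈ Z
    · by_cases hT0 : T = 0
      · simp [hT0]
      · rw [mask_pow_left (by simpa using hv) v (by positivity)]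
        exact pow_nonneg (by linarith) T
    refine mask_pow_diag_le hc hlam hv hr0 (fun a => ?_) fun x hx => ?_
    · obtain ⟨z, hz, hz'⟩ := hnet a
      exact ⟨z, Finset.mem_union_left _ hz, hz'⟩
    · refine hpos (graphBall H v R') x (card_graphBall_le hdeg v R') (fun w hw hwT => hv ?_) hx
      exact Finset.mem_union_right _ (Finset.mem_biUnion.2 ⟨w, hwT, graphBall_symm hw⟩)
  have htrace : (mask (lazyMatrix H c) Zᶜ ^ (2 * r * T)).trace ≤ Fintype.card V * (θ - 1) ^ T := by
    refine (Finset.sum_le_sum fun v _ => hdiag v).trans_eq ?_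
    simp
  have hnull := nullity_mul_pow_le_trace
    (isHermitian_mask (W := Zᶜ) (isHermitian_lazyMatrix (H := H) (c := c))) (lam + 1)
    (j := 2 * r * T) (by rw [mul_assoc]; exact even_two_mul _)
  rw [pow_mul, ← hθ] at hnull
  -- Each eigenvector for `lam` contributes `θ ^ T` to a trace that is at most `n * (θ - 1) ^ T`.
  have h1 : (nullity (restr (shiftMatrix lam H c) fun v => v ∉ Z) : ℝ) ≤ κ / 2 * Fintype.card V := by
    have h2 : (nullity (restr (shiftMatrix lam H c) fun v => v ∉ Z) : ℝ) ≤ _ :=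
      Nat.cast_le.2 (nullity_restr_le_mask (lam := lam) (H := H) (c := c) Z)
    refine h2.trans ?_
    have hθT : 0 < θ ^ T := by positivity
    have h3 := (le_div_iff₀ hθT).2 (hnull.trans htrace)
    refine h3.trans ?_
    rw [mul_div_assoc, ← div_pow, mul_comm]
    gcongr
  have h2 := nullity_le_restr_add (shiftMatrix lam H c) fun v => v ∉ Z
  have h3 : Fintype.card {v // ¬ v ∉ Z} = Z.card := by
    rw [Fintype.card_subtype]
    congr 1
    ext v
    simp
  rw [h3] at h2
  have h4 : (nullity (shiftMatrix lam H c) : ℝ) ≤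
      nullity (restr (shiftMatrix lam H c) fun v => v ∉ Z) + Z.card := by exact_mod_cast h2
  have h5 : (Z.card : ℝ) ≤ Z₀.card + U.card := by exact_mod_cast Finset.card_union_le _ _
  have h6 : (U.card : ℝ) ≤ s * (S * (Δ + 1)) * S := by exact_mod_cast hUcard
  have h7 : (Fintype.card V : ℝ) / (ρ + 1) ≤ κ / 2 * Fintype.card V := by
    rw [div_eq_mul_one_div, mul_comm]
    gcongr
  linarith

end Sublinear

/-! ### Removing the signs for at most two colors -/

section Switching

open scoped Classical

variable {V : Type*} [Fintype V] [DecidableEq V]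

theorem nullity_le_of_conj {M M' : Matrix V V ℝ} {σ : V → ℝ} (hσ : ∀ v, σ v * σ v = 1)
    (h : ∀ u v, M' u v = σ u * M u v * σ v) : nullity M' ≤ nullity M := by
  let e : (V → ℝ) →ₗ[ℝ] (V → ℝ) :=
    { toFun := fun x v => σ v * x v
      map_add' := fun x y => by funext v; simp [mul_add]
      map_smul' := fun r x => by funext v; simp; ring }
  let g : LinearMap.ker M'.mulVecLin →ₗ[ℝ] LinearMap.ker M.mulVecLin :=
    LinearMap.codRestrict _ (e.comp (Submodule.subtype _)) (by
      intro x
      rw [LinearMap.mem_ker]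
      ext u
      change (M *ᵥ fun v => σ v * x.1 v) u = 0
      have hx : M' *ᵥ x.1 = 0 := x.2
      have hu : σ u * (M' *ᵥ x.1) u = 0 := by simp [hx]
      rw [← hu]
      simp only [mulVec, dotProduct, h, Finset.mul_sum]
      refine Finset.sum_congr rfl fun v _ => ?_
      linear_combination -(M u v * (σ v * x.1 v)) * hσ u)
  refine LinearMap.finrank_le_finrank_of_injective (f := g) fun x y hxy => ?_
  apply Subtype.ext
  funext v
  have h1 : σ v * x.1 v = σ v * y.1 v := congrFun (congrArg Subtype.val hxy) v
  have h2 : σ v ≠ 0 := fun h0 => by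
    have := hσ v
    rw [h0] at this
    norm_num at this
  exact mul_left_cancel₀ h2 h1

theorem form_of_conj {M M' : Matrix V V ℝ} {σ : V → ℝ} (h : ∀ u v, M' u v = σ u * M u v * σ v)
    (x y : V → ℝ) :
    x ⬝ᵥ M' *ᵥ y = (fun v => σ v * x v) ⬝ᵥ M *ᵥ (fun v => σ v * y v) := by
  simp only [dotProduct, mulVec, Finset.mul_sum, h]
  exact Finset.sum_congr rfl fun u _ => Finset.sum_congr rfl fun v _ => by ring

theorem NegRankLE.of_conj {M M' : Matrix V V ℝ} {σ : V → ℝ} {s : ℕ}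
    (h : ∀ u v, M' u v = σ u * M u v * σ v) (hs : NegRankLE M s) : NegRankLE M' s := by
  intro x hx
  obtain ⟨i, hi⟩ := hs (fun i v => σ v * x i v) fun i j hij => by
    rw [← form_of_conj h]
    exact hx i j hij
  refine ⟨i, ?_⟩
  rw [form_of_conj h]
  exact hi

/-- Two-colored signed graphs are switching equivalent to unsigned graphs. -/
theorem exists_switching {p : ℕ} (hp : p ≤ 2) (lam : ℝ) (H : SimpleGraph V) (c : V → Fin p) :
    ∃ σ : V → ℝ, (∀ v, σ v * σ v = 1) ∧
      (∀ u v, shiftMatrix lam H c u v = σ u * shiftMatrix lam H (fun _ => ()) u v * σ v) ∧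
      ∀ u v, shiftMatrix lam H (fun _ => ()) u v = σ u * shiftMatrix lam H c u v * σ v := by
  have hσ : ∀ v, (if (c v).1 = 0 then (1 : ℝ) else -1) * (if (c v).1 = 0 then (1 : ℝ) else -1) = 1 := by
    intro v
    split_ifs <;> norm_num
  have key : ∀ u v, shiftMatrix lam H c u v = (if (c u).1 = 0 then (1 : ℝ) else -1) *
      shiftMatrix lam H (fun _ => ()) u v * (if (c v).1 = 0 then (1 : ℝ) else -1) := by
    intro u v
    by_cases huv : u = v
    · subst huv
      rw [shiftMatrix_self, shiftMatrix_self]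
      linear_combination -lam * hσ u
    · rw [shiftMatrix_of_ne _ huv, shiftMatrix_of_ne _ huv, colMatrix_apply, colMatrix_apply]
      by_cases h : H.Adj u v
      · have hu := (c u).2
        have hv := (c v).2
        -- With at most two colors, equality of colors is agreement on being color `0`; this is the
        -- only use of `p ≤ 2`.
        have hiff : c u = c v ↔ ((c u).1 = 0 ↔ (c v).1 = 0) := by
          rw [Fin.ext_iff]
          omega
        by_cases h1 : (c u).1 = 0 <;> by_cases h2 : (c v).1 = 0 <;> simp [h, hiff, h1, h2]
      · simp [h]
  refine ⟨fun v => if (c v).1 = 0 then 1 else -1, hσ, key, fun u v => ?_⟩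
  rw [key]
  linear_combination -(shiftMatrix lam H (fun _ => ()) u v) * hσ u -
    (shiftMatrix lam H (fun _ => ()) u v) * ((if (c u).1 = 0 then (1 : ℝ) else -1) *
      (if (c u).1 = 0 then (1 : ℝ) else -1)) * hσ v

theorem nullity_switching {p : ℕ} (hp : p ≤ 2) (lam : ℝ) (H : SimpleGraph V) (c : V → Fin p) :
    nullity (shiftMatrix lam H c) = nullity (shiftMatrix lam H fun _ => ()) := by
  obtain ⟨σ, hσ, h1, h2⟩ := exists_switching hp lam H c
  exact le_antisymm (nullity_le_of_conj hσ h1) (nullity_le_of_conj hσ h2)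

theorem negRankLE_switching {p : ℕ} (hp : p ≤ 2) {lam : ℝ} {H : SimpleGraph V} {c : V → Fin p}
    {s : ℕ} : NegRankLE (shiftMatrix lam H c) s ↔ NegRankLE (shiftMatrix lam H fun _ => ()) s := by
  obtain ⟨σ, -, h1, h2⟩ := exists_switching hp lam H c
  exact ⟨NegRankLE.of_conj h2, NegRankLE.of_conj h1⟩

theorem posSemidef_switching {p : ℕ} (hp : p ≤ 2) {lam : ℝ} {H : SimpleGraph V} {c : V → Fin p} :
    (shiftMatrix lam H c).PosSemidef ↔ (shiftMatrix lam H fun _ => ()).PosSemidef :=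
  ⟨fun h => NegRankLE.posSemidef (isHermitian_shiftMatrix lam)
      ((negRankLE_switching hp).1 (PosSemidef.negRankLE h 0)),
    fun h => NegRankLE.posSemidef (isHermitian_shiftMatrix lam)
      ((negRankLE_switching hp).2 (PosSemidef.negRankLE h 0))⟩

end Switching

/-! ### Unsigned graphs and the spectral radius order -/

section Unsigned

open scoped Classical

/-- The largest eigenvalue of a connected unsigned graph is simple. -/
theorem NoSplit.nullity_le_one {V : Type*} [Fintype V] [DecidableEq V] {H : SimpleGraph V}
    {lam : ℝ} (hH : NoSplit H) {c : V → Unit} (h : (shiftMatrix lam H c).PosSemidef) :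
    nullity (shiftMatrix lam H c) ≤ 1 := by
  have hnn : ∀ a b, 0 ≤ colMatrix H c a b := by
    intro a b
    rw [colMatrix_apply, if_pos (Subsingleton.elim (c a) (c b))]
    split_ifs <;> norm_num
  rcases isEmpty_or_nonempty V with hV | ⟨⟨v₀⟩⟩
  · have := nullity_le_card (shiftMatrix lam H c)
    rw [Fintype.card_eq_zero] at this
    omega
  · have key : ∀ x : V → ℝ, shiftMatrix lam H c *ᵥ x = 0 → x v₀ = 0 → x = 0 := by
      intro x hx hx0
      have h1 : (fun v => |x v|) ⬝ᵥ shiftMatrix lam H c *ᵥ (fun v => |x v|) = 0 := by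
        refine le_antisymm ?_ ((posSemidef_iff (isHermitian_shiftMatrix lam)).1 h _)
        have h2 : x ⬝ᵥ shiftMatrix lam H c *ᵥ x = 0 := by rw [hx, dotProduct_zero]
        have h3 := (le_abs_self _).trans (abs_form_le hnn x)
        have hf : ∀ y : V → ℝ, y ⬝ᵥ shiftMatrix lam H c *ᵥ y =
            lam * (y ⬝ᵥ y) - y ⬝ᵥ colMatrix H c *ᵥ y := by
          intro y
          rw [shiftMatrix, sub_mulVec, dotProduct_sub, smul_mulVec, one_mulVec, dotProduct_smul,
            smul_eq_mul]
        have h4 : (fun v => |x v|) ⬝ᵥ (fun v => |x v|) = x ⬝ᵥ x := by simp [dotProduct]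
        rw [hf] at h2 ⊢
        rw [h4]
        linarith
      have h2 := mulVec_eq_zero_of_posSemidef h h1
      funext w
      refine hH (fun v => x v = 0) (fun u v huv hu => ?_) v₀ hx0 w
      have h3 := congrFun h2 u
      rw [mulVec_shiftMatrix, hu, abs_zero, mul_zero, zero_sub, Pi.zero_apply, neg_eq_zero,
        Finset.sum_eq_zero_iff_of_nonneg fun v _ => mul_nonneg (hnn u v) (abs_nonneg _)] at h3
      have h4 := h3 v (Finset.mem_univ v)
      simpa [colMatrix_apply, huv] using h4
    let g : LinearMap.ker (shiftMatrix lam H c).mulVecLin →ₗ[ℝ] ℝ :=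
      (LinearMap.proj v₀).comp (Submodule.subtype _)
    have := LinearMap.finrank_le_finrank_of_injective (f := g) (by
      rw [← LinearMap.ker_eq_bot, LinearMap.ker_eq_bot']
      intro x hx
      exact Subtype.ext (key x.1 x.2 hx))
    rwa [Module.finrank_self] at this

theorem nullity_lt_card {V K : Type*} [Fintype V] [DecidableEq V] {H : SimpleGraph V}
    {lam : ℝ} {c : V → K} (hlam : 0 < lam) [Nonempty V] :
    nullity (shiftMatrix lam H c) < Fintype.card V := by
  have h1 := nullity_add_rank (shiftMatrix lam H c)
  by_contra hcon
  have h2 : (shiftMatrix lam H c).rank = 0 := by omega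
  obtain ⟨v⟩ := ‹Nonempty V›
  have h3 : shiftMatrix lam H c = 0 := by
    rw [Matrix.rank, Submodule.finrank_eq_zero, LinearMap.range_eq_bot] at h2
    ext a b
    have := congrFun (LinearMap.congr_fun h2 (Pi.single b 1)) a
    simpa using this
  have h4 := shiftMatrix_self (H := H) (c := c) lam v
  rw [h3] at h4
  simp at h4
  linarith

/-- Bounds for unsigned connected graphs bound the ratio for two-colored graphs. -/
theorem nullity_le_of_unsigned {p : ℕ} (hp : p ≤ 2) {lam : ℝ} {r : ℝ} (hr : 0 < r)
    (h : ∀ (V : Type) [Fintype V] [DecidableEq V] (H : SimpleGraph V) (c : V → Unit),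
      (shiftMatrix lam H c).PosSemidef → 0 < nullity (shiftMatrix lam H c) → r ≤ Fintype.card V)
    (V : Type) [Fintype V] [DecidableEq V] (H : SimpleGraph V) (c : V → Fin p)
    (hpsd : (shiftMatrix lam H c).PosSemidef) :
    r * nullity (shiftMatrix lam H c) ≤ Fintype.card V := by
  have h1 : (nullity (shiftMatrix lam H fun _ => ()) : ℝ) ≤ r⁻¹ * Fintype.card V := by
    refine nullity_le_of_components_posSemidef ?_ V H _ ((posSemidef_switching hp).1 hpsd)
    intro V _ _ H c hH hpsd
    rcases Nat.eq_zero_or_pos (nullity (shiftMatrix lam H c)) with h0 | h0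
    · rw [h0]
      simpa using mul_nonneg (inv_nonneg.2 hr.le) (Nat.cast_nonneg (Fintype.card V))
    · have h2 : (nullity (shiftMatrix lam H c) : ℝ) ≤ 1 := by exact_mod_cast hH.nullity_le_one hpsd
      refine h2.trans ?_
      rw [← inv_mul_cancel₀ hr.ne']
      gcongr
      exact h V H c hpsd h0
  rw [nullity_switching hp]
  calc r * nullity (shiftMatrix lam H fun _ => ()) ≤ r * (r⁻¹ * Fintype.card V) := by gcongr
    _ = Fintype.card V := by field_simp

/-- The nullity of two-colored graphs of bounded degree. -/
theorem exists_nullity_bound_unsigned {p s : ℕ} (hp : p ≤ 2) {lam κ : ℝ} (hlam : 0 ≤ lam)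
    (hκ : 0 < κ)
    (h : ∀ (V : Type) [Fintype V] [DecidableEq V] (H : SimpleGraph V) (c : V → Unit),
      (shiftMatrix lam H c).PosSemidef → 0 < nullity (shiftMatrix lam H c) →
      1 ≤ κ * Fintype.card V) (Δ : ℕ) :
    ∃ C : ℝ, ∀ (V : Type) [Fintype V] [DecidableEq V] (H : SimpleGraph V)
      (c : V → Fin p), (∀ x, (Finset.univ.filter fun y => H.Adj x y).card ≤ Δ) →
      NegRankLE (shiftMatrix lam H c) s → (nullity (shiftMatrix lam H c) : ℝ) ≤
        κ * Fintype.card V + C := by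
  obtain ⟨C, hC, hbound⟩ := exists_sublinear_bound (K := Unit) hlam hκ s Δ
  refine ⟨s * C, fun V _ _ H c hdeg hs => ?_⟩
  rw [nullity_switching hp]
  refine nullity_le_of_components hC s Δ ?_ ?_ _ V H _ rfl hdeg s le_rfl
    ((negRankLE_switching hp).1 hs)
  · intro V _ _ H c hH hpsd
    rcases Nat.eq_zero_or_pos (nullity (shiftMatrix lam H c)) with h0 | h0
    · rw [h0]
      simpa using mul_nonneg hκ.le (Nat.cast_nonneg (Fintype.card V))
    · have h2 : (nullity (shiftMatrix lam H c) : ℝ) ≤ 1 := by exact_mod_cast hH.nullity_le_one hpsd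
      exact h2.trans (h V H c hpsd h0)
  · exact fun _ V _ _ H c hH hdeg hs => hbound V H c (fun _ _ => rfl) hH hdeg hs

theorem nullity_submatrix_equiv {V W : Type*} [Fintype V] [Fintype W] (M : Matrix V V ℝ)
    (e : W ≃ V) : nullity (M.submatrix e e) = nullity M := by
  have h1 := nullity_add_rank (M.submatrix e e)
  have h2 := nullity_add_rank M
  rw [rank_submatrix, Fintype.card_congr e] at h1
  omega

theorem hasSpectralRadius_iff {V : Type*} [Fintype V] [DecidableEq V] {H : SimpleGraph V} {lam : ℝ} :
    H.HasSpectralRadius lam ↔ (shiftMatrix lam H fun _ => ()).PosSemidef ∧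
      0 < nullity (shiftMatrix lam H fun _ => ()) := by
  have h : H.adjMatrix ℝ = colMatrix H fun _ => () := by
    ext u v
    simp [colMatrix_apply, SimpleGraph.adjMatrix_apply]
  rw [SimpleGraph.HasSpectralRadius, @isTopEigenvalue_iff V _ (Classical.decEq V), h, shiftMatrix]
  have h' : (fun a b => Classical.propDecidable (a = b)) = ‹DecidableEq V› := Subsingleton.elim _ _
  subst h'
  rfl

theorem spectralRadiusOrder_le {V : Type} [Fintype V] [DecidableEq V] {H : SimpleGraph V}
    {lam : ℝ} {c : V → Unit} (h : (shiftMatrix lam H c).PosSemidef)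
    (h0 : 0 < nullity (shiftMatrix lam H c)) : spectralRadiusOrder lam ≤ Fintype.card V := by
  refine sInf_le ⟨Fintype.card V, H.comap (Fintype.equivFin V).symm, ?_, rfl⟩
  have hM : shiftMatrix lam (H.comap (Fintype.equivFin V).symm) (fun _ => ()) =
      (shiftMatrix lam H c).submatrix (Fintype.equivFin V).symm (Fintype.equivFin V).symm := by
    ext a b
    by_cases hab : a = b
    · subst hab
      simp [shiftMatrix_self]
    · rw [shiftMatrix_of_ne _ hab, submatrix_apply,
        shiftMatrix_of_ne _ fun h => hab ((Fintype.equivFin V).symm.injective h)]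
      simp [colMatrix_apply]
  rw [hasSpectralRadius_iff, hM, nullity_submatrix_equiv]
  exact ⟨h.submatrix _, h0⟩

theorem exists_of_spectralRadiusOrder {lam : ℝ} {k : ℕ} (h : spectralRadiusOrder lam = k) :
    ∃ H : SimpleGraph (Fin k), (shiftMatrix lam H fun _ => ()).PosSemidef ∧
      0 < nullity (shiftMatrix lam H fun _ => ()) := by
  have hne : {k : ℕ∞ | ∃ (n : ℕ) (G : SimpleGraph (Fin n)), G.HasSpectralRadius lam ∧
      k = (n : ℕ∞)}.Nonempty := by
    by_contra hcon
    rw [Set.not_nonempty_iff_eq_empty] at hcon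
    rw [spectralRadiusOrder, hcon, sInf_empty] at h
    simp at h
  obtain ⟨n, G, hG, hn⟩ := csInf_mem hne
  have hnk : n = k := by
    rw [spectralRadiusOrder, hn] at h
    exact_mod_cast h
  subst hnk
  exact ⟨G, hasSpectralRadius_iff.1 hG⟩

end Unsigned

/-! ### Local restrictions when `λ₁ ≤ √3` -/

section LocalStructure

open scoped Classical

variable {V K : Type*} [Fintype V] [DecidableEq V] {H : SimpleGraph V} {c : V → K}

/-- The vector with given values at given vertices. -/
noncomputable def sumSingle {k : ℕ} (f : Fin k → V) (w : Fin k → ℝ) : V → ℝ :=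
  ∑ i, w i • Pi.single (f i) 1

theorem mulVec_sumSingle {k : ℕ} (M : Matrix V V ℝ) (f : Fin k → V) (w : Fin k → ℝ) (y : V) :
    (M *ᵥ sumSingle f w) y = ∑ i, w i * M y (f i) := by
  simp [sumSingle, mulVec_sum, mulVec_smul]

theorem sumSingle_form {k : ℕ} (M : Matrix V V ℝ) (f : Fin k → V) (w : Fin k → ℝ) :
    sumSingle f w ⬝ᵥ M *ᵥ sumSingle f w = ∑ i, w i * ∑ j, w j * M (f i) (f j) := by
  conv_lhs => enter [1]; rw [sumSingle]
  rw [sum_dotProduct]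
  refine Finset.sum_congr rfl fun i _ => ?_
  rw [smul_dotProduct, single_one_dotProduct, mulVec_sumSingle, smul_eq_mul]

theorem exists_int_colMatrix (u v : V) : ∃ z : ℤ, colMatrix H c u v = z := by
  by_cases h : H.Adj u v
  · rcases colMatrix_eq_or (c := c) h with h | h
    · exact ⟨1, by rw [h]; norm_num⟩
    · exact ⟨-1, by rw [h]; norm_num⟩
  · exact ⟨0, by rw [colMatrix_of_not_adj h]; norm_num⟩

theorem sqrt_three_mul_add_eq_zero {i j : ℤ} (h : √3 * i + j = 0) : i = 0 ∧ j = 0 := by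
  have hi : i = 0 := by
    by_contra hi
    have hi' : (i : ℝ) ≠ 0 := by exact_mod_cast hi
    refine irrational_sqrt_three ⟨-j / i, ?_⟩
    push_cast
    rw [div_eq_iff hi']
    linarith
  subst hi
  exact ⟨rfl, by simpa using h⟩

theorem sqrt_three_bounds : 1.7 < √3 ∧ √3 < 1.8 := by
  constructor
  · exact Real.lt_sqrt_of_sq_lt (by norm_num)
  · rw [Real.sqrt_lt' (by norm_num)]
    norm_num

/-- Triangles are rainbow. -/
theorem color_ne_of_triangle (h : (shiftMatrix √3 H c).PosSemidef) {a b d : V} (hab : H.Adj a b)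
    (had : H.Adj a d) (hbd : H.Adj b d) : c a ≠ c b := by
  intro hc
  -- If `a` and `b` share a color, the triangle switches to a positive one, of energy `3 * √3 - 6 <
  -- 0`.
  have h1 := (posSemidef_iff (isHermitian_shiftMatrix _)).1 h
    (sumSingle ![a, b, d] ![1, 1, colMatrix H c a d])
  have h2 : colMatrix H c b d = colMatrix H c a d := by
    simp [colMatrix_apply, had, hbd, hc]
  have h3 : colMatrix H c a b = 1 := by simp [colMatrix_apply, hab, hc]
  have h4 := colMatrix_sq (c := c) had
  rw [sumSingle_form] at h1
  simp only [Fin.sum_univ_three, cons_val_zero, cons_val_one, cons_val, shiftMatrix_self,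
    shiftMatrix_of_ne _ hab.ne, shiftMatrix_of_ne _ had.ne, shiftMatrix_of_ne _ hbd.ne,
    shiftMatrix_of_ne _ hab.ne', shiftMatrix_of_ne _ had.ne', shiftMatrix_of_ne _ hbd.ne',
    colMatrix_symm b a, colMatrix_symm d a, colMatrix_symm d b, h2, h3] at h1
  have h5 := sqrt_three_bounds.2
  nlinarith

/-- Induced four-cycles are negative. -/
theorem induced_square (h : (shiftMatrix √3 H c).PosSemidef) {a b d e : V} (hab : H.Adj a b)
    (hbd : H.Adj b d) (hde : H.Adj d e) (hae : H.Adj a e) (had : ¬ H.Adj a d) (hbe : ¬ H.Adj b e)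
    (had' : a ≠ d) (hbe' : b ≠ e) :
    colMatrix H c a b * colMatrix H c b d * (colMatrix H c d e * colMatrix H c a e) = -1 := by
  -- The entries make three edges positive, so a positive cycle would have energy `4 * √3 - 8 < 0`.
  have h1 := (posSemidef_iff (isHermitian_shiftMatrix _)).1 h
    (sumSingle ![a, b, d, e] ![1, colMatrix H c a b, colMatrix H c a b * colMatrix H c b d,
      colMatrix H c a e])
  rw [sumSingle_form] at h1
  simp only [Fin.sum_univ_four, cons_val_zero, cons_val_one, cons_val, shiftMatrix_self,
    shiftMatrix_of_ne _ hab.ne, shiftMatrix_of_ne _ hbd.ne, shiftMatrix_of_ne _ hde.ne,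
    shiftMatrix_of_ne _ hae.ne, shiftMatrix_of_ne _ hab.ne', shiftMatrix_of_ne _ hbd.ne',
    shiftMatrix_of_ne _ hde.ne', shiftMatrix_of_ne _ hae.ne', shiftMatrix_eq_zero _ had' had,
    shiftMatrix_eq_zero _ hbe' hbe, shiftMatrix_eq_zero _ had'.symm fun h => had h.symm,
    shiftMatrix_eq_zero _ hbe'.symm fun h => hbe h.symm,
    colMatrix_symm b a, colMatrix_symm d b, colMatrix_symm e d, colMatrix_symm e a] at h1
  have h5 := sqrt_three_bounds.2
  rcases colMatrix_eq_or (c := c) hab with h2 | h2 <;>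
    rcases colMatrix_eq_or (c := c) hbd with h3 | h3 <;>
    rcases colMatrix_eq_or (c := c) hde with h4 | h4 <;>
    rcases colMatrix_eq_or (c := c) hae with h6 | h6 <;>
    rw [h2, h3, h4, h6] at h1 ⊢ <;> first | (norm_num; done) | (exfalso; linarith)

/-- Three pairwise nonadjacent neighbors. -/
def IsClaw (H : SimpleGraph V) (v a b d : V) : Prop :=
  H.Adj v a ∧ H.Adj v b ∧ H.Adj v d ∧ a ≠ b ∧ a ≠ d ∧ b ≠ d ∧
    ¬ H.Adj a b ∧ ¬ H.Adj a d ∧ ¬ H.Adj b d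

/-- The center of a claw has no other neighbor, and is orthogonal to all other vertices. -/
theorem IsClaw.eigenvector (h : (shiftMatrix √3 H c).PosSemidef) {v a b d : V}
    (hcl : IsClaw H v a b d) {w : V} (hv : w ≠ v) (ha : w ≠ a) (hb : w ≠ b) (hd : w ≠ d) :
    ¬ H.Adj v w ∧ colMatrix H c v a * colMatrix H c a w + colMatrix H c v b * colMatrix H c b w +
      colMatrix H c v d * colMatrix H c d w = 0 := by
  obtain ⟨hva, hvb, hvd, hab, had, hbd, hab', had', hbd'⟩ := hcl
  have h1 : sumSingle ![v, a, b, d] ![√3, colMatrix H c v a, colMatrix H c v b, colMatrix H c v d] ⬝ᵥ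
      shiftMatrix √3 H c *ᵥ
      sumSingle ![v, a, b, d] ![√3, colMatrix H c v a, colMatrix H c v b, colMatrix H c v d] = 0 := by
    rw [sumSingle_form]
    simp only [Fin.sum_univ_four, cons_val_zero, cons_val_one, cons_val, shiftMatrix_self,
      shiftMatrix_of_ne _ hva.ne, shiftMatrix_of_ne _ hvb.ne, shiftMatrix_of_ne _ hvd.ne,
      shiftMatrix_of_ne _ hva.ne', shiftMatrix_of_ne _ hvb.ne', shiftMatrix_of_ne _ hvd.ne',
      shiftMatrix_eq_zero _ hab hab', shiftMatrix_eq_zero _ had had',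
      shiftMatrix_eq_zero _ hbd hbd', shiftMatrix_eq_zero _ hab.symm fun h => hab' h.symm,
      shiftMatrix_eq_zero _ had.symm fun h => had' h.symm,
      shiftMatrix_eq_zero _ hbd.symm fun h => hbd' h.symm,
      colMatrix_symm a v, colMatrix_symm b v, colMatrix_symm d v]
    have e1 := colMatrix_sq (c := c) hva
    have e2 := colMatrix_sq (c := c) hvb
    have e3 := colMatrix_sq (c := c) hvd
    have e4 : √3 * √3 = 3 := Real.mul_self_sqrt (by norm_num)
    linear_combination √3 * e4 - √3 * e1 - √3 * e2 - √3 * e3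
  have h2 := congrFun (mulVec_eq_zero_of_posSemidef h h1) w
  rw [mulVec_sumSingle] at h2
  simp only [Fin.sum_univ_four, cons_val_zero, cons_val_one, cons_val,
    shiftMatrix_of_ne _ hv, shiftMatrix_of_ne _ ha, shiftMatrix_of_ne _ hb, shiftMatrix_of_ne _ hd,
    Pi.zero_apply, colMatrix_symm w] at h2
  obtain ⟨z1, e1⟩ := exists_int_colMatrix (H := H) (c := c) v a
  obtain ⟨z2, e2⟩ := exists_int_colMatrix (H := H) (c := c) v b
  obtain ⟨z3, e3⟩ := exists_int_colMatrix (H := H) (c := c) v d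
  obtain ⟨y1, f1⟩ := exists_int_colMatrix (H := H) (c := c) a w
  obtain ⟨y2, f2⟩ := exists_int_colMatrix (H := H) (c := c) b w
  obtain ⟨y3, f3⟩ := exists_int_colMatrix (H := H) (c := c) d w
  obtain ⟨t, g⟩ := exists_int_colMatrix (H := H) (c := c) v w
  rw [e1, e2, e3, f1, f2, f3, g] at h2
  -- The entries are integers and `√3` is irrational, so the center term and the leaf terms vanish
  -- separately.
  have h3 : √3 * (t : ℤ) + ((z1 * y1 + z2 * y2 + z3 * y3 : ℤ) : ℝ) = 0 := by
    push_cast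
    linarith
  obtain ⟨h4, h5⟩ := sqrt_three_mul_add_eq_zero h3
  constructor
  · intro hvw
    refine colMatrix_ne_zero_iff (c := c).2 hvw ?_
    rw [g, h4, Int.cast_zero]
  · rw [e1, e2, e3, f1, f2, f3]
    exact_mod_cast h5

/-- A vertex sees an even number of the neighbors of the center of a claw. -/
theorem IsClaw.adj_iff (h : (shiftMatrix √3 H c).PosSemidef) {v a b d : V}
    (hcl : IsClaw H v a b d) {w : V} (hv : w ≠ v) (ha : w ≠ a) (hb : w ≠ b) (hd : w ≠ d)
    (hwa : H.Adj a w) : (H.Adj b w ↔ ¬ H.Adj d w) := by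
  have h1 := (hcl.eigenvector h hv ha hb hd).2
  obtain ⟨hva, hvb, hvd, -⟩ := hcl
  by_cases hwb : H.Adj b w <;> by_cases hwd : H.Adj d w <;>
    simp only [hwb, hwd, not_true_eq_false, not_false_eq_true, iff_self, iff_false, iff_true]
  · rcases colMatrix_eq_or (c := c) hva with e1 | e1 <;>
    rcases colMatrix_eq_or (c := c) hvb with e2 | e2 <;>
    rcases colMatrix_eq_or (c := c) hvd with e3 | e3 <;>
    rcases colMatrix_eq_or (c := c) hwa with e4 | e4 <;>
    rcases colMatrix_eq_or (c := c) hwb with e5 | e5 <;>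
    rcases colMatrix_eq_or (c := c) hwd with e6 | e6 <;>
    rw [e1, e2, e3, e4, e5, e6] at h1 <;> norm_num at h1
  · rw [colMatrix_of_not_adj hwb, colMatrix_of_not_adj hwd] at h1
    rcases colMatrix_eq_or (c := c) hva with e1 | e1 <;>
    rcases colMatrix_eq_or (c := c) hwa with e4 | e4 <;>
    rw [e1, e4] at h1 <;> norm_num at h1

theorem IsClaw.swap {v a b d : V} (h : IsClaw H v a b d) : IsClaw H v b a d := by
  obtain ⟨hva, hvb, hvd, hab, had, hbd, hab', had', hbd'⟩ := h
  exact ⟨hvb, hva, hvd, hab.symm, hbd, had, fun h => hab' h.symm, hbd', had'⟩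

theorem IsClaw.rotate {v a b d : V} (h : IsClaw H v a b d) : IsClaw H v b d a := by
  obtain ⟨hva, hvb, hvd, hab, had, hbd, hab', had', hbd'⟩ := h
  exact ⟨hvb, hvd, hva, hbd, hab.symm, had.symm, hbd', fun h => hab' h.symm, fun h => had' h.symm⟩

theorem IsClaw.eq_of_adj (h : (shiftMatrix √3 H c).PosSemidef) {v a b d w : V}
    (hcl : IsClaw H v a b d) (hw : H.Adj v w) : w = a ∨ w = b ∨ w = d := by
  by_contra hcon
  push Not at hcon
  exact (hcl.eigenvector h hw.ne' hcon.1 hcon.2.1 hcon.2.2).1 hw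

end LocalStructure

/-! ### Components containing a claw -/

section ClawCase

open scoped Classical

variable {V : Type*} [Fintype V] [DecidableEq V] {H : SimpleGraph V} {c : V → Fin 3}

/-- Suppose `y ≠ y'` are both common neighbors of the leaves `a`, `b`. If adjacent, rainbow
triangles over the edge `yy'` force `c a = c b`, against orthogonality to the claw vector. If not,
`a y b y'` is an induced square, which the two orthogonality relations make positive. -/
theorem IsClaw.unique_common (h : (shiftMatrix √3 H c).PosSemidef) {x a b d y y' : V}
    (hcl : IsClaw H x a b d) (hx : y ≠ x) (hx' : y' ≠ x) (hay : H.Adj a y) (hby : H.Adj b y)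
    (hay' : H.Adj a y') (hby' : H.Adj b y') : y = y' := by
  by_contra hne
  obtain ⟨hxa, hxb, hxd, hab, had, hbd, hab', had', hbd'⟩ := id hcl
  have hd : y ≠ d := fun h => had' (h ▸ hay)
  have hd' : y' ≠ d := fun h => had' (h ▸ hay')
  have hdy : ¬ H.Adj d y := (hcl.adj_iff h hx hay.ne' hby.ne' hd hay).1 hby
  have hdy' : ¬ H.Adj d y' := (hcl.adj_iff h hx' hay'.ne' hby'.ne' hd' hay').1 hby'
  have e1 := (hcl.eigenvector h hx hay.ne' hby.ne' hd).2
  have e2 := (hcl.eigenvector h hx' hay'.ne' hby'.ne' hd').2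
  rw [colMatrix_of_not_adj hdy, mul_zero, add_zero] at e1
  rw [colMatrix_of_not_adj hdy', mul_zero, add_zero] at e2
  by_cases hyy : H.Adj y y'
  · have h1 := color_ne_of_triangle h hay hay' hyy
    have h2 := color_ne_of_triangle h hby hby' hyy
    rw [colMatrix_apply a y, colMatrix_apply b y, if_pos hay, if_pos hby, if_neg h1, if_neg h2] at e1
    have h3 := color_ne_of_triangle h hay' hay hyy.symm
    have h4 := color_ne_of_triangle h hby' hby hyy.symm
    have h5 := color_ne_of_triangle h hyy hay.symm hay'.symm
    have h6 : c a = c b := by omega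
    have h7 : colMatrix H c x a = colMatrix H c x b := by
      simp [colMatrix_apply, hxa, hxb, h6]
    rw [h7] at e1
    rcases colMatrix_eq_or (c := c) hxb with e3 | e3 <;> rw [e3] at e1 <;> norm_num at e1
  · have h1 := induced_square h hay hby.symm hby' hay' hab' hyy hab hne
    rw [colMatrix_symm y b] at h1
    have e3 := colMatrix_sq (c := c) hxa
    have e4 := colMatrix_sq (c := c) hxb
    have e5 := colMatrix_sq (c := c) hay
    have e6 := colMatrix_sq (c := c) hay'
    have e7 : colMatrix H c a y * colMatrix H c a y' = colMatrix H c b y * colMatrix H c b y' := by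
      linear_combination colMatrix H c x a * colMatrix H c a y' * e1 -
        colMatrix H c x b * colMatrix H c b y * e2 -
        colMatrix H c a y * colMatrix H c a y' * e3 + colMatrix H c b y * colMatrix H c b y' * e4
    have e8 : (1 : ℝ) = -1 := by
      linear_combination h1 + colMatrix H c a y * colMatrix H c a y' * e7 -
        colMatrix H c a y' * colMatrix H c a y' * e5 - e6
    norm_num at e8

/-- The vertices adjacent to a neighbor of a claw center see exactly two of its neighbors. -/
theorem IsClaw.exists_pair (h : (shiftMatrix √3 H c).PosSemidef) {x a b d y : V}
    (hcl : IsClaw H x a b d) (hx : y ≠ x) (ha : y ≠ a) (hb : y ≠ b) (hd : y ≠ d)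
    (hy : H.Adj a y ∨ H.Adj b y ∨ H.Adj d y) :
    (H.Adj a y ∧ H.Adj b y ∧ ¬ H.Adj d y) ∨ (H.Adj a y ∧ ¬ H.Adj b y ∧ H.Adj d y) ∨
      (¬ H.Adj a y ∧ H.Adj b y ∧ H.Adj d y) := by
  have h1 := hcl.adj_iff h hx ha hb hd
  have h2 := hcl.rotate.adj_iff h hx hb hd ha
  have h3 := hcl.rotate.rotate.adj_iff h hx hd ha hb
  tauto

/-- The component looks like part of a cube: the center, three leaves, at most one further vertex
for each pair of leaves, and at most one vertex beyond these. -/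
theorem IsClaw.card_le (h : (shiftMatrix √3 H c).PosSemidef) (hH : NoSplit H) {x a b d : V}
    (hcl : IsClaw H x a b d) : Fintype.card V ≤ 8 := by
  obtain ⟨hxa, hxb, hxd, hab, had, hbd, hab', had', hbd'⟩ := id hcl
  set F : Finset V := {x, a, b, d} with hF
  have hFiff : ∀ w, w ∉ F ↔ w ≠ x ∧ w ≠ a ∧ w ≠ b ∧ w ≠ d := by
    intro w
    simp [hF, not_or]
  set Y : V → Prop := fun y => y ∉ F ∧ (H.Adj a y ∨ H.Adj b y ∨ H.Adj d y) with hY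
  set Z : V → Prop := fun z => z ∉ F ∧ ¬ (H.Adj a z ∨ H.Adj b z ∨ H.Adj d z) ∧ ∃ y, Y y ∧ H.Adj y z
    with hZ
  have hpair : ∀ y, Y y → (H.Adj a y ∧ H.Adj b y ∧ ¬ H.Adj d y) ∨
      (H.Adj a y ∧ ¬ H.Adj b y ∧ H.Adj d y) ∨ (¬ H.Adj a y ∧ H.Adj b y ∧ H.Adj d y) := by
    intro y hy
    obtain ⟨h1, h2, h3, h4⟩ := (hFiff y).1 hy.1
    exact hcl.exists_pair h h1 h2 h3 h4 hy.2
  have huab : ∀ y y', Y y → Y y' → H.Adj a y → H.Adj b y → H.Adj a y' → H.Adj b y' → y = y' :=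
    fun y y' hy hy' h1 h2 h3 h4 =>
      hcl.unique_common h ((hFiff y).1 hy.1).1 ((hFiff y').1 hy'.1).1 h1 h2 h3 h4
  have hubd : ∀ y y', Y y → Y y' → H.Adj b y → H.Adj d y → H.Adj b y' → H.Adj d y' → y = y' :=
    fun y y' hy hy' h1 h2 h3 h4 =>
      hcl.rotate.unique_common h ((hFiff y).1 hy.1).1 ((hFiff y').1 hy'.1).1 h1 h2 h3 h4
  have huad : ∀ y y', Y y → Y y' → H.Adj a y → H.Adj d y → H.Adj a y' → H.Adj d y' → y = y' :=
    fun y y' hy hy' h1 h2 h3 h4 => hcl.rotate.rotate.unique_common h ((hFiff y).1 hy.1).1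
      ((hFiff y').1 hy'.1).1 h2 h1 h4 h3
  -- a far vertex completes a claw at each vertex of `Y`
  have hclaw : ∀ y z, Y y → Z z → H.Adj y z → ∃ f g, (f = a ∨ f = b ∨ f = d) ∧
      (g = a ∨ g = b ∨ g = d) ∧ IsClaw H y f g z ∧
      ∀ y', Y y' → y' ≠ y → (H.Adj f y' ∧ ¬ H.Adj g y') ∨ (¬ H.Adj f y' ∧ H.Adj g y') := by
    intro y z hy hz hyz
    have hz' := hz.2.1
    obtain ⟨-, h2, h3, h4⟩ := (hFiff z).1 hz.1
    push Not at hz'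
    rcases hpair y hy with ⟨p, q, -⟩ | ⟨p, -, q⟩ | ⟨-, p, q⟩
    · refine ⟨a, b, by simp, by simp, ⟨p.symm, q.symm, hyz, hab, h2.symm, h3.symm, hab',
        hz'.1, hz'.2.1⟩, fun y' hy' hne => ?_⟩
      rcases hpair y' hy' with ⟨p', q', -⟩ | ⟨p', q', -⟩ | ⟨p', q', -⟩
      · exact absurd (huab y' y hy' hy p' q' p q) hne
      · exact Or.inl ⟨p', q'⟩
      · exact Or.inr ⟨p', q'⟩
    · refine ⟨a, d, by simp, by simp, ⟨p.symm, q.symm, hyz, had, h2.symm, h4.symm, had',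
        hz'.1, hz'.2.2⟩, fun y' hy' hne => ?_⟩
      rcases hpair y' hy' with ⟨p', -, q'⟩ | ⟨p', -, q'⟩ | ⟨p', -, q'⟩
      · exact Or.inl ⟨p', q'⟩
      · exact absurd (huad y' y hy' hy p' q' p q) hne
      · exact Or.inr ⟨p', q'⟩
    · refine ⟨b, d, by simp, by simp, ⟨p.symm, q.symm, hyz, hbd, h3.symm, h4.symm, hbd',
        hz'.2.1, hz'.2.2⟩, fun y' hy' hne => ?_⟩
      rcases hpair y' hy' with ⟨-, p', q'⟩ | ⟨-, p', q'⟩ | ⟨-, p', q'⟩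
      · exact Or.inl ⟨p', q'⟩
      · exact Or.inr ⟨p', q'⟩
      · exact absurd (hubd y' y hy' hy p' q' p q) hne
  have hmem : ∀ f, f = a ∨ f = b ∨ f = d → f ∈ F := by
    rintro f (rfl | rfl | rfl) <;> simp [hF]
  -- A far vertex `z` is a leaf of a claw at `y` whose other leaves lie in `F`, and a claw center
  -- has no further neighbors.
  have honly : ∀ y z z', Y y → Z z → Z z' → H.Adj y z → H.Adj y z' → z' = z := by
    intro y z z' hy hz hz' hyz hyz'
    obtain ⟨f, g, hf, hg, hc', -⟩ := hclaw y z hy hz hyz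
    rcases hc'.eq_of_adj h hyz' with rfl | rfl | h1
    · exact absurd (hmem _ hf) hz'.1
    · exact absurd (hmem _ hg) hz'.1
    · exact h1
  -- Another vertex of `Y` sees exactly one of `f`, `g`, so parity at the claw centered at `y` makes
  -- it see `z`.
  have hall : ∀ y y' z, Y y → Y y' → Z z → H.Adj y z → H.Adj y' z := by
    intro y y' z hy hy' hz hyz
    by_cases hyy : y' = y
    · rwa [hyy]
    have hy'z : y' ≠ z := fun h => hz.2.1 (h ▸ hy'.2)
    obtain ⟨f, g, hf, hg, hc', hone⟩ := hclaw y z hy hz hyz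
    have hy'f : y' ≠ f := fun h => hy'.1 (h ▸ hmem f hf)
    have hy'g : y' ≠ g := fun h => hy'.1 (h ▸ hmem g hg)
    rcases hone y' hy' hyy with ⟨p, q⟩ | ⟨p, q⟩
    · by_contra hcon
      exact q ((hc'.adj_iff h hyy hy'f hy'g hy'z p).2 fun h => hcon h.symm)
    · by_contra hcon
      exact p ((hc'.swap.adj_iff h hyy hy'g hy'f hy'z q).2 fun h => hcon h.symm)
  have hclosed : ∀ u v, H.Adj u v → (u ∈ F ∨ Y u ∨ Z u) → (v ∈ F ∨ Y v ∨ Z v) := by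
    intro u v huv hu
    by_contra hv
    push Not at hv
    obtain ⟨hv1, hv2, hv3⟩ := hv
    have hvadj : ¬ (H.Adj a v ∨ H.Adj b v ∨ H.Adj d v) := fun h' => hv2 ⟨hv1, h'⟩
    rcases hu with hu | hu | hu
    · simp only [hF, Finset.mem_insert, Finset.mem_singleton] at hu
      rcases hu with rfl | rfl | rfl | rfl
      · exact hv1 (hmem v (hcl.eq_of_adj h huv))
      · exact hvadj (Or.inl huv)
      · exact hvadj (Or.inr (Or.inl huv))
      · exact hvadj (Or.inr (Or.inr huv))
    · exact hv3 ⟨hv1, hvadj, u, hu, huv⟩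
    -- A new neighbor of the far vertex would, by parity, see a leaf of the original claw.
    · obtain ⟨y, hy, hyu⟩ := hu.2.2
      obtain ⟨f, g, hf, hg, hc', -⟩ := hclaw y u hy hu hyu
      have hno : ∀ f, f = a ∨ f = b ∨ f = d → ¬ H.Adj f v := by
        rintro f (rfl | rfl | rfl) h'
        · exact hvadj (Or.inl h')
        · exact hvadj (Or.inr (Or.inl h'))
        · exact hvadj (Or.inr (Or.inr h'))
      exact hno f hf ((hc'.rotate.rotate.adj_iff h (w := v) (fun h => hv2 (h ▸ hy)) huv.ne'
        (fun h => hv1 (h ▸ hmem f hf)) (fun h => hv1 (h ▸ hmem g hg)) huv).2 (hno g hg))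
  have huniv := hH _ hclosed x (Or.inl (by simp [hF]))
  have hsub : (Finset.univ : Finset V) ⊆ F ∪ ((Finset.univ.filter fun y => Y y ∧ H.Adj a y ∧ H.Adj b y) ∪
      ((Finset.univ.filter fun y => Y y ∧ H.Adj a y ∧ H.Adj d y) ∪
      ((Finset.univ.filter fun y => Y y ∧ H.Adj b y ∧ H.Adj d y) ∪ Finset.univ.filter Z))) := by
    intro v _
    simp only [Finset.mem_union, Finset.mem_filter, Finset.mem_univ, true_and]
    rcases huniv v with k | k | k
    · exact Or.inl k
    · rcases hpair v k with k' | k' | k'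
      · exact Or.inr (Or.inl ⟨k, k'.1, k'.2.1⟩)
      · exact Or.inr (Or.inr (Or.inl ⟨k, k'.1, k'.2.2⟩))
      · exact Or.inr (Or.inr (Or.inr (Or.inl ⟨k, k'.2⟩)))
    · exact Or.inr (Or.inr (Or.inr (Or.inr k)))
  have c1 : (Finset.univ.filter fun y => Y y ∧ H.Adj a y ∧ H.Adj b y).card ≤ 1 := by
    rw [Finset.card_le_one]
    simp only [Finset.mem_filter, Finset.mem_univ, true_and]
    exact fun y hy y' hy' => huab y y' hy.1 hy'.1 hy.2.1 hy.2.2 hy'.2.1 hy'.2.2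
  have c2 : (Finset.univ.filter fun y => Y y ∧ H.Adj a y ∧ H.Adj d y).card ≤ 1 := by
    rw [Finset.card_le_one]
    simp only [Finset.mem_filter, Finset.mem_univ, true_and]
    exact fun y hy y' hy' => huad y y' hy.1 hy'.1 hy.2.1 hy.2.2 hy'.2.1 hy'.2.2
  have c3 : (Finset.univ.filter fun y => Y y ∧ H.Adj b y ∧ H.Adj d y).card ≤ 1 := by
    rw [Finset.card_le_one]
    simp only [Finset.mem_filter, Finset.mem_univ, true_and]
    exact fun y hy y' hy' => hubd y y' hy.1 hy'.1 hy.2.1 hy.2.2 hy'.2.1 hy'.2.2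
  have c4 : (Finset.univ.filter Z).card ≤ 1 := by
    rw [Finset.card_le_one]
    simp only [Finset.mem_filter, Finset.mem_univ, true_and]
    intro z hz z' hz'
    obtain ⟨y, hy, hyz⟩ := hz.2.2
    obtain ⟨y', hy', hyz'⟩ := hz'.2.2
    exact honly y' z' z hy' hz' hz hyz' (hall y y' z hy hy' hz hyz)
  have c0 : F.card ≤ 4 := Finset.card_le_four
  have := Finset.card_le_card hsub
  have e1 := Finset.card_union_le F ((Finset.univ.filter fun y => Y y ∧ H.Adj a y ∧ H.Adj b y) ∪
      ((Finset.univ.filter fun y => Y y ∧ H.Adj a y ∧ H.Adj d y) ∪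
      ((Finset.univ.filter fun y => Y y ∧ H.Adj b y ∧ H.Adj d y) ∪ Finset.univ.filter Z)))
  have e2 := Finset.card_union_le (Finset.univ.filter fun y => Y y ∧ H.Adj a y ∧ H.Adj b y)
      ((Finset.univ.filter fun y => Y y ∧ H.Adj a y ∧ H.Adj d y) ∪
      ((Finset.univ.filter fun y => Y y ∧ H.Adj b y ∧ H.Adj d y) ∪ Finset.univ.filter Z))
  have e3 := Finset.card_union_le (Finset.univ.filter fun y => Y y ∧ H.Adj a y ∧ H.Adj d y)
      ((Finset.univ.filter fun y => Y y ∧ H.Adj b y ∧ H.Adj d y) ∪ Finset.univ.filter Z)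
  have e4 := Finset.card_union_le (Finset.univ.filter fun y => Y y ∧ H.Adj b y ∧ H.Adj d y)
    (Finset.univ.filter Z)
  rw [Finset.card_univ] at this
  omega

end ClawCase

/-! ### Three colors exclude `A² = 3` -/

section ThreeColors

open scoped Classical

variable {V : Type*} [Fintype V] [DecidableEq V] {H : SimpleGraph V} {c : V → Fin 3}

/-- Three colors do not allow `A ^ 2 = 3`. -/
theorem colMatrix_sq_ne_three (h : (shiftMatrix √3 H c).PosSemidef) [Nonempty V]
    (hsq : colMatrix H c * colMatrix H c = (3 : ℝ) • (1 : Matrix V V ℝ)) : False := by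
  have hent : ∀ u v, ∑ w, colMatrix H c u w * colMatrix H c w v = if u = v then 3 else 0 := by
    intro u v
    rw [← mul_apply, hsq, Matrix.smul_apply, one_apply]
    by_cases huv : u = v <;> simp [huv]
  -- Rainbow triangles have negative edges only, so every path of length two between adjacent
  -- vertices counts `+1` and nothing can cancel it.
  have hfree : ∀ u v w, H.Adj u v → H.Adj u w → ¬ H.Adj v w := by
    intro u v w huv huw hvw
    have h1 := hent u v
    rw [if_neg huv.ne] at h1
    have h2 : ∀ y ∈ Finset.univ, 0 ≤ colMatrix H c u y * colMatrix H c y v := by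
      intro y _
      by_cases hy : H.Adj u y ∧ H.Adj y v
      · have e1 := color_ne_of_triangle h hy.1 huv hy.2
        have e2 := color_ne_of_triangle h hy.2 hy.1.symm huv.symm
        simp [colMatrix_apply, hy, e1, e2]
      · rw [not_and_or] at hy
        rcases hy with hy | hy <;> simp [colMatrix_of_not_adj hy]
    rw [Finset.sum_eq_zero_iff_of_nonneg h2] at h1
    have h3 := h1 w (Finset.mem_univ w)
    rcases mul_eq_zero.1 h3 with h4 | h4
    · exact colMatrix_ne_zero_iff.2 huw h4
    · exact colMatrix_ne_zero_iff.2 hvw.symm h4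
  -- The path through `x` must be cancelled by another path between its neighbors, which closes an
  -- induced square.
  have hsquare : ∀ x a b, H.Adj x a → H.Adj x b → a ≠ b → ∃ y, y ≠ x ∧ H.Adj a y ∧ H.Adj b y ∧
      colMatrix H c x a * colMatrix H c a y * (colMatrix H c y b * colMatrix H c x b) = -1 := by
    intro x a b hxa hxb hab
    have h1 := hent a b
    rw [if_neg hab] at h1
    have h2 : ∃ y, y ≠ x ∧ colMatrix H c a y * colMatrix H c y b ≠ 0 := by
      by_contra hcon
      push Not at hcon
      rw [Finset.sum_eq_single x (fun y _ hy => hcon y hy) (by simp)] at h1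
      rcases mul_eq_zero.1 h1 with h4 | h4
      · exact colMatrix_ne_zero_iff.2 hxa.symm h4
      · exact colMatrix_ne_zero_iff.2 hxb h4
    obtain ⟨y, hy, hne⟩ := h2
    have h3 := colMatrix_ne_zero_iff.1 (left_ne_zero_of_mul hne)
    have h4 := colMatrix_ne_zero_iff.1 (right_ne_zero_of_mul hne)
    exact ⟨y, hy, h3, h4.symm, induced_square h hxa h3 h4 hxb
      (fun h' => hfree a x y hxa.symm h3 h') (hfree x a b hxa hxb) hy.symm hab⟩
  have hcol : ∀ x a b, H.Adj x a → H.Adj x b → c a = c b → a = b := by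
    intro x a b hxa hxb hc
    by_contra hab
    obtain ⟨y, -, hay, hby, hp⟩ := hsquare x a b hxa hxb hab
    have e1 : colMatrix H c x b = colMatrix H c x a := by simp [colMatrix_apply, hxa, hxb, hc]
    have e2 : colMatrix H c y b = colMatrix H c a y := by
      rw [colMatrix_symm]
      simp [colMatrix_apply, hay, hby, hc]
    rw [e1, e2] at hp
    have e3 := colMatrix_sq (c := c) hxa
    have e4 := colMatrix_sq (c := c) hay
    have e5 : (1 : ℝ) = -1 := by
      linear_combination hp - colMatrix H c a y * colMatrix H c a y * e3 - e4
    norm_num at e5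
  -- Each vertex has three neighbors, of distinct colors because equal colors would make the square
  -- positive. So every color occurs around every vertex.
  have hsurj : ∀ (x : V) (k : Fin 3), ∃ w, H.Adj x w ∧ c w = k := by
    intro x k
    have hdeg : (Finset.univ.filter fun w => H.Adj x w).card = 3 := by
      have h1 := hent x x
      rw [if_pos rfl] at h1
      have h2 : ∀ w, colMatrix H c x w * colMatrix H c w x = if H.Adj x w then 1 else 0 := by
        intro w
        rw [colMatrix_symm w x]
        by_cases hw : H.Adj x w
        · rw [colMatrix_sq hw, if_pos hw]
        · rw [colMatrix_of_not_adj hw, if_neg hw, zero_mul]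
      rw [Finset.sum_congr rfl fun w _ => h2 w, Finset.sum_boole] at h1
      exact_mod_cast h1
    have h1 : ((Finset.univ.filter fun w => H.Adj x w).image c) = Finset.univ := by
      refine Finset.eq_univ_of_card _ ?_
      rw [Finset.card_image_of_injOn, hdeg, Fintype.card_fin]
      intro a ha b hb hab
      simp only [Finset.coe_filter, Finset.mem_univ, true_and, Set.mem_ofPred_eq] at ha hb
      exact hcol x a b ha hb hab
    have h2 : k ∈ (Finset.univ.filter fun w => H.Adj x w).image c := h1 ▸ Finset.mem_univ k
    obtain ⟨w, hw, hk⟩ := Finset.mem_image.1 h2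
    exact ⟨w, (Finset.mem_filter.1 hw).2, hk⟩
  obtain ⟨x⟩ := ‹Nonempty V›
  obtain ⟨a, hxa, hca⟩ := hsurj x (c x)
  -- The sign of the square through `a` and `d` forces its fourth vertex `w` to have the color of
  -- `b`, hence `w = y`. Then `y` sees all three leaves of a claw, against parity.
  have key : ∀ b d y, H.Adj x b → H.Adj x d → c b ≠ c x → c d ≠ c x → c b ≠ c d → y ≠ x →
      H.Adj b y → H.Adj d y → c y = c b → False := by
    intro b d y hxb hxd hb hd hbd hyx hby hdy hcy
    have had : a ≠ d := fun h => hd (h ▸ hca)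
    have hab : a ≠ b := fun h => hb (h ▸ hca)
    obtain ⟨w, hwx, haw, hdw, hp⟩ := hsquare x a d hxa hxd had
    have hcw : c w = c b := by
      have e1 : colMatrix H c x a = 1 := by simp [colMatrix_apply, hxa, hca]
      have e2 : colMatrix H c x d = -1 := by simp [colMatrix_apply, hxd, hd.symm]
      rw [e1, e2, colMatrix_apply, colMatrix_apply, if_pos haw, if_pos hdw.symm, hca] at hp
      by_cases h1 : c x = c w
      · have h2 : c w ≠ c d := fun h2 => hd (h2 ▸ h1.symm)
        rw [if_pos h1, if_neg h2] at hp
        norm_num at hp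
      · by_cases h2 : c w = c d
        · rw [if_neg h1, if_pos h2] at hp
          norm_num at hp
        · omega
    obtain rfl : w = y := hcol d w y hdw hdy (hcw.trans hcy.symm)
    have hcl : IsClaw H x a b d := ⟨hxa, hxb, hxd, hab, had, fun h => hbd (by rw [h]),
      hfree x a b hxa hxb, hfree x a d hxa hxd, hfree x b d hxb hxd⟩
    exact (hcl.adj_iff h hyx haw.ne' hby.ne' hdy.ne' haw).1 hby hdy
  have hk : ∀ i : Fin 3, ∃ j k : Fin 3, j ≠ i ∧ k ≠ i ∧ j ≠ k := by decide
  obtain ⟨j, k, hj, hk, hjk⟩ := hk (c x)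
  obtain ⟨b, hxb, rfl⟩ := hsurj x j
  obtain ⟨d, hxd, rfl⟩ := hsurj x k
  obtain ⟨y, hyx, hby, hdy, hp⟩ := hsquare x b d hxb hxd fun h => hjk (by rw [h])
  have e1 : colMatrix H c x b = -1 := by simp [colMatrix_apply, hxb, hj.symm]
  have e2 : colMatrix H c x d = -1 := by simp [colMatrix_apply, hxd, hk.symm]
  by_cases h1 : c y = c b
  · exact key b d y hxb hxd hj hk hjk hyx hby hdy h1
  · by_cases h2 : c y = c d
    · exact key d b y hxd hxb hk hj hjk.symm hyx hdy hby h2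
    · rw [e1, e2, colMatrix_apply, colMatrix_apply, if_pos hby, if_pos hdy.symm,
        if_neg fun h => h1 h.symm, if_neg h2] at hp
      norm_num at hp

end ThreeColors

/-! ### Eigenvalue bounds from forms and degrees -/

section Spectrum

open scoped Classical

variable {V K : Type*} [Fintype V] [DecidableEq V] {H : SimpleGraph V} {c : V → K}

/-- Bounds for the form bound the eigenvalues. -/
theorem le_eigenvalues {A : Matrix V V ℝ} (hA : A.IsHermitian) {l : ℝ}
    (h : ∀ x : V → ℝ, l * (x ⬝ᵥ x) ≤ x ⬝ᵥ A *ᵥ x) (i : V) : l ≤ hA.eigenvalues i := by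
  obtain ⟨U, -, hU2, hAU⟩ := exists_spectral hA
  have h1 := h (U *ᵥ Pi.single i 1)
  have h2 : (U *ᵥ Pi.single i 1) ⬝ᵥ (U *ᵥ Pi.single i 1) = 1 := by
    rw [dotProduct_mulVec, ← mulVec_transpose, mulVec_mulVec, hU2, one_mulVec]
    simp
  have h3 : A *ᵥ (U *ᵥ Pi.single i 1) = hA.eigenvalues i • (U *ᵥ Pi.single i 1) := by
    have h4 : A * U = U * diagonal hA.eigenvalues := by
      calc A * U = U * diagonal hA.eigenvalues * Uᵀ * U := by rw [← hAU]
        _ = U * diagonal hA.eigenvalues := by rw [Matrix.mul_assoc, hU2, Matrix.mul_one]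
    rw [mulVec_mulVec, h4, ← mulVec_mulVec, diagonal_mulVec_single, ← mulVec_smul]
    congr 1
    ext j
    by_cases hj : j = i <;> simp [hj]
  rw [h3, dotProduct_smul, h2] at h1
  simpa using h1

theorem colMatrix_form_ge {Δ : ℕ} (hdeg : ∀ x, (Finset.univ.filter fun y => H.Adj x y).card ≤ Δ)
    (x : V → ℝ) : -(Δ : ℝ) * (x ⬝ᵥ x) ≤ x ⬝ᵥ colMatrix H c *ᵥ x := by
  have h1 : ∑ u, ∑ v, (if H.Adj u v then x u ^ 2 else 0) ≤ Δ * (x ⬝ᵥ x) := by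
    rw [dotProduct, Finset.mul_sum]
    refine Finset.sum_le_sum fun u _ => ?_
    rw [← Finset.sum_filter, Finset.sum_const, nsmul_eq_mul, sq]
    have : ((Finset.univ.filter fun y => H.Adj u y).card : ℝ) ≤ Δ := by exact_mod_cast hdeg u
    exact mul_le_mul_of_nonneg_right this (mul_self_nonneg _)
  have h2 : ∑ u, ∑ v, (if H.Adj u v then x v ^ 2 else 0) =
      ∑ u, ∑ v, (if H.Adj u v then x u ^ 2 else 0) := by
    rw [Finset.sum_comm]
    simp only [H.adj_comm]
  have h3 : x ⬝ᵥ colMatrix H c *ᵥ x = ∑ u, ∑ v, colMatrix H c u v * (x u * x v) := by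
    simp only [dotProduct, mulVec, Finset.mul_sum]
    exact Finset.sum_congr rfl fun u _ => Finset.sum_congr rfl fun v _ => by ring
  have h4 : -(∑ u, ∑ v, (if H.Adj u v then x u ^ 2 else 0) +
      ∑ u, ∑ v, (if H.Adj u v then x v ^ 2 else 0)) ≤ 2 * (x ⬝ᵥ colMatrix H c *ᵥ x) := by
    rw [h3]
    simp only [Finset.mul_sum, ← Finset.sum_add_distrib, ← Finset.sum_neg_distrib]
    refine Finset.sum_le_sum fun u _ => Finset.sum_le_sum fun v _ => ?_
    by_cases huv : H.Adj u v
    · simp only [huv, if_true]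
      rcases colMatrix_eq_or (c := c) huv with e | e <;> rw [e]
      · nlinarith [sq_nonneg (x u + x v)]
      · nlinarith [sq_nonneg (x u - x v)]
    · simp [huv, colMatrix_of_not_adj huv]
  rw [h2] at h4
  linarith

/-- If all eigenvalues have the same square then so does the matrix. -/
theorem mul_self_eq_of_eigenvalues {A : Matrix V V ℝ} (hA : A.IsHermitian) {k : ℝ}
    (h : ∀ i, hA.eigenvalues i ^ 2 = k) : A * A = k • (1 : Matrix V V ℝ) := by
  obtain ⟨U, hU1, hU2, hAU⟩ := exists_spectral hA
  have h1 : diagonal hA.eigenvalues * diagonal hA.eigenvalues = k • (1 : Matrix V V ℝ) := by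
    rw [diagonal_mul_diagonal, ← diagonal_one, ← diagonal_smul]
    congr 1
    funext i
    simp [← h i, sq]
  calc A * A = U * diagonal hA.eigenvalues * Uᵀ * (U * diagonal hA.eigenvalues * Uᵀ) := by
        rw [← hAU]
    _ = U * (diagonal hA.eigenvalues * (Uᵀ * U) * diagonal hA.eigenvalues) * Uᵀ := by
        simp only [Matrix.mul_assoc]
    _ = k • (1 : Matrix V V ℝ) := by
        rw [hU2, Matrix.mul_one, h1, Matrix.mul_smul, Matrix.smul_mul, Matrix.mul_one, hU1]

theorem mul_self_diag_le {A : Matrix V V ℝ} (hA : A.IsHermitian) {k : ℝ}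
    (h : ∀ i, hA.eigenvalues i ^ 2 ≤ k) (v : V) : (A * A) v v ≤ k := by
  obtain ⟨U, hU1, hU2, hAU⟩ := exists_spectral hA
  have h0 : A * A = U * diagonal (fun i => hA.eigenvalues i ^ 2) * Uᵀ := by
    calc A * A = U * diagonal hA.eigenvalues * Uᵀ * (U * diagonal hA.eigenvalues * Uᵀ) := by
          rw [← hAU]
      _ = U * (diagonal hA.eigenvalues * (Uᵀ * U) * diagonal hA.eigenvalues) * Uᵀ := by
          simp only [Matrix.mul_assoc]
      _ = _ := by
          rw [hU2, Matrix.mul_one, diagonal_mul_diagonal]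
          simp only [sq]
  have h1 : ∀ f : V → ℝ, (U * diagonal f * Uᵀ) v v = ∑ i, U v i ^ 2 * f i := by
    intro f
    rw [mul_apply]
    refine Finset.sum_congr rfl fun i _ => ?_
    rw [mul_diagonal, transpose_apply]
    ring
  have h2 : ∑ i, U v i ^ 2 = 1 := by
    have := h1 1
    rw [show diagonal (1 : V → ℝ) = 1 from diagonal_one, Matrix.mul_one, hU1] at this
    simpa using this.symm
  rw [h0, h1]
  calc ∑ i, U v i ^ 2 * hA.eigenvalues i ^ 2 ≤ ∑ i, U v i ^ 2 * k :=
        Finset.sum_le_sum fun i _ => mul_le_mul_of_nonneg_left (h i) (sq_nonneg _)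
    _ = k := by rw [← Finset.sum_mul, h2, one_mul]

end Spectrum

/-! ### Claw-free graphs of maximum degree three -/

section SmallDegree

open scoped Classical

variable {V : Type*} [Fintype V] [DecidableEq V] {H : SimpleGraph V} {c : V → Fin 3}

/-- The cubic vanishes at `±√3`, so only the other eigenvalues contribute to its trace. The bound
`14 = 2 * 7` is what the ratio `7` requires and is not sharp. -/
theorem cubic_le {μ : ℝ} (h1 : -3 ≤ μ) (h2 : μ ≤ √3) : (3 - μ ^ 2) * (2 + μ) ≤ 14 := by
  have h3 := sqrt_three_bounds.2
  nlinarith [mul_nonneg (by linarith : 0 ≤ μ + 3) (sq_nonneg (μ - 1/2)), sq_nonneg (μ - 1/2),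
    sq_nonneg μ, mul_nonneg (by linarith : 0 ≤ μ + 3) (sq_nonneg μ)]

/-- The number of eigenvalues other than `±√3`. -/
theorem card_eq_two_mul_nullity_add (hA : (colMatrix H c).IsHermitian) :
    Fintype.card V = 2 * nullity (shiftMatrix √3 H c) +
      (Finset.univ.filter fun i => hA.eigenvalues i ^ 2 ≠ 3).card := by
  have h1 := card_eigenvalues_sq_eq sqrt_three_sq irrational_sqrt_three hA
  have h2 := Finset.card_filter_add_card_filter_not (s := (Finset.univ : Finset V))
    (fun i => hA.eigenvalues i ^ 2 = 3)
  norm_num at h1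
  rw [h1, Finset.card_univ] at h2
  exact h2.symm

/-- Graphs of maximum degree three without claws. -/
theorem card_le_of_no_claw (h : (shiftMatrix √3 H c).PosSemidef)
    (hdeg : ∀ x, (Finset.univ.filter fun y => H.Adj x y).card ≤ 3)
    (hcl : ∀ v a b d, ¬ IsClaw H v a b d) (hA : (colMatrix H c).IsHermitian) :
    Fintype.card V ≤ 7 * (Finset.univ.filter fun i => hA.eigenvalues i ^ 2 ≠ 3).card := by
  have hle : ∀ i, hA.eigenvalues i ≤ √3 := (posSemidef_iff_eigenvalues_le hA √3).1 h
  have hge : ∀ i, -3 ≤ hA.eigenvalues i := fun i => by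
    have := le_eigenvalues hA (colMatrix_form_ge hdeg) i
    simpa using this
  set R := (Finset.univ.filter fun i => hA.eigenvalues i ^ 2 ≠ 3).card with hR
  have hup : ∑ i, (3 - hA.eigenvalues i ^ 2) * (2 + hA.eigenvalues i) ≤ 14 * (R : ℝ) := by
    calc _ ≤ ∑ i, (if hA.eigenvalues i ^ 2 ≠ 3 then (14 : ℝ) else 0) := by
          refine Finset.sum_le_sum fun i _ => ?_
          by_cases h1 : hA.eigenvalues i ^ 2 = 3
          · simp [h1]
          · rw [if_pos h1]
            exact cubic_le (hge i) (hle i)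
      _ = 14 * (R : ℝ) := by
          rw [← Finset.sum_filter, Finset.sum_const, nsmul_eq_mul, mul_comm]
  -- The trace of `(3 - A²)(2 + A) = 6 + 3A - 2A² - A³`, written as a sum over vertices.
  have htr : ∑ i, (3 - hA.eigenvalues i ^ 2) * (2 + hA.eigenvalues i) =
      ∑ v, (6 - 2 * (H.degree v : ℝ) - (colMatrix H c ^ 3) v v) := by
    have t1 := trace_pow_eq_sum hA 1
    have t2 := trace_pow_eq_sum hA 2
    have t3 := trace_pow_eq_sum hA 3
    rw [pow_one, trace_colMatrix] at t1
    rw [trace_colMatrix_sq] at t2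
    simp only [pow_one] at t1
    have e : ∀ i, (3 - hA.eigenvalues i ^ 2) * (2 + hA.eigenvalues i) =
      6 + 3 * hA.eigenvalues i - 2 * hA.eigenvalues i ^ 2 - hA.eigenvalues i ^ 3 := fun i => by ring
    simp only [e, Finset.sum_sub_distrib, Finset.sum_add_distrib, ← Finset.mul_sum]
    rw [← t1, ← t2, ← t3, trace]
    simp
  -- Closed walks around triangles are all negative, as triangles are rainbow. Degree at most two
  -- already leaves `2`; at degree three, the absence of a claw gives a triangle, whose two
  -- orientations contribute the missing `2`.
  have hlow : ∀ v, 2 ≤ 6 - 2 * (H.degree v : ℝ) - (colMatrix H c ^ 3) v v := by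
    intro v
    have hdeg' : H.degree v = (Finset.univ.filter fun y => H.Adj v y).card := by
      rw [← SimpleGraph.card_neighborFinset_eq_degree, SimpleGraph.neighborFinset_eq_filter]
    have hexp : (colMatrix H c ^ 3) v v =
        ∑ u, ∑ w, colMatrix H c v u * colMatrix H c u w * colMatrix H c w v := by
      rw [pow_succ, pow_two, mul_apply, Finset.sum_comm]
      refine Finset.sum_congr rfl fun w _ => ?_
      rw [mul_apply, Finset.sum_mul]
    have hterm : ∀ u w, H.Adj v u → H.Adj u w → H.Adj w v →
        colMatrix H c v u * colMatrix H c u w * colMatrix H c w v = -1 := by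
      intro u w h1 h2 h3
      have e1 := color_ne_of_triangle h h1 h3.symm h2
      have e2 := color_ne_of_triangle h h2 h1.symm h3
      have e3 := color_ne_of_triangle h h3 h2.symm h1
      simp [colMatrix_apply, h1, h2, h3, e1, e2, e3]
    have hterm' : ∀ u w, colMatrix H c v u * colMatrix H c u w * colMatrix H c w v ≤ 0 := by
      intro u w
      by_cases h1 : H.Adj v u
      · by_cases h2 : H.Adj u w
        · by_cases h3 : H.Adj w v
          · rw [hterm u w h1 h2 h3]
            norm_num
          · simp [colMatrix_of_not_adj h3]
        · simp [colMatrix_of_not_adj h2]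
      · simp [colMatrix_of_not_adj h1]
    by_cases h2 : H.degree v ≤ 2
    · have h3 : (H.degree v : ℝ) ≤ 2 := by exact_mod_cast h2
      have h4 : (colMatrix H c ^ 3) v v ≤ 0 := by
        rw [hexp]
        exact Finset.sum_nonpos fun u _ => Finset.sum_nonpos fun w _ => hterm' u w
      linarith
    · have h3 : (Finset.univ.filter fun y => H.Adj v y).card = 3 := by
        have := hdeg v
        omega
      rw [hdeg', h3]
      obtain ⟨a, b, d, hab, had, hbd, hset⟩ := Finset.card_eq_three.1 h3
      have hmem : ∀ y ∈ ({a, b, d} : Finset V), H.Adj v y := fun y hy => by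
        rw [← hset] at hy
        exact (Finset.mem_filter.1 hy).2
      have hva := hmem a (by simp)
      have hvb := hmem b (by simp)
      have hvd := hmem d (by simp)
      obtain ⟨u, w, hu, hw, huw⟩ : ∃ u w, H.Adj v u ∧ H.Adj v w ∧ H.Adj u w := by
        by_contra hcon
        push Not at hcon
        exact hcl v a b d ⟨hva, hvb, hvd, hab, had, hbd, hcon a b hva hvb, hcon a d hva hvd,
          hcon b d hvb hvd⟩
      have h4 : (colMatrix H c ^ 3) v v ≤ -2 := by
        rw [hexp, ← Finset.sum_product']
        have h5 := Finset.sum_le_sum_of_subset_of_nonneg (s := {(u, w), (w, u)})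
          (t := (Finset.univ : Finset V) ×ˢ (Finset.univ : Finset V)) (f := fun q =>
            -(colMatrix H c v q.1 * colMatrix H c q.1 q.2 * colMatrix H c q.2 v)) (by simp)
          fun q _ _ => by linarith [hterm' q.1 q.2]
        rw [Finset.sum_pair (by simp [huw.ne])] at h5
        simp only [hterm u w hu huw hw.symm, hterm w u hw huw.symm hu.symm,
          Finset.sum_neg_distrib] at h5
        linarith
      push_cast
      linarith
  have hfin : (2 : ℝ) * Fintype.card V ≤ 14 * R := by
    refine le_trans ?_ (htr.symm.trans_le hup)
    refine le_trans (le_of_eq ?_) (Finset.sum_le_sum fun v _ => hlow v)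
    simp [mul_comm]
  have : 2 * Fintype.card V ≤ 14 * R := by exact_mod_cast hfin
  omega

end SmallDegree

/-! ### Vertices of degree at least four -/

section DegreeFour

open scoped Classical

variable {V K : Type*} [Fintype V] [DecidableEq V] {H : SimpleGraph V}

/-- An induced path on five vertices carries an eigenvector for `√3`. -/
theorem not_adj_of_path_five {c : V → K} (h : (shiftMatrix √3 H c).PosSemidef) {u : ℕ → V}
    (hu : IsInducedPath H 4 u) {y : V} (hy : ∀ i ≤ 4, y ≠ u i) (hy0 : ¬ H.Adj y (u 0)) :
    ¬ H.Adj y (u 2) ∧ ¬ H.Adj y (u 4) := by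
  -- The weights `1, √3, 2, √3, 1` form the top eigenvector of the path on five vertices.
  let wt : ℕ → ℝ := fun i => if i = 2 then 2 else if i = 1 ∨ i = 3 then √3 else 1
  have e4 : √3 * √3 = 3 := Real.mul_self_sqrt (by norm_num)
  have h1 := pathVec_form (lam := √3) (c := c) hu wt 4 le_rfl
  have h2 : √3 * ∑ i ∈ Finset.range 5, wt i ^ 2 - 2 * ∑ i ∈ Finset.range 4, wt i * wt (i + 1) = 0 := by
    simp [Finset.sum_range_succ, wt]
    ring
  rw [h2] at h1
  have h3 := congrFun (mulVec_eq_zero_of_posSemidef h h1) y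
  rw [mulVec_pathVec] at h3
  have hs : ∀ i ≤ 4, ∃ z : ℤ, (z = 1 ∨ z = -1) ∧ pathSign H c u i = z := by
    intro i hi
    have := pathSign_sq (c := c) hu i hi
    rcases mul_self_eq_one_iff.1 this with h | h
    · exact ⟨1, Or.inl rfl, by simp [h]⟩
    · exact ⟨-1, Or.inr rfl, by simp [h]⟩
  obtain ⟨z1, -, f1⟩ := hs 1 (by omega)
  obtain ⟨z2, g2, f2⟩ := hs 2 (by omega)
  obtain ⟨z3, -, f3⟩ := hs 3 (by omega)
  obtain ⟨z4, g4, f4⟩ := hs 4 (by omega)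
  obtain ⟨y1, k1⟩ := exists_int_colMatrix (H := H) (c := c) y (u 1)
  obtain ⟨y3, k3⟩ := exists_int_colMatrix (H := H) (c := c) y (u 3)
  simp only [Finset.sum_range_succ, Finset.sum_range_zero, zero_add,
    shiftMatrix_of_ne _ (hy 0 (by omega)), shiftMatrix_of_ne _ (hy 1 (by omega)),
    shiftMatrix_of_ne _ (hy 2 (by omega)), shiftMatrix_of_ne _ (hy 3 (by omega)),
    shiftMatrix_of_ne _ (hy 4 (by omega)), colMatrix_of_not_adj hy0, f1, f2, f3, f4, k1, k3,
    Pi.zero_apply] at h3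
  have hint : ∀ v, ∃ z : ℤ, (z = 0 ∨ z = 1 ∨ z = -1) ∧ colMatrix H c y v = z ∧ (z = 0 ↔ ¬ H.Adj y v) := by
    intro v
    by_cases hv : H.Adj y v
    · rcases colMatrix_eq_or (c := c) hv with h | h
      · exact ⟨1, by simp, by simp [h], by simp [hv]⟩
      · exact ⟨-1, by simp, by simp [h], by simp [hv]⟩
    · exact ⟨0, by simp, by simp [colMatrix_of_not_adj hv], by simp [hv]⟩
  obtain ⟨y2, m2, k2, n2⟩ := hint (u 2)
  obtain ⟨y4, m4, k4, n4⟩ := hint (u 4)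
  rw [k2, k4] at h3
  have h5 : √3 * ((z1 * y1 + z3 * y3 : ℤ) : ℝ) + ((2 * z2 * y2 + z4 * y4 : ℤ) : ℝ) = 0 := by
    push_cast
    simp [wt] at h3
    linarith
  -- The rational part reads `±2 * y2 ± y4 = 0` with `y2, y4 ∈ {0, 1, -1}`, so both vanish.
  have h6 := (sqrt_three_mul_add_eq_zero h5).2
  rw [← n2, ← n4]
  rcases g2 with rfl | rfl <;> rcases g4 with rfl | rfl <;> omega

variable {c : V → Fin 3}

/-- A vertex of degree at least four is not the center of a claw. -/
theorem not_isClaw_of_degree_four (h : (shiftMatrix √3 H c).PosSemidef) {v a b d : V}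
    (hv : 4 ≤ (Finset.univ.filter fun y => H.Adj v y).card) : ¬ IsClaw H v a b d := by
  intro hcl
  have h1 : (Finset.univ.filter fun y => H.Adj v y) ⊆ {a, b, d} := by
    intro y hy
    have := hcl.eq_of_adj h (Finset.mem_filter.1 hy).2
    simpa using this
  have h2 := Finset.card_le_card h1
  have h3 : ({a, b, d} : Finset V).card ≤ 3 := Finset.card_le_three
  omega

theorem card_le_two_of_independent (h : (shiftMatrix √3 H c).PosSemidef) {v : V}
    (hv : 4 ≤ (Finset.univ.filter fun y => H.Adj v y).card) {T : Finset V}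
    (hT : ∀ a ∈ T, H.Adj v a) (hind : ∀ a ∈ T, ∀ b ∈ T, ¬ H.Adj a b) : T.card ≤ 2 := by
  by_contra hcon
  obtain ⟨a, ha, b, hb, d, hd, hab, had, hbd⟩ := Finset.two_lt_card.1 (not_le.1 hcon)
  exact not_isClaw_of_degree_four h hv ⟨hT a ha, hT b hb, hT d hd, hab, had, hbd, hind a ha b hb,
    hind a ha d hd, hind b hb d hd⟩

/-- A neighbor `a` with the color of `v` lies in no triangle with `v`. The absence of claws then
makes three other neighbors pairwise adjacent, a complete graph on four vertices with `v`, needing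
four colors. -/
theorem color_ne_of_degree_four (h : (shiftMatrix √3 H c).PosSemidef) {v a : V}
    (hv : 4 ≤ (Finset.univ.filter fun y => H.Adj v y).card) (hva : H.Adj v a) : c a ≠ c v := by
  intro hc
  have hiso : ∀ b, H.Adj v b → ¬ H.Adj a b := fun b hvb hab =>
    color_ne_of_triangle h hva hvb hab hc.symm
  have h1 : 2 < ((Finset.univ.filter fun y => H.Adj v y).erase a).card := by
    rw [Finset.card_erase_of_mem (by simpa using hva)]
    omega
  obtain ⟨b, hb, d, hd, e, he, hbd, hbe, hde⟩ := Finset.two_lt_card.1 h1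
  simp only [Finset.mem_erase, Finset.mem_filter, Finset.mem_univ, true_and] at hb hd he
  have key : ∀ b d, b ≠ a → d ≠ a → H.Adj v b → H.Adj v d → b ≠ d → H.Adj b d := by
    intro b d hba hda hvb hvd hbd
    by_contra hcon
    exact not_isClaw_of_degree_four h hv ⟨hva, hvb, hvd, hba.symm, hda.symm, hbd, hiso b hvb,
      hiso d hvd, hcon⟩
  have k1 := key b d hb.1 hd.1 hb.2 hd.2 hbd
  have k2 := key b e hb.1 he.1 hb.2 he.2 hbe
  have k3 := key d e hd.1 he.1 hd.2 he.2 hde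
  have c1 := color_ne_of_triangle h k1 k2 k3
  have c2 := color_ne_of_triangle h k2 k1 k3.symm
  have c3 := color_ne_of_triangle h k3 k1.symm k2.symm
  have c4 := color_ne_of_triangle h hb.2 hd.2 k1
  have c5 := color_ne_of_triangle h hd.2 hb.2 k1.symm
  have c6 := color_ne_of_triangle h he.2 hb.2 k2.symm
  omega

/-- The neighborhood of a vertex of degree at least four. -/
theorem degree_four_structure (h : (shiftMatrix √3 H c).PosSemidef) {v p : V}
    (hv : 4 ≤ (Finset.univ.filter fun y => H.Adj v y).card) (hvp : H.Adj v p) :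
    (Finset.univ.filter fun y => H.Adj v y).card = 4 ∧
    (∃ p', p' ≠ p ∧ H.Adj v p' ∧ c p' = c p) ∧ ∃ q, H.Adj v q ∧ H.Adj p q := by
  set N := Finset.univ.filter fun y => H.Adj v y with hN
  have hmem : ∀ y, y ∈ N ↔ H.Adj v y := by simp [hN]
  have hcol : ∀ a b, H.Adj v a → H.Adj v b → c a = c b → ¬ H.Adj a b := fun a b ha hb hc hab =>
    color_ne_of_triangle h hab ha.symm hb.symm hc
  -- The neighbors use the two colors different from that of `v`. Each class is independent, hence
  -- has at most two elements, so both have exactly two.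
  have h1 : (N.filter fun y => c y = c p).card ≤ 2 := by
    refine card_le_two_of_independent h hv (fun a ha => (hmem a).1 (Finset.mem_filter.1 ha).1) ?_
    intro a ha b hb
    rw [Finset.mem_filter, hmem] at ha hb
    exact hcol a b ha.1 hb.1 (ha.2.trans hb.2.symm)
  have h2 : (N.filter fun y => ¬ c y = c p).card ≤ 2 := by
    refine card_le_two_of_independent h hv (fun a ha => (hmem a).1 (Finset.mem_filter.1 ha).1) ?_
    intro a ha b hb
    rw [Finset.mem_filter, hmem] at ha hb
    have e1 := color_ne_of_degree_four h hv ha.1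
    have e2 := color_ne_of_degree_four h hv hb.1
    have e3 := color_ne_of_degree_four h hv hvp
    exact hcol a b ha.1 hb.1 (by omega)
  have h3 := Finset.card_filter_add_card_filter_not (s := N) (fun y => c y = c p)
  refine ⟨by omega, ?_, ?_⟩
  · obtain ⟨p', hp', hne⟩ := Finset.exists_mem_ne
      (by omega : 1 < (N.filter fun y => c y = c p).card) p
    rw [Finset.mem_filter, hmem] at hp'
    exact ⟨p', hne, hp'⟩
  · obtain ⟨q, hq, q', hq', hne⟩ := Finset.one_lt_card.1
      (by omega : 1 < (N.filter fun y => ¬ c y = c p).card)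
    rw [Finset.mem_filter, hmem] at hq hq'
    by_contra hcon
    push Not at hcon
    have e1 := color_ne_of_degree_four h hv hq.1
    have e2 := color_ne_of_degree_four h hv hq'.1
    have e3 := color_ne_of_degree_four h hv hvp
    have e4 := hcol q q' hq.1 hq'.1 (by omega)
    exact not_isClaw_of_degree_four h hv ⟨hvp, hq.1, hq'.1, fun h => hq.2 (by rw [h]),
      fun h => hq'.2 (by rw [h]), hne, hcon q hq.1, hcon q' hq'.1, e4⟩

/-- Connected graphs with a vertex of degree at least four are small. -/
theorem card_le_of_degree_four (h : (shiftMatrix √3 H c).PosSemidef) (hH : NoSplit H) {v : V}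
    (hv : 4 ≤ (Finset.univ.filter fun y => H.Adj v y).card) : Fintype.card V ≤ 13 := by
  set N := Finset.univ.filter fun y => H.Adj v y with hN
  have hmem : ∀ y, y ∈ N ↔ H.Adj v y := by simp [hN]
  -- No vertex is at distance three from `v`. If `u w p v` were a geodesic, the twin `p'` of `p`
  -- would extend it to an induced path on five vertices, and another neighbor of `v` would see
  -- neither `p` nor `p'`, giving a claw at `v`.
  have hclosed : ∀ u w, H.Adj u w → (u = v ∨ H.Adj v u ∨ ∃ p, H.Adj v p ∧ H.Adj p u) →
      (w = v ∨ H.Adj v w ∨ ∃ p, H.Adj v p ∧ H.Adj p w) := by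
    intro w u hwu hw
    by_contra hcon
    push Not at hcon
    obtain ⟨huv, hvu, hpu⟩ := hcon
    rcases hw with rfl | hw | ⟨p, hvp, hpw⟩
    · exact hvu hwu
    · exact hpu w hw hwu
    · have hvw : ¬ H.Adj v w := fun h' => hpu w h' hwu
      have hwv : w ≠ v := fun h' => hvu (h' ▸ hwu)
      obtain ⟨-, ⟨p', hne, hvp', hcp⟩, -⟩ := degree_four_structure h hv hvp
      have hpp : ¬ H.Adj p p' := fun h' => color_ne_of_triangle h h' hvp.symm hvp'.symm hcp.symm
      have hp'w : ¬ H.Adj p' w := by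
        intro hp'w
        have h1 := induced_square h hvp hpw hp'w.symm hvp' hvw hpp hwv.symm hne.symm
        have e1 : colMatrix H c v p' = colMatrix H c v p := by
          simp [colMatrix_apply, hvp, hvp', hcp]
        have e2 : colMatrix H c w p' = colMatrix H c p w := by
          rw [colMatrix_symm]
          simp [colMatrix_apply, hpw, hp'w, hcp]
        rw [e1, e2] at h1
        have e3 := colMatrix_sq (c := c) hvp
        have e4 := colMatrix_sq (c := c) hpw
        have e5 : (1 : ℝ) = -1 := by
          linear_combination h1 - colMatrix H c p w * colMatrix H c p w * e3 - e4
        norm_num at e5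
      let f : ℕ → V := fun i => if i = 0 then u else if i = 1 then w else if i = 2 then p else
        if i = 3 then v else p'
      have hup : ¬ H.Adj u p := fun h' => hpu p hvp h'.symm
      have hup' : ¬ H.Adj u p' := fun h' => hpu p' hvp' h'.symm
      have huv' : ¬ H.Adj u v := fun h' => hvu h'.symm
      have hwv' : ¬ H.Adj w v := fun h' => hvw h'.symm
      have hwp' : ¬ H.Adj w p' := fun h' => hp'w h'.symm
      have n1 : u ≠ p := fun h' => hvu (h' ▸ hvp)
      have n2 : u ≠ p' := fun h' => hvu (h' ▸ hvp')
      have n3 : w ≠ p' := fun h' => hvw (h' ▸ hvp')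
      have hf : IsInducedPath H 4 f := by
        constructor
        · intro i hi
          interval_cases i <;> simp [f, hwu.symm, hpw.symm, hvp.symm, hvp']
        · intro i j hij hj
          have hi : i < 3 := by omega
          interval_cases i <;> interval_cases j
          · exact ⟨n1, hup⟩
          · exact ⟨huv, huv'⟩
          · exact ⟨n2, hup'⟩
          · exact ⟨hwv, hwv'⟩
          · exact ⟨n3, hwp'⟩
          · exact ⟨hne.symm, hpp⟩
      obtain ⟨y, hy, hy1, hy2⟩ : ∃ y, H.Adj v y ∧ y ≠ p ∧ y ≠ p' := by
        have h1 : 0 < ((N.erase p).erase p').card := by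
          have k1 := Finset.pred_card_le_card_erase (s := N) (a := p)
          have k2 := Finset.pred_card_le_card_erase (s := N.erase p) (a := p')
          omega
        obtain ⟨y, hy⟩ := Finset.card_pos.1 h1
        simp only [Finset.mem_erase, hmem] at hy
        exact ⟨y, hy.2.2, hy.2.1, hy.1⟩
      have hyall : ∀ i ≤ 4, y ≠ f i := by
        intro i hi
        interval_cases i
        · exact fun h' => hvu (by rw [show f 0 = u from rfl] at h'; exact h' ▸ hy)
        · exact fun h' => hvw (by rw [show f 1 = w from rfl] at h'; exact h' ▸ hy)
        · exact hy1
        · exact hy.ne'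
        · exact hy2
      obtain ⟨g1, g2⟩ := not_adj_of_path_five h hf hyall fun h' => hpu y hy h'
      exact not_isClaw_of_degree_four h hv ⟨hy, hvp, hvp', hy1, hy2, hne.symm, g1, g2, hpp⟩
  have huniv := hH _ hclosed v (Or.inl rfl)
  have hN4 : N.card = 4 := by
    obtain ⟨p, hp⟩ := Finset.card_pos.1 (by omega : 0 < N.card)
    exact (degree_four_structure h hv ((hmem p).1 hp)).1
  have hdeg : ∀ p, (Finset.univ.filter fun y => H.Adj p y).card ≤ 4 := by
    intro p
    by_contra hcon
    obtain ⟨q, hq⟩ := Finset.card_pos.1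
      (by omega : 0 < (Finset.univ.filter fun y => H.Adj p y).card)
    have := (degree_four_structure h (v := p) (by omega) (Finset.mem_filter.1 hq).2).1
    omega
  set B : V → Finset V := fun p => Finset.univ.filter fun y => H.Adj p y ∧ y ≠ v ∧ ¬ H.Adj v y with hB
  -- Of the at most four neighbors of `p`, one is `v` and one lies in the neighborhood of `v`. The
  -- total is at most `1 + 4 + 4 * 2 = 13`.
  have hBcard : ∀ p ∈ N, (B p).card ≤ 2 := by
    intro p hp
    rw [hmem] at hp
    obtain ⟨-, -, q, hvq, hpq⟩ := degree_four_structure h hv hp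
    have hsub : insert v (insert q (B p)) ⊆ Finset.univ.filter fun y => H.Adj p y := by
      intro y hy
      simp only [Finset.mem_insert, hB, Finset.mem_filter, Finset.mem_univ, true_and] at hy ⊢
      rcases hy with rfl | rfl | hy
      · exact hp.symm
      · exact hpq
      · exact hy.1
    have h1 := (Finset.card_le_card hsub).trans (hdeg p)
    rw [Finset.card_insert_of_notMem (by simp [hB, hvq.ne]),
      Finset.card_insert_of_notMem (by simp [hB, hvq])] at h1
    omega
  have hsub : (Finset.univ : Finset V) ⊆ insert v (N ∪ N.biUnion B) := by
    intro y _
    rw [Finset.mem_insert, Finset.mem_union, Finset.mem_biUnion, hmem]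
    by_cases h1 : y = v
    · exact Or.inl h1
    · by_cases h2 : H.Adj v y
      · exact Or.inr (Or.inl h2)
      · rcases huniv y with h3 | h3 | ⟨p, h3, h4⟩
        · exact absurd h3 h1
        · exact absurd h3 h2
        · exact Or.inr (Or.inr ⟨p, (hmem p).2 h3, by simp [hB, h4, h1, h2]⟩)
  have h1 := Finset.card_le_card hsub
  have h2 := Finset.card_insert_le v (N ∪ N.biUnion B)
  have h3 := Finset.card_union_le N (N.biUnion B)
  have h4 := Finset.card_biUnion_le_card_mul N B 2 hBcard
  rw [Finset.card_univ] at h1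
  omega

end DegreeFour

/-! ### The ratio `3 / 7` for `√3` and three colors -/

section ThreeColorBound

open scoped Classical

variable {V : Type*} [Fintype V] [DecidableEq V] {H : SimpleGraph V} {c : V → Fin 3}

/-- The eigenvalues `√3` and `-√3` cancel in the trace, which is zero. -/
theorem sum_eigenvalues_sq_ne_three (hA : (colMatrix H c).IsHermitian) :
    ∑ i, (if hA.eigenvalues i ^ 2 ≠ 3 then hA.eigenvalues i else 0) = 0 := by
  have h1 := card_eigenvalues_neg_sqrt sqrt_three_sq irrational_sqrt_three hA
  have h2 := card_eigenvalues_eq_nullity hA √3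
  rw [Nat.card_eq_fintype_card, Fintype.card_subtype] at h1 h2
  have h3 := trace_pow_eq_sum hA 1
  rw [pow_one, trace_colMatrix] at h3
  simp only [pow_one] at h3
  have hs : √3 ^ 2 = 3 := Real.sq_sqrt (by norm_num)
  have hpos : 0 < √3 := Real.sqrt_pos.2 (by norm_num)
  have h4 : ∀ i, hA.eigenvalues i = √3 * (if hA.eigenvalues i = √3 then 1 else 0) -
      √3 * (if hA.eigenvalues i = -√3 then 1 else 0) +
      (if hA.eigenvalues i ^ 2 ≠ 3 then hA.eigenvalues i else 0) := by
    intro i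
    by_cases e1 : hA.eigenvalues i = √3
    · have e2 : √3 ≠ -√3 := by linarith
      simp [e1, e2]
    · by_cases e2 : hA.eigenvalues i = -√3
      · have e3 : -√3 ≠ √3 := by linarith
        simp [e2, e3]
      · have e3 : hA.eigenvalues i ^ 2 ≠ 3 := by
          rw [← hs]
          exact fun h => (sq_eq_sq_iff_eq_or_eq_neg.1 h).elim e1 e2
        simp [e1, e2, e3]
  rw [Finset.sum_congr rfl fun i _ => h4 i, Finset.sum_add_distrib, Finset.sum_sub_distrib,
    ← Finset.mul_sum, ← Finset.mul_sum, Finset.sum_boole, Finset.sum_boole, h1, h2,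
    shiftMatrix] at h3
  linarith

/-- A connected three-colored graph with largest eigenvalue at most `√3`. -/
theorem nullity_sqrt_three_le (hH : NoSplit H) (h : (shiftMatrix √3 H c).PosSemidef) :
    (nullity (shiftMatrix √3 H c) : ℝ) ≤ 3 / 7 * Fintype.card V := by
  have hA : (colMatrix H c).IsHermitian := isHermitian_colMatrix
  have hcard := card_eq_two_mul_nullity_add (H := H) (c := c) hA
  set R := (Finset.univ.filter fun i => hA.eigenvalues i ^ 2 ≠ 3).card with hR
  -- With `n = 2m + R`, the claim `7m ≤ 3n` is equivalent to `n ≤ 7R`.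
  suffices hmain : Fintype.card V ≤ 7 * R by
    have h1 : 7 * nullity (shiftMatrix √3 H c) ≤ 3 * Fintype.card V := by omega
    have h2 : 7 * (nullity (shiftMatrix √3 H c) : ℝ) ≤ 3 * Fintype.card V := by exact_mod_cast h1
    linarith
  rcases isEmpty_or_nonempty V with hV | hV
  · rw [Fintype.card_eq_zero]
    omega
  have hR1 : 1 ≤ R := by
    by_contra hcon
    have h0 : R = 0 := by omega
    rw [hR, Finset.card_eq_zero, Finset.filter_eq_empty_iff] at h0
    exact colMatrix_sq_ne_three h (mul_self_eq_of_eigenvalues hA fun i =>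
      not_not.1 (h0 (Finset.mem_univ i)))
  by_cases hcl : ∃ v a b d, IsClaw H v a b d
  · obtain ⟨v, a, b, d, hcl⟩ := hcl
    -- If `R = 1` then `n` is odd, so `n ≤ 8` improves to `n ≤ 7`.
    have := hcl.card_le h hH
    omega
  push Not at hcl
  by_cases hdeg : ∃ v, 4 ≤ (Finset.univ.filter fun y => H.Adj v y).card
  · obtain ⟨v, hv⟩ := hdeg
    have h13 := card_le_of_degree_four h hH hv
    -- A single exceptional eigenvalue equals its sum, zero. Then every eigenvalue has square at
    -- most `3`, and so every degree is at most three.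
    have hR2 : R ≠ 1 := by
      intro h1
      obtain ⟨i₀, hi₀⟩ := Finset.card_eq_one.1 (hR ▸ h1)
      have hmem : ∀ i, hA.eigenvalues i ^ 2 ≠ 3 ↔ i = i₀ := by
        intro i
        have : i ∈ Finset.univ.filter (fun i => hA.eigenvalues i ^ 2 ≠ 3) ↔ i = i₀ := by
          rw [hi₀, Finset.mem_singleton]
        simpa using this
      have hsum := sum_eigenvalues_sq_ne_three (H := H) (c := c) hA
      simp only [hmem, Finset.sum_ite_eq', Finset.mem_univ, if_true] at hsum
      have hle : ∀ i, hA.eigenvalues i ^ 2 ≤ 3 := by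
        intro i
        by_cases hi : i = i₀
        · rw [hi, hsum]
          norm_num
        · exact (not_not.1 fun h' => hi ((hmem i).1 h')).le
      have h2 := mul_self_diag_le hA hle v
      have h3 : (colMatrix H c * colMatrix H c) v v =
          (Finset.univ.filter fun y => H.Adj v y).card := by
        rw [mul_apply, ← Finset.sum_boole]
        refine Finset.sum_congr rfl fun w _ => ?_
        rw [colMatrix_symm w v]
        by_cases hw : H.Adj v w
        · rw [colMatrix_sq hw, if_pos hw]
        · rw [colMatrix_of_not_adj hw, if_neg hw, zero_mul]
      have h4 : (4 : ℝ) ≤ (Finset.univ.filter fun y => H.Adj v y).card := by exact_mod_cast hv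
      linarith
    omega
  · push Not at hdeg
    exact card_le_of_no_claw h (fun x => by have := hdeg x; omega) hcl hA

end ThreeColorBound

/-! ### Smallest unsigned graphs with radius `√2` and `√3` -/

section SmallUnsigned

open scoped Classical

variable {V : Type*} [Fintype V] [DecidableEq V] {H : SimpleGraph V} {c : V → Unit}

theorem sum_degree_ge {K : Type*} {c : V → K} {k : ℚ} {s : ℝ} (hs : s ^ 2 = k)
    (hirr : Irrational s) (h0 : 0 < nullity (shiftMatrix s H c)) :
    2 * (k : ℝ) ≤ ∑ v, (H.degree v : ℝ) := by
  have hA : (colMatrix H c).IsHermitian := isHermitian_colMatrix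
  have h1 := card_eigenvalues_sq_eq hs hirr hA
  have hk : (0 : ℝ) ≤ k := by rw [← hs]; positivity
  rw [← trace_colMatrix_sq (c := c), trace_pow_eq_sum hA]
  calc 2 * (k : ℝ) ≤ (2 * nullity (shiftMatrix s H c) : ℕ) * (k : ℝ) := by
        gcongr
        have : 1 ≤ nullity (shiftMatrix s H c) := h0
        exact_mod_cast (by omega : 2 ≤ 2 * nullity (shiftMatrix s H c))
    _ = ∑ i ∈ Finset.univ.filter (fun i => hA.eigenvalues i ^ 2 = k), hA.eigenvalues i ^ 2 := by
        rw [Finset.sum_congr rfl fun i hi => (Finset.mem_filter.1 hi).2, ← h1]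
        simp
    _ ≤ ∑ i, hA.eigenvalues i ^ 2 := Finset.sum_le_sum_of_subset_of_nonneg
        (Finset.filter_subset _ _) fun i _ _ => sq_nonneg _

theorem sum_degree_le : ∑ v, (H.degree v : ℝ) ≤ Fintype.card V * (Fintype.card V - 1) := by
  calc ∑ v, (H.degree v : ℝ) ≤ ∑ _v : V, ((Fintype.card V : ℝ) - 1) := by
        refine Finset.sum_le_sum fun v _ => ?_
        have := H.degree_lt_card_verts v
        have h1 : (H.degree v : ℝ) + 1 ≤ Fintype.card V := by exact_mod_cast this
        linarith
    _ = Fintype.card V * (Fintype.card V - 1) := by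
        rw [Finset.sum_const, Finset.card_univ, nsmul_eq_mul]

/-- The eigenvalues `±√2` force `∑ deg ≥ 4`, too much for two vertices. -/
theorem three_le_card (h0 : 0 < nullity (shiftMatrix √2 H c)) : 3 ≤ Fintype.card V := by
  have h1 := (sum_degree_ge sqrt_two_sq irrational_sqrt_two h0).trans sum_degree_le
  by_contra hcon
  have h2 : (Fintype.card V : ℝ) ≤ 2 := by exact_mod_cast (by omega : Fintype.card V ≤ 2)
  have h3 : (0 : ℝ) ≤ Fintype.card V := by positivity
  norm_num at h1
  nlinarith

/-- The eigenvalues `±√3` force `∑ deg ≥ 6`, whereas the all-ones vector gives `∑ deg ≤ √3 * n`,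
less than `6` when `n ≤ 3`. -/
theorem four_le_card (h : (shiftMatrix √3 H c).PosSemidef) (h0 : 0 < nullity (shiftMatrix √3 H c)) :
    4 ≤ Fintype.card V := by
  have h1 := sum_degree_ge sqrt_three_sq irrational_sqrt_three h0
  by_contra hcon
  have h2 : (Fintype.card V : ℝ) ≤ 3 := by exact_mod_cast (by omega : Fintype.card V ≤ 3)
  have hform := (posSemidef_iff (isHermitian_shiftMatrix _)).1 h 1
  rw [shiftMatrix_form] at hform
  have h3 : ∑ u, ∑ v, colMatrix H c u v * ((1 : V → ℝ) u * (1 : V → ℝ) v) =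
      ∑ v, (H.degree v : ℝ) := by
    refine Finset.sum_congr rfl fun u _ => ?_
    rw [← SimpleGraph.card_neighborFinset_eq_degree, SimpleGraph.neighborFinset_eq_filter,
      ← Finset.sum_boole]
    refine Finset.sum_congr rfl fun v _ => ?_
    rw [colMatrix_apply, if_pos (Subsingleton.elim (c u) (c v))]
    simp
  rw [h3] at hform
  simp at hform
  norm_num at h1
  have h5 := sqrt_three_bounds
  nlinarith

end SmallUnsigned

/-! ### Values and achievability of `k_p(lam)` -/

section Parameters

open scoped Classical

theorem kParam_one_one : kParam 1 1 = ((2 : ℝ) : EReal) ∧ IsAchievable 1 1 := by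
  obtain ⟨H, c, hpsd, hn⟩ := exists_edge 1 le_rfl
  refine kParam_eq_and_isAchievable (fun n H c h => ?_) H c hpsd (by omega) (by rw [hn]; norm_num)
  have := nullity_le_of_unsigned (p := 1) (by norm_num) two_pos (fun V _ _ H c _ h0 => ?_) (Fin n) H c h
  · simpa using this
  · have h1 := nullity_le_card (shiftMatrix 1 H c)
    have : Nonempty V := Fintype.card_pos_iff.1 (by omega)
    have h2 := nullity_lt_card (H := H) (c := c) one_pos
    exact_mod_cast (by omega : 2 ≤ Fintype.card V)

theorem kParam_one {q : ℕ} (hq : 2 ≤ q) :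
    kParam q 1 = (((q : ℝ) / ((q : ℝ) - 1) : ℝ) : EReal) ∧ IsAchievable q 1 := by
  obtain ⟨hpsd, hn⟩ := negative_complete q hq
  have hq' : (2 : ℝ) ≤ q := by exact_mod_cast hq
  have hq1 : (0 : ℝ) < (q : ℝ) - 1 := by linarith
  refine kParam_eq_and_isAchievable (fun n H c h => ?_) _ _ hpsd ?_ ?_
  · have := nullity_one_le hq h
    rw [Fintype.card_fin] at this
    rw [div_mul_eq_mul_div, div_le_iff₀ hq1]
    linarith
  · have : (0 : ℝ) < nullity (shiftMatrix 1 (⊤ : SimpleGraph (Fin q)) id) := by rw [hn]; exact hq1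
    exact_mod_cast this
  · rw [hn]
    field_simp

theorem kParam_sqrt_two_of_le {q : ℕ} (hq : 1 ≤ q) (hq2 : q ≤ 2) :
    kParam q √2 = ((3 : ℝ) : EReal) ∧ IsAchievable q √2 := by
  obtain ⟨H, c, hpsd, hn⟩ := exists_path q hq
  refine kParam_eq_and_isAchievable (fun n H c h => ?_) H c hpsd (by omega) (by rw [hn]; norm_num)
  have := nullity_le_of_unsigned hq2 three_pos (fun V _ _ H c _ h0 => ?_) (Fin n) H c h
  · simpa using this
  · exact_mod_cast three_le_card h0

theorem kParam_sqrt_three_of_le {q : ℕ} (hq : 1 ≤ q) (hq2 : q ≤ 2) :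
    kParam q √3 = ((4 : ℝ) : EReal) ∧ IsAchievable q √3 := by
  obtain ⟨H, c, hpsd, hn⟩ := exists_claw q hq
  refine kParam_eq_and_isAchievable (fun n H c h => ?_) H c hpsd (by omega) (by rw [hn]; norm_num)
  have := nullity_le_of_unsigned hq2 four_pos (fun V _ _ H c hp h0 => ?_) (Fin n) H c h
  · simpa using this
  · exact_mod_cast four_le_card hp h0

theorem kParam_sqrt_two {q : ℕ} (hq : 3 ≤ q) :
    kParam q √2 = ((2 : ℝ) : EReal) ∧ IsAchievable q √2 := by
  obtain ⟨H, c, hpsd, hn⟩ := exists_square q hq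
  refine kParam_eq_and_isAchievable (fun n H c h => ?_) H c hpsd (by omega) (by rw [hn]; norm_num)
  have := two_mul_nullity_le (H := H) (c := c) sqrt_two_sq irrational_sqrt_two
  rw [Fintype.card_fin] at this
  exact_mod_cast this

theorem kParam_sqrt_three {q : ℕ} (hq : 4 ≤ q) :
    kParam q √3 = ((2 : ℝ) : EReal) ∧ IsAchievable q √3 := by
  obtain ⟨H, c, hpsd, hn⟩ := exists_cube q hq
  refine kParam_eq_and_isAchievable (fun n H c h => ?_) H c hpsd (by omega) (by rw [hn]; norm_num)
  have := two_mul_nullity_le (H := H) (c := c) sqrt_three_sq irrational_sqrt_three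
  rw [Fintype.card_fin] at this
  exact_mod_cast this

theorem kParam_three_sqrt_three :
    kParam 3 √3 = ((7 / 3 : ℝ) : EReal) ∧ IsAchievable 3 √3 := by
  obtain ⟨H, c, hpsd, hn⟩ := exists_punctured_cube 3 le_rfl
  refine kParam_eq_and_isAchievable (fun n H c h => ?_) H c hpsd (by omega) (by rw [hn]; norm_num)
  have := nullity_le_of_components_posSemidef
    (fun V _ _ H c hH h => nullity_sqrt_three_le hH h) (Fin n) H c h
  rw [Fintype.card_fin] at this
  linarith

theorem isAchievable_of_mem {l : ℝ} (hl : l = 1 ∨ l = √2 ∨ l = √3) {q : ℕ} (hq : 1 ≤ q) :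
    IsAchievable q l := by
  rcases hl with rfl | rfl | rfl
  · rcases Nat.lt_or_ge q 2 with h | h
    · obtain rfl : q = 1 := by omega
      exact kParam_one_one.2
    · exact (kParam_one h).2
  · rcases Nat.lt_or_ge q 3 with h | h
    · exact (kParam_sqrt_two_of_le hq (by omega)).2
    · exact (kParam_sqrt_two h).2
  · rcases Nat.lt_or_ge q 3 with h | h
    · exact (kParam_sqrt_three_of_le hq (by omega)).2
    · rcases Nat.lt_or_ge q 4 with h' | h'
      · obtain rfl : q = 3 := by omega
        exact kParam_three_sqrt_three.2
      · exact (kParam_sqrt_three h').2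

end Parameters

/-! ### Sizes of codes -/

section Asymptotics

open scoped Classical

theorem eqUpToConst_of_bounds {N : ℕ → ℕ} {κ : ℝ} (hκ : κ < 1)
    (hlow : ∃ C : ℝ, ∀ d : ℕ, (d : ℝ) - C ≤ (1 - κ) * N d)
    (hup : ∃ C : ℝ, ∀ d : ℕ, (1 - κ) * N d ≤ d + C) {g : ℕ → ℝ}
    (hg : ∀ d : ℕ, (1 - κ) * g d = d) : EqUpToConst N g := by
  obtain ⟨C₁, h1⟩ := hlow
  obtain ⟨C₂, h2⟩ := hup
  have hκ' : 0 < 1 - κ := by linarith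
  refine ⟨max C₁ C₂ / (1 - κ), fun d => ?_⟩
  rw [le_div_iff₀ hκ', mul_comm, ← abs_of_pos hκ', ← abs_mul, mul_sub, hg, abs_le]
  constructor
  · linarith [h1 d, le_max_left C₁ C₂]
  · linarith [h2 d, le_max_right C₁ C₂]

variable {α β lam : ℝ} {p : ℕ}

/-- The two inequalities characterize `p`: a color pattern with `p` parts is positive semidefinite,
one with `p + 1` parts is not. The first serves the constructions, the second the structure theorem.
-/
theorem colors_bounds (hβ0 : β < 0) (hα0 : 0 ≤ α) (hp : p = ⌊-α / β⌋₊ + 1) :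
    0 < p ∧ α + p * β < 0 ∧ 0 ≤ α + (p - 1) * β := by
  have h0 : 0 ≤ -α / β := div_nonneg_of_nonpos (by linarith) hβ0.le
  have h1 := Nat.floor_le h0
  have h2 := Nat.lt_floor_add_one (-α / β)
  rw [le_div_iff_of_neg hβ0] at h1
  rw [div_lt_iff_of_neg hβ0] at h2
  subst hp
  push_cast
  exact ⟨by omega, by linarith, by linarith⟩

/-- Every dimension carries a code of about the same size. -/
theorem exists_lower_bound_zero (hβ0 : β < 0) (hα0 : 0 ≤ α) (hα : α < 1)
    (hlam : lam = (1 - α) / (α - β)) (hlam0 : 0 < lam) (hp0 : 0 < p)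
    (hp : 0 ≤ α + (p - 1) * β) :
    ∃ C : ℝ, ∀ d : ℕ, (d : ℝ) - C ≤ (1 - 0) * maxCodeSize α β d := by
  have hM : shiftMatrix lam (⊥ : SimpleGraph Unit) (fun _ => (⟨0, hp0⟩ : Fin p)) = lam • 1 := by
    ext u v
    simp [shiftMatrix, colMatrix_apply]
  refine exists_lower_bound hβ0 hα0 hα hlam hp (⊥ : SimpleGraph Unit) (fun _ => ⟨0, hp0⟩) ?_ one_pos ?_
  · rw [posSemidef_iff (isHermitian_shiftMatrix lam), hM]
    intro x
    rw [smul_mulVec, one_mulVec, dotProduct_smul]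
    exact mul_nonneg hlam0.le (Finset.sum_nonneg fun u _ => mul_self_nonneg (x u))
  · have := nullity_lt_card (H := (⊥ : SimpleGraph Unit)) (c := fun _ => (⟨0, hp0⟩ : Fin p)) hlam0
    rw [Fintype.card_unit, Nat.lt_one_iff] at this
    rw [this]
    simp

theorem isLittleO_of_bounds {N : ℕ → ℕ} (hlow : ∃ C : ℝ, ∀ d : ℕ, (d : ℝ) - C ≤ N d)
    (hup : ∀ κ : ℝ, 0 < κ → ∃ C : ℝ, ∀ d : ℕ, (1 - κ) * N d ≤ d + C) :
    (fun d : ℕ => (N d : ℝ) - d) =o[Filter.atTop] (fun d : ℕ => (d : ℝ)) := by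
  rw [Asymptotics.isLittleO_iff]
  intro ε hε
  obtain ⟨C₁, h1⟩ := hlow
  -- The bound `1 / 2` gives `N ≤ 2 * (d + |C₂|)`, and then `ε / 4` keeps `κ * N` below `ε / 2 * (d
  -- + |C₂|)`.
  obtain ⟨C₂, h2⟩ := hup (min (1 / 2) (ε / 4)) (by positivity)
  set κ := min (1 / 2) (ε / 4) with hκ
  have hκ1 : κ ≤ 1 / 2 := min_le_left _ _
  have hκ2 : κ ≤ ε / 4 := min_le_right _ _
  have hκ0 : 0 < κ := by positivity
  filter_upwards [Filter.eventually_ge_atTop ⌈(max C₁ ((2 + ε) * |C₂|)) / ε⌉₊] with d hd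
  have hd' : max C₁ ((2 + ε) * |C₂|) ≤ ε * d := by
    have := (Nat.le_ceil _).trans (Nat.cast_le (α := ℝ).2 hd)
    rw [div_le_iff₀ hε] at this
    linarith
  have hC1 := (le_max_left _ _).trans hd'
  have hC2 := (le_max_right _ _).trans hd'
  have hd0 : (0 : ℝ) ≤ d := by positivity
  rw [Real.norm_eq_abs, Real.norm_of_nonneg hd0, abs_le]
  constructor
  · linarith [h1 d]
  · have h3 := h2 d
    have h4 := le_abs_self C₂
    have h5 : (N d : ℝ) ≤ 2 * (d + |C₂|) := by
      have : (0 : ℝ) ≤ N d := by positivity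
      nlinarith
    have h6 : κ * N d ≤ ε / 4 * (2 * (d + |C₂|)) := by
      have : (0 : ℝ) ≤ N d := by positivity
      gcongr
    nlinarith

/-- At most two colors: the spectral radius order decides. -/
theorem eqUpToConst_of_spectralRadiusOrder (hβ : -1 ≤ β) (hβ0 : β < 0) (hα0 : 0 ≤ α) (hα : α < 1)
    (hlam : lam = (1 - α) / (α - β)) (hlam0 : 0 < lam) (hp0 : 0 < p) (hp' : α + p * β < 0)
    (hp : 0 ≤ α + (p - 1) * β) (hp2 : p ≤ 2) {k : ℕ} (hk : spectralRadiusOrder lam = k) :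
    EqUpToConst (maxCodeSize α β) (fun d => (k : ℝ) * d / ((k : ℝ) - 1)) := by
  obtain ⟨H, hpsd, h0⟩ := exists_of_spectralRadiusOrder hk
  have hle := nullity_le_card (shiftMatrix lam H fun _ => ())
  rw [Fintype.card_fin] at hle
  have hk0 : 0 < k := by omega
  have : Nonempty (Fin k) := ⟨⟨0, hk0⟩⟩
  have hlt := nullity_lt_card (H := H) (c := fun _ => ()) hlam0
  rw [Fintype.card_fin] at hlt
  have hk1 : (1 : ℝ) < k := by exact_mod_cast (by omega : 1 < k)
  have hmin : ∀ (V : Type) [Fintype V] [DecidableEq V] (H : SimpleGraph V) (c : V → Unit),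
      (shiftMatrix lam H c).PosSemidef → 0 < nullity (shiftMatrix lam H c) →
      (k : ℝ) ≤ Fintype.card V := by
    intro V _ _ H c h h0
    have := spectralRadiusOrder_le h h0
    rw [hk] at this
    exact_mod_cast this
  refine eqUpToConst_of_bounds (κ := (k : ℝ)⁻¹) (inv_lt_one_of_one_lt₀ hk1) ?_ ?_ fun d => ?_
  · refine exists_lower_bound hβ0 hα0 hα hlam hp H (fun _ => ⟨0, hp0⟩)
      ((posSemidef_switching hp2).2 hpsd) (inv_lt_one_of_one_lt₀ hk1) ?_
    have h1 := nullity_le_of_unsigned hp2 (by linarith) hmin (Fin k) H (fun _ => ⟨0, hp0⟩)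
      ((posSemidef_switching hp2).2 hpsd)
    rw [nullity_switching hp2, Fintype.card_fin] at h1 ⊢
    rw [inv_mul_cancel₀ (by linarith)]
    have h2 : k * nullity (shiftMatrix lam H fun _ => ()) ≤ k * 1 := by
      rw [mul_one]
      exact_mod_cast h1
    have h3 := Nat.le_of_mul_le_mul_left h2 hk0
    exact_mod_cast (by omega : nullity (shiftMatrix lam H fun _ => ()) = 1)
  · refine exists_upper_bound hβ hβ0 hα0 hα hlam hp0 hp' (by positivity) fun Δ => ?_
    refine exists_nullity_bound_unsigned hp2 hlam0.le (by positivity) (fun V _ _ H c h h0 => ?_) Δ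
    rw [← div_eq_inv_mul, le_div_iff₀ (by linarith), one_mul]
    exact hmin V H c h h0
  · have : (k : ℝ) - 1 ≠ 0 := by linarith
    have : (k : ℝ) ≠ 0 := by linarith
    field_simp

theorem isLittleO_of_spectralRadiusOrder (hβ : -1 ≤ β) (hβ0 : β < 0) (hα0 : 0 ≤ α) (hα : α < 1)
    (hlam : lam = (1 - α) / (α - β)) (hlam0 : 0 < lam) (hp0 : 0 < p) (hp' : α + p * β < 0)
    (hp : 0 ≤ α + (p - 1) * β) (hp2 : p ≤ 2) (hk : spectralRadiusOrder lam = ⊤) :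
    (fun d : ℕ => (maxCodeSize α β d : ℝ) - d) =o[Filter.atTop] (fun d : ℕ => (d : ℝ)) := by
  refine isLittleO_of_bounds ?_ fun κ hκ => ?_
  · simpa using exists_lower_bound_zero hβ0 hα0 hα hlam hlam0 hp0 hp
  · refine exists_upper_bound hβ hβ0 hα0 hα hlam hp0 hp' hκ.le fun Δ => ?_
    refine exists_nullity_bound_unsigned hp2 hlam0.le hκ (fun V _ _ H c h h0 => ?_) Δ
    have := spectralRadiusOrder_le h h0
    rw [hk, top_le_iff] at this
    exact absurd this (ENat.natCast_ne_top _)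

theorem eqUpToConst_one (hβ : -1 ≤ β) (hβ0 : β < 0) (hα0 : 0 ≤ α) (hα : α < 1)
    (hlam : 1 = (1 - α) / (α - β)) (hp' : α + p * β < 0)
    (hp : 0 ≤ α + (p - 1) * β) (hp2 : 2 ≤ p) :
    EqUpToConst (maxCodeSize α β) (fun d => (p : ℝ) * d) := by
  have hp2' : (2 : ℝ) ≤ p := by exact_mod_cast hp2
  have hp0 : (0 : ℝ) < p := by linarith
  have hκ1 : ((p : ℝ) - 1) / p < 1 := by rw [div_lt_one hp0]; linarith
  refine eqUpToConst_of_bounds (κ := ((p : ℝ) - 1) / p) hκ1 ?_ ?_ fun d => ?_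
  · obtain ⟨hpsd, hn⟩ := negative_complete p hp2
    have : Nonempty (Fin p) := ⟨⟨0, by omega⟩⟩
    refine exists_lower_bound hβ0 hα0 hα hlam hp _ _ hpsd hκ1 ?_
    rw [hn, Fintype.card_fin]
    field_simp
  · refine exists_upper_bound hβ hβ0 hα0 hα hlam (by omega) hp'
      (div_nonneg (by linarith) hp0.le) fun Δ => ?_
    -- The path on three vertices with unit weights is negative, since `3 < 2 * 2`.
    refine exists_nullity_bound (D := 2) (w := fun _ => 1) (div_nonneg (by linarith) hp0.le)
      two_pos (by norm_num [Finset.sum_range_succ]) (fun V _ _ H c h => ?_) Δ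
    have := nullity_one_le hp2 h
    rw [div_mul_eq_mul_div, le_div_iff₀ hp0]
    linarith
  · field_simp
    ring

theorem eqUpToConst_three_sqrt_three (hβ : -1 ≤ β) (hβ0 : β < 0) (hα0 : 0 ≤ α) (hα : α < 1)
    (hlam : √3 = (1 - α) / (α - β)) (hp' : α + (3 : ℕ) * β < 0)
    (hp : 0 ≤ α + ((3 : ℕ) - 1) * β) :
    EqUpToConst (maxCodeSize α β) (fun d => 7 * (d : ℝ) / 4) := by
  refine eqUpToConst_of_bounds (κ := 3 / 7) (by norm_num) ?_ ?_ fun d => by ring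
  · obtain ⟨H, c, hpsd, hn⟩ := exists_punctured_cube 3 le_rfl
    refine exists_lower_bound hβ0 hα0 hα hlam hp H c hpsd (by norm_num) ?_
    rw [hn, Fintype.card_fin]
    norm_num
  · refine exists_upper_bound hβ hβ0 hα0 hα hlam three_pos hp' (by norm_num) fun Δ => ?_
    -- The weights `1, 2, 2, 2, 2, 1` give `18 * lam < 32`, true for `√3 < 16 / 9`.
    refine exists_nullity_bound (D := 5) (w := fun i => if i = 0 ∨ i = 5 then 1 else 2)
      (by norm_num) (by norm_num) ?_ (fun V _ _ H c h => ?_) Δ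
    · have := Real.sqrt_lt' (x := 3) (y := 1.75) (by norm_num)
      have h1 : √3 < 1.75 := this.2 (by norm_num)
      norm_num [Finset.sum_range_succ]
      linarith
    · exact nullity_le_of_components_posSemidef
        (fun V _ _ H c hH h => nullity_sqrt_three_le hH h) V H c h

theorem eqUpToConst_two (hβ : -1 ≤ β) (hβ0 : β < 0) (hα0 : 0 ≤ α) (hα : α < 1)
    (hlam : lam = (1 - α) / (α - β)) (hp0 : 0 < p) (hp' : α + p * β < 0)
    (hp : 0 ≤ α + (p - 1) * β) {k : ℚ} (hs : lam ^ 2 = k) (hirr : Irrational lam)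
    {V : Type*} [Fintype V] [DecidableEq V] [Nonempty V] (H : SimpleGraph V) (c : V → Fin p)
    (hpsd : (shiftMatrix lam H c).PosSemidef)
    (hn : Fintype.card V = 2 * nullity (shiftMatrix lam H c)) :
    EqUpToConst (maxCodeSize α β) (fun d => 2 * (d : ℝ)) := by
  refine eqUpToConst_of_bounds (κ := 1 / 2) (by norm_num) ?_ ?_ fun d => by ring
  · refine exists_lower_bound hβ0 hα0 hα hlam hp H c hpsd (by norm_num) ?_
    rw [hn]
    push_cast
    ring
  -- Conjugation bounds the multiplicity of every graph by half its order, so neither the degree nor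
  -- the negative index matters.
  · refine exists_upper_bound hβ hβ0 hα0 hα hlam hp0 hp' (by norm_num) fun Δ =>
      ⟨0, fun V _ _ H c _ _ => ?_⟩
    have h1 := two_mul_nullity_le (H := H) (c := c) hs hirr
    have h2 : 2 * (nullity (shiftMatrix lam H c) : ℝ) ≤ Fintype.card V := by exact_mod_cast h1
    linarith

end Asymptotics

end

theorem theorem1p6 (α β : ℝ) (hβ : -1 ≤ β) (hβ0 : β < 0) (hα0 : 0 ≤ α) (hα : α < 1)
    (lam : ℝ) (hlam : lam = (1 - α) / (α - β))
    (p : ℕ) (hp : p = ⌊-α / β⌋₊ + 1) :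
    -- the maximum size is attained in every dimension
    (∀ d : ℕ, IsGreatest (codeSizes α β d) (maxCodeSize α β d)) ∧
    -- (a)
    (p ≤ 2 →
      (∀ k : ℕ, spectralRadiusOrder lam = (k : ℕ∞) →
        EqUpToConst (maxCodeSize α β) (fun d => (k : ℝ) * d / ((k : ℝ) - 1))) ∧
      (spectralRadiusOrder lam = ⊤ →
        (fun d : ℕ => (maxCodeSize α β d : ℝ) - d) =o[Filter.atTop] (fun d : ℕ => (d : ℝ)))) ∧
    -- (b)
    (lam = 1 → 2 ≤ p →
      kParam p 1 = (((p : ℝ) / ((p : ℝ) - 1) : ℝ) : EReal) ∧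
      EqUpToConst (maxCodeSize α β) (fun d => (p : ℝ) * d)) ∧
    -- (c)
    (lam = √3 → p = 3 →
      kParam 3 √3 = ((7 / 3 : ℝ) : EReal) ∧
      EqUpToConst (maxCodeSize α β) (fun d => 7 * (d : ℝ) / 4)) ∧
    -- (d)
    (lam = √2 ∨ lam = √3 → lam ^ 2 + 1 ≤ (p : ℝ) →
      kParam p lam = ((2 : ℝ) : EReal) ∧
      EqUpToConst (maxCodeSize α β) (fun d => 2 * (d : ℝ))) ∧
    -- achievability, for all positive integers `q`
    (∀ l : ℝ, l = 1 ∨ l = √2 ∨ l = √3 → ∀ q : ℕ, 1 ≤ q → IsAchievable q l) := by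
  obtain ⟨hp0, hp', hp1⟩ := colors_bounds hβ0 hα0 hp
  have hlam0 : 0 < lam := by
    rw [hlam]
    exact div_pos (by linarith) (by linarith)
  refine ⟨fun d => isGreatest_maxCodeSize (by linarith) hα d, fun hp2 => ⟨fun k hk => ?_, fun hk => ?_⟩,
    fun hl hp2 => ?_, fun hl hp3 => ?_, fun hl hp2 => ?_,
    fun l hl q hq => isAchievable_of_mem hl hq⟩
  · exact eqUpToConst_of_spectralRadiusOrder hβ hβ0 hα0 hα hlam hlam0 hp0 hp' hp1 hp2 hk
  · exact isLittleO_of_spectralRadiusOrder hβ hβ0 hα0 hα hlam hlam0 hp0 hp' hp1 hp2 hk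
  · exact ⟨(kParam_one hp2).1, eqUpToConst_one hβ hβ0 hα0 hα (hl ▸ hlam) hp' hp1 hp2⟩
  · subst hp3
    exact ⟨kParam_three_sqrt_three.1, eqUpToConst_three_sqrt_three hβ hβ0 hα0 hα (hl ▸ hlam) hp' hp1⟩
  · rcases hl with rfl | rfl
    · have h3 : 3 ≤ p := by
        rw [Real.sq_sqrt (by norm_num)] at hp2
        exact_mod_cast (by linarith : (3 : ℝ) ≤ p)
      obtain ⟨H, c, hpsd, hn⟩ := exists_square p h3
      exact ⟨(kParam_sqrt_two h3).1, eqUpToConst_two hβ hβ0 hα0 hα hlam hp0 hp' hp1 sqrt_two_sq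
        irrational_sqrt_two H c hpsd (by rw [hn, Fintype.card_fin])⟩
    · have h4 : 4 ≤ p := by
        rw [Real.sq_sqrt (by norm_num)] at hp2
        exact_mod_cast (by linarith : (4 : ℝ) ≤ p)
      obtain ⟨H, c, hpsd, hn⟩ := exists_cube p h4
      exact ⟨(kParam_sqrt_three h4).1, eqUpToConst_two hβ hβ0 hα0 hα hlam hp0 hp' hp1 sqrt_three_sq
        irrational_sqrt_three H c hpsd (by rw [hn, Fintype.card_fin])⟩
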